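/- Let $d\in\{2,3\}$, $k\ge 1$ and $\gamma>0$. There is a constant $\beta_0>0$, depending only on $d$, $k$, $\gamma$, such that the following holds. Let $\Omega\subset\mathbb R^d$ be a bounded polygonal/polyhedral domain (open, connected, equal to the interior of its closure), with $\partial\Omega=\overline{\Gamma}_D\cup\overline{\Gamma}_T=\overline{\Gamma}_P\cup\overline{\Gamma}_F$, $\Gamma_D\cap\Gamma_T=\emptyset=\Gamma_P\cap\Gamma_F$, $|\Gamma_D|>0$, $|\Gamma_P|>0$. Let $\mathcal T$ be a conforming triangulation of $\overline\Omega$ into finitely many $d$-simplices such that $\overline{\Gamma}_D,\overline{\Gamma}_T,\overline{\Gamma}_P,\overline{\Gamma}_F$ are unions of facets, and such that every $K\in\mathcal T$, of diameter $h_K$, contains a ball of diameter $\rho>0$ with $h_K\le\gamma\rho$. Let $\Gamma_0$ be the union of the set $\mathcal F$ of all facets and $n$ the outward unit normal on $\partial K$. A facet is said to lie on $\Gamma$ if it is contained in $\overline\Gamma$. Put $$\begin{aligned} V_h&=\{v\in[L^2(\Omega)]^d: v|_K\in[\mathbb P_k(K)]^d\ \forall K\in\mathcal T\},\qquad Q_h=\{q\in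 L^2(\Omega): q|_K\in\mathbb P_{k-1}(K)\ \forall K\in\mathcal T\},\\ \bar V_h&=\{\bar v\in[L^2(\Gamma_0)]^d:\bar v|_F\in[\mathbb P_k(F)]^d\ \forall F\in\mathcal F,\ \bar v=0\text{ on the facets lying on }\Gamma_D\},\\ \bar Q_h&=\{\bar q\in L^2(\Gamma_0):\bar q|_F\in\mathbb P_k(F)\ \forall F\in\mathcal F\},\qquad \bar Q_h^0=\{\bar q\in\bar Q_h:\bar q=0\text{ on the facets lying on }\Gamma_P\} \end{aligned}$$ for the HDG method; for the EDG-HDG method $\bar V_h$ is replaced by $\bar V_h\cap [C^0(\Gamma_0)]^d$. Let $\boldsymbol V_h=V_h\times\bar V_h$, $\boldsymbol Q_h=Q_h\times\bar Q_h$, $\boldsymbol Q_h^0=Q_h\times\bar Q_h^0$, $\boldsymbol X_h=\boldsymbol V_h\times\boldsymbol Q_h\times V_h\times\boldsymbol Q_h^0$, and write $\boldsymbol v=(v,\bar v)$, $\boldsymbol q=(q,\bar q)$. Let $\mu,\lambda,\kappa>0$, $c_0\ge0$, $0<\alpha<1$ be constants, and for $\beta>\beta_0$ and $\varepsilon(v)=\frac12(\nabla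 v+\nabla v^{T})$ (elementwise) define $$\begin{aligned} a_h(\boldsymbol u,\boldsymbol v)={}&\sum_{K}\int_K 2\mu\,\varepsilon(u):\varepsilon(v)\,dx+\sum_K\int_{\partial K}\tfrac{2\beta\mu}{h_K}(u-\bar u)\cdot(v-\bar v)\,ds\\ &-\sum_K\int_{\partial K}2\mu\,\varepsilon(u)n\cdot(v-\bar v)\,ds-\sum_K\int_{\partial K}2\mu\,\varepsilon(v)n\cdot(u-\bar u)\,ds,\\ b_h(\boldsymbol v,\boldsymbol q)={}&-\sum_K\int_K q\,\nabla\cdot v\,dx+\sum_K\int_{\partial K}\bar q\,(v-\bar v)\cdot n\,ds . \end{aligned}$$ Let $t^n=n\Delta t$, $0\le n\le N$, $\Delta t=T/N$, with $T>0$, $N\ge1$, and let $f^{n+1}=f(t^{n+1})\in[L^2(\Omega)]^d$, $g^{n+1}=g(t^{n+1})\in L^2(\Omega)$ for $0\le n<N$. **Theorem.** For both methods, for every $0\le n<N$ and every $(\boldsymbol u_h^n,\boldsymbol p_{Th}^n,z_h^n,\boldsymbol p_h^n)\in\boldsymbol X_h$, there is exactly one $(\boldsymbol u_h^{n+1},\boldsymbol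 p_{Th}^{n+1},z_h^{n+1},\boldsymbol p_h^{n+1})\in\boldsymbol X_h$ such that for all $(\boldsymbol v_h,\boldsymbol q_{Th},w_h,\boldsymbol q_h)\in\boldsymbol X_h$ $$\begin{aligned} &a_h(\boldsymbol u_h^{n+1},\boldsymbol v_h)+b_h(\boldsymbol v_h,\boldsymbol p_{Th}^{n+1})=(f^{n+1},v_h)_\Omega,\\ &b_h(\boldsymbol u_h^{n+1},\boldsymbol q_{Th})+\lambda^{-1}(\alpha p_h^{n+1}-p_{Th}^{n+1},q_{Th})_\Omega=0,\\ &\kappa^{-1}(z_h^{n+1},w_h)_\Omega+b_h((w_h,0),\boldsymbol p_h^{n+1})=0,\\ &\tfrac1{\Delta t}\big((c_0p_h^{n+1},q_h)_\Omega+\lambda^{-1}(\alpha p_h^{n+1}-p_{Th}^{n+1},\alpha q_h)_\Omega\big)-b_h((z_h^{n+1},0),\boldsymbol q_h)\\ &\qquad=\tfrac1{\Delta t}\big((c_0p_h^{n},q_h)_\Omega+\lambda^{-1}(\alpha p_h^{n}-p_{Th}^{n},\alpha q_h)_\Omega\big)+(g^{n+1},q_h)_\Omega . \end{aligned}$$ Moreover,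 for any initial state in $\boldsymbol X_h$ there is exactly one sequence of states at the levels $n=0,\dots,N$ that starts with it and satisfies these equations for all $0\le n<N$. -/

import Mathlib

open MeasureTheory

namespace BiotHDG

noncomputable section

/-- The Euclidean space `ℝ^d`. -/
abbrev Pt (d : ℕ) : Type := EuclideanSpace ℝ (Fin d)

/-! ### Domain, boundary partition, triangulation -/

/-- A bounded polygonal domain, up to the existence of a triangulation (see `Mesh`, which also gives
boundedness): an open connected set that is the interior of its closure (no slits). -/
structure IsPolygonalDomain {d : ℕ} (Ω : Set (Pt d)) : Prop where
  isOpen : IsOpen Ω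
  isConnected : IsConnected Ω
  interior_closure : interior (closure Ω) = Ω

/-- `∂Ω = closure A ∪ closure B`, where `A, B ⊆ ∂Ω` are disjoint and `A` has positive
`(d-1)`-dimensional measure. -/
structure IsBoundaryPartition {d : ℕ} (Ω A B : Set (Pt d)) : Prop where
  closure_union : closure A ∪ closure B = frontier Ω
  disjoint : Disjoint A B
  pos : 0 < (μHE[d - 1] : Measure (Pt d)) A

/-- A conforming triangulation of `closure Ω` by finitely many `d`-simplices. -/
structure Mesh {d : ℕ} (Ω : Set (Pt d)) extends Geometry.SimplicialComplex ℝ (Pt d) where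
  finite_faces : faces.Finite
  pure : ∀ s ∈ faces, ∃ t ∈ faces, s ⊆ t ∧ t.card = d + 1
  space_eq : toSimplicialComplex.space = closure Ω

namespace Mesh

variable {d : ℕ} {Ω : Set (Pt d)}

/-- The elements of the triangulation, given by their `d + 1` vertices. -/
def Elem (T : Mesh Ω) : Type := {s : Finset (Pt d) // s ∈ T.faces ∧ s.card = d + 1}

/-- The facets of the triangulation, given by their `d` vertices. -/
def Facet (T : Mesh Ω) : Type := {s : Finset (Pt d) // s ∈ T.faces ∧ s.card = d}

instance (T : Mesh Ω) : Finite T.Elem :=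
  (T.finite_faces.subset fun _ h => h.1 :
    {s : Finset (Pt d) | s ∈ T.faces ∧ s.card = d + 1}.Finite).to_subtype

instance (T : Mesh Ω) : Finite T.Facet :=
  (T.finite_faces.subset fun _ h => h.1 :
    {s : Finset (Pt d) | s ∈ T.faces ∧ s.card = d}.Finite).to_subtype

instance (T : Mesh Ω) : Fintype T.Elem := Fintype.ofFinite _

instance (T : Mesh Ω) : Fintype T.Facet := Fintype.ofFinite _

/-- The closed simplex `K ⊆ ℝ^d`. -/
def Elem.set {T : Mesh Ω} (K : T.Elem) : Set (Pt d) := convexHull ℝ (K.1 : Set (Pt d))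

/-- The closed facet `F ⊆ ℝ^d`. -/
def Facet.set {T : Mesh Ω} (F : T.Facet) : Set (Pt d) := convexHull ℝ (F.1 : Set (Pt d))

open Classical in
/-- The facets that make up `∂K`. -/
def Elem.bdry {T : Mesh Ω} (K : T.Elem) : Finset T.Facet := {F : T.Facet | F.1 ⊆ K.1}

/-- The diameter `h_K`. -/
def Elem.h {T : Mesh Ω} (K : T.Elem) : ℝ := Metric.diam K.set

/-- The outward unit normal of `K` on its facet `F`: the normalized component orthogonal to `F` of
the vector from the barycentre of `K` to the barycentre of `F`. -/
def Elem.normal {T : Mesh Ω} (K : T.Elem) (F : T.Facet) : Pt d :=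
  let w : Pt d := (vectorSpan ℝ (F.1 : Set (Pt d)))ᗮ.starProjection
    (F.1.centroid ℝ id - K.1.centroid ℝ id)
  ‖w‖⁻¹ • w

/-- Surface measure on the facet `F`. -/
def Facet.surf {T : Mesh Ω} (F : T.Facet) : Measure F.set :=
  (μHE[d - 1] : Measure (Pt d)).comap Subtype.val

/-- The skeleton `Γ₀`, the union of all facets. -/
def skeleton (T : Mesh Ω) : Set (Pt d) := ⋃ F : T.Facet, F.set

/-- Shape regularity with constant `γ`: every element `K` contains a ball of diameter `ρ` with
`h_K ≤ γ ρ`. -/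
def ShapeRegular (T : Mesh Ω) (γ : ℝ) : Prop :=
  ∀ K : T.Elem, ∃ x : Pt d, ∃ ρ : ℝ, 0 < ρ ∧ Metric.closedBall x (ρ / 2) ⊆ K.set ∧ K.h ≤ γ * ρ

/-- The facet `F` lies on the part `Γ` of the boundary. -/
def Facet.LiesOn {T : Mesh Ω} (F : T.Facet) (Γ : Set (Pt d)) : Prop := F.set ⊆ closure Γ

/-- The triangulation resolves `Γ ⊆ ∂Ω`: its closure is the union of the facets lying on it. -/
def Resolves (T : Mesh Ω) (Γ : Set (Pt d)) : Prop :=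
  closure Γ = ⋃ F : {F : T.Facet // F.LiesOn Γ}, F.1.set

end Mesh

/-! ### Polynomial spaces -/

/-- Polynomials of total degree at most `l` on `ℝ^d`. As the elements have nonempty interior, this is
`ℙ_l(K)` for every element `K`. -/
abbrev Poly (d l : ℕ) : Type := MvPolynomial.restrictTotalDegree (Fin d) ℝ l

/-- The value of a polynomial at a point of `ℝ^d`. -/
def val {d : ℕ} (p : MvPolynomial (Fin d) ℝ) (x : Pt d) : ℝ := MvPolynomial.eval (fun i => x i) p

section Spaces

variable {d : ℕ} {Ω : Set (Pt d)}

/-- `ℙ_l(F)`: the functions on the facet `F` that are restrictions of polynomials of degree at most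
`l`. -/
def facetPoly {T : Mesh Ω} (l : ℕ) (F : T.Facet) : Submodule ℝ (F.set → ℝ) where
  carrier := {φ | ∃ p : Poly d l, ∀ x, φ x = val p.1 x.1}
  zero_mem' := ⟨0, fun x => by simp [val]⟩
  add_mem' := by
    rintro a b ⟨p, hp⟩ ⟨q, hq⟩
    exact ⟨p + q, fun x => by simp [val, hp, hq]⟩
  smul_mem' := by
    rintro c a ⟨p, hp⟩
    exact ⟨c • p, fun x => by simp [val, hp]⟩

/-- Scalar functions on the skeleton, given facet by facet. -/
abbrev SkelFun (T : Mesh Ω) : Type := ∀ F : T.Facet, F.set → ℝ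

/-- Vector-valued functions on the skeleton, given component by component. -/
abbrev SkelField (T : Mesh Ω) : Type := Fin d → SkelFun T

/-- The functions on the skeleton (given facet by facet) that come from one continuous function on
`Γ₀`. -/
def skelContinuous (T : Mesh Ω) : Submodule ℝ (SkelFun T) where
  carrier := {φ | ∃ g : Pt d → ℝ, ContinuousOn g T.skeleton ∧ ∀ F (x : F.set), φ F x = g x}
  zero_mem' := ⟨0, continuousOn_const, fun _ _ => rfl⟩
  add_mem' := by
    rintro a b ⟨g, hg, hga⟩ ⟨k, hk, hkb⟩
    exact ⟨g + k, hg.add hk, fun F x => by simp [hga, hkb]⟩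
  smul_mem' := by
    rintro c a ⟨g, hg, hga⟩
    exact ⟨c • g, hg.const_smul c, fun F x => by simp [hga]⟩

/-- The scalar functions on the skeleton that are of degree at most `l` on every facet and vanish on
the facets lying on `Γ`. -/
def skelPoly (T : Mesh Ω) (l : ℕ) (Γ : Set (Pt d)) : Submodule ℝ (SkelFun T) where
  carrier := {φ | (∀ F, φ F ∈ facetPoly l F) ∧ ∀ F : T.Facet, F.LiesOn Γ → φ F = 0}
  zero_mem' := ⟨fun F => (facetPoly l F).zero_mem, fun _ _ => rfl⟩
  add_mem' := by
    rintro a b ⟨ha, ha'⟩ ⟨hb, hb'⟩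
    exact ⟨fun F => (facetPoly l F).add_mem (ha F) (hb F),
      fun F hF => by simp [ha' F hF, hb' F hF]⟩
  smul_mem' := by
    rintro c a ⟨ha, ha'⟩
    exact ⟨fun F => (facetPoly l F).smul_mem c (ha F), fun F hF => by simp [ha' F hF]⟩

/-- The two methods. -/
inductive Method
  | hdg
  | edghdg

/-- The scalar component space of `V̄_h`: for the EDG-HDG method it is intersected with `C⁰(Γ₀)`. -/
def traceSpace (T : Mesh Ω) (k : ℕ) (ΓD : Set (Pt d)) : Method → Submodule ℝ (SkelFun T)
  | .hdg => skelPoly T k ΓD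
  | .edghdg => skelPoly T k ΓD ⊓ skelContinuous T

/-- `V_h`: vector fields that are of degree at most `k` on every element. -/
abbrev Vh (T : Mesh Ω) (k : ℕ) : Type := T.Elem → Fin d → Poly d k

/-- `V̄_h`. -/
abbrev VbarH (T : Mesh Ω) (k : ℕ) (ΓD : Set (Pt d)) (m : Method) : Type :=
  Fin d → traceSpace T k ΓD m

/-- `Q_h`: functions that are of degree at most `k - 1` on every element. -/
abbrev Qh (T : Mesh Ω) (k : ℕ) : Type := T.Elem → Poly d (k - 1)

/-- `Q̄_h`. -/
abbrev QbarH (T : Mesh Ω) (k : ℕ) : Type := skelPoly T k (∅ : Set (Pt d))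

/-- `Q̄_h⁰`. -/
abbrev QbarH0 (T : Mesh Ω) (k : ℕ) (ΓP : Set (Pt d)) : Type := skelPoly T k ΓP

/-- The pair space `V_h × V̄_h`. -/
abbrev VV (T : Mesh Ω) (k : ℕ) (ΓD : Set (Pt d)) (m : Method) : Type := Vh T k × VbarH T k ΓD m

/-- The pair space `Q_h × Q̄_h`. -/
abbrev QQ (T : Mesh Ω) (k : ℕ) : Type := Qh T k × QbarH T k

/-- The pair space `Q_h × Q̄_h⁰`. -/
abbrev QQ0 (T : Mesh Ω) (k : ℕ) (ΓP : Set (Pt d)) : Type := Qh T k × QbarH0 T k ΓP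

/-- `X_h`, with elements `(u, p_T, z, p)` where `u`, `p_T`, `p` are pairs. -/
abbrev Xh (T : Mesh Ω) (k : ℕ) (ΓD ΓP : Set (Pt d)) (m : Method) : Type :=
  VV T k ΓD m × QQ T k × Vh T k × QQ0 T k ΓP

/-- The function on the skeleton underlying an element of `V̄_h`. -/
def VbarH.toField {T : Mesh Ω} {k : ℕ} {ΓD : Set (Pt d)} {m : Method} (v : VbarH T k ΓD m) :
    SkelField T := fun i => (v i).1

end Spaces

/-! ### Forms -/

section Forms

variable {d : ℕ} {Ω : Set (Pt d)} {T : Mesh Ω}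

/-- The entry `(i, j)` of the symmetric gradient of `v` on `K`. -/
def eps {k : ℕ} (v : Vh T k) (K : T.Elem) (i j : Fin d) : MvPolynomial (Fin d) ℝ :=
  (2⁻¹ : ℝ) • (MvPolynomial.pderiv j (v K i).1 + MvPolynomial.pderiv i (v K j).1)

/-- The divergence of `v` on `K`. -/
def divg {k : ℕ} (v : Vh T k) (K : T.Elem) : MvPolynomial (Fin d) ℝ :=
  ∑ i, MvPolynomial.pderiv i (v K i).1

/-- The component `i` of `v - v̄` on the facet `F` of `K`. -/
def jmp {k : ℕ} (v : Vh T k) (vbar : SkelField T) (K : T.Elem) (F : T.Facet) (i : Fin d)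
    (x : F.set) : ℝ := val (v K i).1 x.1 - vbar i F x

/-- The component `i` of `ε(v) n` on the facet `F` of `K`. -/
def epsn {k : ℕ} (v : Vh T k) (K : T.Elem) (F : T.Facet) (i : Fin d) (x : F.set) : ℝ :=
  ∑ j, val (eps v K i j) x.1 * K.normal F j

/-- The form `a_h`, with Lamé constant `μ` and penalty parameter `β`. -/
def ah {k : ℕ} (μ β : ℝ) (u : Vh T k) (ubar : SkelField T) (v : Vh T k) (vbar : SkelField T) : ℝ :=
  (∑ K : T.Elem, ∫ x in K.set, ∑ i, ∑ j, 2 * μ * val (eps u K i j) x * val (eps v K i j) x)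
  + (∑ K : T.Elem, ∑ F ∈ K.bdry, ∫ x, 2 * β * μ / K.h *
      ∑ i, jmp u ubar K F i x * jmp v vbar K F i x ∂F.surf)
  - (∑ K : T.Elem, ∑ F ∈ K.bdry, ∫ x, ∑ i, 2 * μ * epsn u K F i x * jmp v vbar K F i x ∂F.surf)
  - (∑ K : T.Elem, ∑ F ∈ K.bdry, ∫ x, ∑ i, 2 * μ * epsn v K F i x * jmp u ubar K F i x ∂F.surf)

/-- The form `b_h`. -/
def bh {k l : ℕ} (v : Vh T k) (vbar : SkelField T) (q : T.Elem → Poly d l) (qbar : SkelFun T) : ℝ :=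
  - (∑ K : T.Elem, ∫ x in K.set, val (q K).1 x * val (divg v K) x)
  + ∑ K : T.Elem, ∑ F ∈ K.bdry, ∫ x, qbar F x * ∑ i, jmp v vbar K F i x * K.normal F i ∂F.surf

/-- `(p, q)_Ω` for piecewise polynomials. -/
def ipQ {l : ℕ} (p q : T.Elem → Poly d l) : ℝ :=
  ∑ K : T.Elem, ∫ x in K.set, val (p K).1 x * val (q K).1 x

/-- `(z, w)_Ω` for piecewise polynomial vector fields. -/
def ipV {k : ℕ} (z w : Vh T k) : ℝ :=
  ∑ K : T.Elem, ∫ x in K.set, ∑ i, val (z K i).1 x * val (w K i).1 x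

/-- `(f, v)_Ω` for a given vector field `f`. -/
def loadV {k : ℕ} (f : Pt d → Pt d) (v : Vh T k) : ℝ :=
  ∑ K : T.Elem, ∫ x in K.set, ∑ i, f x i * val (v K i).1 x

/-- `(g, q)_Ω` for a given function `g`. -/
def loadQ {l : ℕ} (g : Pt d → ℝ) (q : T.Elem → Poly d l) : ℝ :=
  ∑ K : T.Elem, ∫ x in K.set, g x * val (q K).1 x

end Forms

/-! ### The fully discrete problem -/

/-- The constant model parameters: the Lamé constants `μ, λ`, the permeability `κ`, the specific
storage coefficient `c₀` and the Biot–Willis constant `α`. -/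
structure Coeffs where
  mu : ℝ
  lam : ℝ
  kappa : ℝ
  c0 : ℝ
  alpha : ℝ
  mu_pos : 0 < mu
  lam_pos : 0 < lam
  kappa_pos : 0 < kappa
  c0_nonneg : 0 ≤ c0
  alpha_pos : 0 < alpha
  alpha_lt_one : alpha < 1

/-- One backward Euler step of size `dt`, from the state `old` at time `t^n` to the state `new` at
time `t^{n+1}`, with `f = f^{n+1}` and `g = g^{n+1}`. -/
def IsStep {d : ℕ} {Ω : Set (Pt d)} {T : Mesh Ω} {k : ℕ} {ΓD ΓP : Set (Pt d)} {m : Method}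
    (c : Coeffs) (β dt : ℝ) (f : Pt d → Pt d) (g : Pt d → ℝ)
    (old new : Xh T k ΓD ΓP m) : Prop :=
  match old, new with
  | (_, (pT', _), _, (p', _)), ((u, ubar), (pT, pTbar), z, (p, pbar)) =>
    (∀ v : VV T k ΓD m,
      ah c.mu β u ubar.toField v.1 v.2.toField + bh v.1 v.2.toField pT pTbar.1 = loadV f v.1) ∧
    (∀ qT : QQ T k,
      bh u ubar.toField qT.1 qT.2.1 + c.lam⁻¹ * ipQ (c.alpha • p - pT) qT.1 = 0) ∧
    (∀ w : Vh T k, c.kappa⁻¹ * ipV z w + bh w 0 p pbar.1 = 0) ∧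
    (∀ q : QQ0 T k ΓP,
      1 / dt * (c.c0 * ipQ p q.1 + c.lam⁻¹ * ipQ (c.alpha • p - pT) (c.alpha • q.1))
        - bh z 0 q.1 q.2.1
      = 1 / dt * (c.c0 * ipQ p' q.1 + c.lam⁻¹ * ipQ (c.alpha • p' - pT') (c.alpha • q.1))
        + loadQ g q.1)

/-- The time level `t^n` of the uniform partition of `[0, Tend]` into `N` steps. -/
def timeLevel (Tend : ℝ) (N n : ℕ) : ℝ := n * (Tend / N)

end

end BiotHDG

/-! One time step is a square linear system on the finite-dimensional space `Xh`, so unique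
solvability follows once the homogeneous system has only the zero solution (`IsBil.existsUnique`,
`IsBil.existsUnique_four`). The sequence of states then arises by iteration (`existsUnique_orbit`).

Test the homogeneous system with its own solution and put `e = α p - p_T`. The `b_h` terms cancel
and leave `a_h(u, u) + λ⁻¹ ‖e‖² + c₀ ‖p‖² + Δt κ⁻¹ ‖z‖² = 0`. If `a_h` is coercive, every summand
vanishes, so `z = 0`, `p_T = α p` on the elements, `ε(u) = 0` and `u = ū` on all facets. Then `u` is
a rigid displacement on each element. It is zero on an element with a facet on `Γ_D`, and it stays
zero across common facets (`eq_zero_of_energy_of_jumpSq`). As `c₀` may be zero, `p` is not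
controlled by this identity. With `z = 0`, however, Darcy's law says `b_h((w, 0), p) = 0` for all
`w`. Bubble fields along the edges then force `p` to be constant on each element, with `p̄` equal to
the same constant on its boundary (`exists_eq_C_of_bh_eq_zero`). These constants agree across facets
and are zero at `Γ_P`. The momentum equation treats `p̄_T` in the same way. Only triviality of
kernels is needed, neither an inf-sup constant nor Korn's inequality. The argument is the same for
both methods, because the trace component of the displacement enters only as the solution itself or
as zero.

Coercivity (`exists_coercive`) rests on a discrete trace inequality whose constant depends on `d`,
`k` and `γ` only. It is reduced to a one-dimensional inverse inequality on segments parallel to an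
edge by an oblique Fubini formula (`setIntegral_simplexSet`). The same formula supplies the
divergence theorem on a simplex. Shape regularity bounds the height over a facet from below by a
multiple of `h_K`.

Propagation through the mesh (`forall_elem_of_adjacent`) holds because a generic short segment
inside `Ω` misses all faces of codimension at least two, so it passes between elements only through
facets. -/

set_option linter.unusedSectionVars false

namespace BiotHDG

/-! ### Integration over simplices -/

section Hyperplane

variable {d : ℕ}

/-- The hyperplane through `a` with normal vector `n`. -/
def hyperplane (n a : Pt d) : Set (Pt d) := {y | inner ℝ n (y - a) = 0}

lemma isClosed_hyperplane (n a : Pt d) : IsClosed (hyperplane n a) :=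
  isClosed_eq (by fun_prop) continuous_const

/-- Surface measure on a hyperplane is the image of Lebesgue measure on its direction. -/
lemma restrict_hyperplane_eq_map {n : Pt d} (hn : ‖n‖ = 1) (a : Pt d) :
    (μHE[d - 1] : Measure (Pt d)).restrict (hyperplane n a)
      = (volume : Measure (ℝ ∙ n)ᗮ).map (fun w : (ℝ ∙ n)ᗮ => (w : Pt d) + a) := by
  have hn0 : n ≠ 0 := by rintro rfl; simp at hn
  have hrank : Module.finrank ℝ (ℝ ∙ n)ᗮ = d - 1 := by
    have h1 := (ℝ ∙ n).finrank_add_finrank_orthogonal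
    rw [finrank_span_singleton hn0, finrank_euclideanSpace_fin] at h1
    omega
  have hiso : Isometry (fun w : (ℝ ∙ n)ᗮ => (w : Pt d) + a) :=
    Isometry.of_dist_eq fun x y => by rw [dist_add_right]; rfl
  have hrange : Set.range (fun w : (ℝ ∙ n)ᗮ => (w : Pt d) + a) = hyperplane n a := by
    ext y
    change _ ↔ inner ℝ n (y - a) = 0
    rw [Set.mem_range]
    constructor
    · rintro ⟨w, rfl⟩
      simpa using Submodule.mem_orthogonal_singleton_iff_inner_right.1 w.2
    · intro h
      exact ⟨⟨y - a, Submodule.mem_orthogonal_singleton_iff_inner_right.2 h⟩, by simp⟩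
  rw [← hrange, ← hiso.map_euclideanHausdorffMeasure, ← hrank,
    InnerProductSpace.euclideanHausdorffMeasure_eq_volume]

/-- Orthogonal Fubini: Lebesgue measure is the product of the measures on the line `ℝ ∙ n` and on
its orthogonal complement, and the unit vector `n` identifies that line isometrically with `ℝ`. -/
lemma measurePreserving_orthogonal_add_smul {n : Pt d} (hn : ‖n‖ = 1) (a : Pt d) :
    MeasurePreserving (fun p : (ℝ ∙ n)ᗮ × ℝ => (p.1 : Pt d) + a + p.2 • n) := by
  have h1 : MeasurePreserving ((ℝ ∙ n).measurableEquivProd a).symm volume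
      (volume : Measure (Pt d)) := by
    have h := ((ℝ ∙ n).measurePreserving_measurableEquivProd a).symm
    rwa [InnerProductSpace.euclideanHausdorffMeasure_eq_volume] at h
  have h2 : MeasurePreserving (LinearIsometryEquiv.toSpanUnitSingleton (𝕜 := ℝ) n hn) :=
    LinearIsometryEquiv.measurePreserving _
  have h3 := h1.comp ((h2.prod (MeasurePreserving.id (volume : Measure (ℝ ∙ n)ᗮ))).comp
    (Measure.measurePreserving_swap (μ := (volume : Measure (ℝ ∙ n)ᗮ)) (ν := (volume : Measure ℝ))))
  have heq : (fun p : (ℝ ∙ n)ᗮ × ℝ => (p.1 : Pt d) + a + p.2 • n)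
      = ((ℝ ∙ n).measurableEquivProd a).symm ∘
        (Prod.map (LinearIsometryEquiv.toSpanUnitSingleton (𝕜 := ℝ) n hn) id ∘ Prod.swap) := by
    ext1 p
    simp only [Function.comp, Submodule.measurableEquivProd_symm_apply, Prod.map, Prod.swap, id,
      LinearIsometryEquiv.toSpanUnitSingleton_apply, vadd_eq_add]
    abel
  rw [heq]
  exact h3

/-- Oblique Fubini: moving a hyperplane along a transversal direction sweeps out the volume. -/
lemma map_add_smul_eq_volume {n : Pt d} (hn : ‖n‖ = 1) (a t : Pt d) (ht : inner ℝ n t ≠ 0) :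
    (((μHE[d - 1] : Measure (Pt d)).restrict (hyperplane n a)).prod (volume : Measure ℝ)).map
        (fun p => p.1 + p.2 • t)
      = ENNReal.ofReal |inner ℝ n t|⁻¹ • (volume : Measure (Pt d)) := by
  set τ : ℝ := inner ℝ n t with hτ
  have htW : t - τ • n ∈ (ℝ ∙ n)ᗮ := by
    rw [Submodule.mem_orthogonal_singleton_iff_inner_right, inner_sub_right, inner_smul_right,
      real_inner_self_eq_norm_sq, hn]
    simp [hτ]
  -- Since `t = τ n + tW`, moving along `t` is a shear within the hyperplane direction, which
  -- preserves measure, followed by scaling the normal coordinate by `τ`. The scaling alone produces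
  -- the factor `|τ|⁻¹`.
  let tW : (ℝ ∙ n)ᗮ := ⟨t - τ • n, htW⟩
  have hshear : MeasurePreserving (fun p : (ℝ ∙ n)ᗮ × ℝ => (p.1 + p.2 • tW, p.2)) := by
    have h : MeasurePreserving (fun p : ℝ × (ℝ ∙ n)ᗮ => (p.1, p.2 + p.1 • tW))
        ((volume : Measure ℝ).prod volume) ((volume : Measure ℝ).prod volume) :=
      (MeasurePreserving.id volume).skew_product (g := fun s w => w + s • tW) (by fun_prop)
        (Filter.Eventually.of_forall fun s => map_add_right_eq_self _ _)
    exact (Measure.measurePreserving_swap.comp h).comp Measure.measurePreserving_swap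
  have hscale : (volume : Measure ((ℝ ∙ n)ᗮ × ℝ)).map (Prod.map id (τ * ·))
      = ENNReal.ofReal |τ|⁻¹ • volume := by
    rw [Measure.volume_eq_prod, ← Measure.map_prod_map _ _ measurable_id (by fun_prop),
      Measure.map_id, Real.map_volume_mul_left ht, Measure.prod_smul_right, abs_inv]
  rw [restrict_hyperplane_eq_map hn a]
  have hprod : ((volume : Measure (ℝ ∙ n)ᗮ).map (fun w : (ℝ ∙ n)ᗮ => (w : Pt d) + a)).prod
      (volume : Measure ℝ)
      = (volume : Measure ((ℝ ∙ n)ᗮ × ℝ)).map (Prod.map (fun w : (ℝ ∙ n)ᗮ => (w : Pt d) + a) id) := by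
    rw [Measure.volume_eq_prod, ← Measure.map_prod_map _ _ (by fun_prop) measurable_id,
      Measure.map_id]
  have hcomp : (fun p : Pt d × ℝ => p.1 + p.2 • t) ∘
        (Prod.map (fun w : (ℝ ∙ n)ᗮ => (w : Pt d) + a) id)
      = (fun p : (ℝ ∙ n)ᗮ × ℝ => (p.1 : Pt d) + a + p.2 • n) ∘ (Prod.map id (τ * ·)) ∘
        (fun p : (ℝ ∙ n)ᗮ × ℝ => (p.1 + p.2 • tW, p.2)) := by
    ext1 p
    simp only [Function.comp, Prod.map, id, tW, Submodule.coe_add, Submodule.coe_smul]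
    module
  rw [hprod, Measure.map_map (by fun_prop) (by fun_prop), hcomp,
    ← Measure.map_map (by fun_prop) (by fun_prop), ← Measure.map_map (by fun_prop) (by fun_prop),
    hshear.map_eq, hscale, Measure.map_smul, (measurePreserving_orthogonal_add_smul hn a).map_eq]

end Hyperplane

/-! ### Simplices in barycentric coordinates and Fubini along an edge. -/

section Simplex

variable {d : ℕ} {ι : Type*} [Fintype ι] (b : AffineBasis ι ℝ (Pt d))

/-- The closed simplex spanned by an affine basis. -/
def simplexSet : Set (Pt d) := {x | ∀ i, 0 ≤ b.coord i x}

/-- The facet of the simplex opposite to the vertex `c`. -/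
def simplexFacet (c : ι) : Set (Pt d) := {x | b.coord c x = 0 ∧ ∀ i, 0 ≤ b.coord i x}

/-- `n` is a unit vector normal to the facet opposite to the vertex `c`. -/
structure IsFacetNormal (c : ι) (n : Pt d) : Prop where
  norm_eq : ‖n‖ = 1
  orth : ∀ i j, i ≠ c → j ≠ c → inner ℝ n (b i - b j) = 0

lemma convexHull_range_eq_simplexSet : convexHull ℝ (Set.range b) = simplexSet b :=
  b.convexHull_eq_nonneg_coord

lemma isCompact_simplexSet : IsCompact (simplexSet b) := by
  rw [← convexHull_range_eq_simplexSet]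
  exact (Set.finite_range b).isCompact_convexHull ℝ

lemma continuous_coord (i : ι) : Continuous (b.coord i) :=
  (b.coord i).continuous_of_finiteDimensional

lemma simplexFacet_subset (c : ι) : simplexFacet b c ⊆ simplexSet b := fun _ h => h.2

lemma isClosed_simplexFacet (c : ι) : IsClosed (simplexFacet b c) :=
  (isClosed_eq (continuous_coord b c) continuous_const).inter (isCompact_simplexSet b).isClosed

lemma isCompact_simplexFacet (c : ι) : IsCompact (simplexFacet b c) :=
  (isCompact_simplexSet b).of_isClosed_subset (isClosed_simplexFacet b c) (simplexFacet_subset b c)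

lemma coord_add_smul (i j a : ι) (y : Pt d) (s : ℝ) :
    b.coord i (y + s • (b j - b a)) = b.coord i y + s * (b.coord i (b j) - b.coord i (b a)) := by
  have h := (b.coord i).map_vadd y (s • (b j - b a))
  rw [vadd_eq_add, vadd_eq_add, map_smul, ← vsub_eq_sub (b j), AffineMap.linearMap_vsub,
    vsub_eq_sub, add_comm, smul_eq_mul] at h
  rw [h, vsub_eq_sub, add_comm]

variable {b}

/-- Expanding `y - b a` in the edges `b i - b a` with barycentric weights, all edges inside the
facet are orthogonal to `n`. Only the edge to `c` survives, so signed distance to the facet is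
proportional to the barycentric coordinate at `c`. -/
lemma inner_normal_sub {c : ι} {n : Pt d} (hn : IsFacetNormal b c n) {a : ι} (ha : a ≠ c)
    (y : Pt d) : inner ℝ n (y - b a) = b.coord c y * inner ℝ n (b c - b a) := by
  classical
  have hy : y - b a = ∑ i, b.coord i y • (b i - b a) := by
    simp only [smul_sub, Finset.sum_sub_distrib, b.linear_combination_coord_eq_self,
      ← Finset.sum_smul, b.sum_coord_apply_eq_one, one_smul]
  rw [hy, inner_sum, Finset.sum_eq_single c]
  · rw [inner_smul_right]
  · intro i _ hi
    rw [inner_smul_right, hn.orth i a hi ha, mul_zero]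
  · simp

lemma simplexFacet_subset_hyperplane {c : ι} {n : Pt d} (hn : IsFacetNormal b c n) {a : ι}
    (ha : a ≠ c) : simplexFacet b c ⊆ hyperplane n (b a) := fun y hy => by
  change inner ℝ n (y - b a) = 0
  rw [inner_normal_sub hn ha, hy.1, zero_mul]

lemma inner_normal_ne_zero {c : ι} {n : Pt d} (hn : IsFacetNormal b c n) {a : ι} (ha : a ≠ c) :
    inner ℝ n (b c - b a) ≠ 0 := by
  intro h
  have h1 := inner_normal_sub hn ha (n + b a)
  rw [h, mul_zero, add_sub_cancel_right, real_inner_self_eq_norm_sq, hn.norm_eq] at h1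
  norm_num at h1

lemma coord_c_eq_zero_of_mem_hyperplane {c : ι} {n : Pt d} (hn : IsFacetNormal b c n) {a : ι}
    (ha : a ≠ c) {y : Pt d} (hy : y ∈ hyperplane n (b a)) : b.coord c y = 0 := by
  have h : inner ℝ n (y - b a) = 0 := hy
  rw [inner_normal_sub hn ha] at h
  exact (mul_eq_zero.1 h).resolve_right (inner_normal_ne_zero hn ha)

/-- Moving by `s` along the edge from `a` to `c` raises coordinate `c` by `s`, lowers coordinate `a`
by `s` and fixes all others. A line starting on the hyperplane of the facet therefore leaves the
simplex when coordinate `a` is exhausted. -/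
lemma add_smul_mem_simplexSet_iff {c a : ι} (ha : a ≠ c) {y : Pt d} (hy : b.coord c y = 0)
    (s : ℝ) : y + s • (b c - b a) ∈ simplexSet b ↔
      y ∈ simplexFacet b c ∧ s ∈ Set.Icc 0 (b.coord a y) := by
  classical
  have hc : ∀ i, b.coord i (y + s • (b c - b a))
      = b.coord i y + s * ((if i = c then 1 else 0) - (if i = a then 1 else 0)) := fun i => by
    rw [coord_add_smul, b.coord_apply, b.coord_apply]
  change (∀ i, 0 ≤ b.coord i _) ↔ (b.coord c y = 0 ∧ ∀ i, 0 ≤ b.coord i y) ∧ _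
  simp only [hc]
  constructor
  · intro h
    have h1 := h c
    have h2 := h a
    rw [if_pos rfl, if_neg ha.symm, hy] at h1
    rw [if_pos rfl, if_neg ha] at h2
    refine ⟨⟨hy, fun i => ?_⟩, by linarith, by linarith⟩
    by_cases hi : i = c
    · rw [hi, hy]
    · by_cases hia : i = a
      · rw [hia]; linarith
      · have h3 := h i
        rw [if_neg hi, if_neg hia] at h3
        linarith
  · rintro ⟨⟨-, h⟩, h0, h1⟩ i
    have := h i
    by_cases hi : i = c
    · rw [if_pos hi, if_neg (by rw [hi]; exact ha.symm)]; linarith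
    · by_cases hia : i = a
      · rw [if_neg hi, if_pos hia, hia]; linarith
      · rw [if_neg hi, if_neg hia]; linarith

/-- Fubini on a simplex: integration over the facet opposite to `c` and along the direction of the
edge from `a` to `c`. -/
theorem setIntegral_simplexSet {c : ι} {n : Pt d} (hn : IsFacetNormal b c n) {a : ι}
    (ha : a ≠ c) {G : Pt d → ℝ} (hG : Continuous G) :
    ∫ x in simplexSet b, G x = |inner ℝ n (b c - b a)| *
      ∫ y in simplexFacet b c, (∫ s in (0 : ℝ)..b.coord a y, G (y + s • (b c - b a)))
        ∂(μHE[d - 1] : Measure (Pt d)) := by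
  set t := b c - b a with ht
  set τ : ℝ := inner ℝ n t with hτ
  have hτ0 : τ ≠ 0 := inner_normal_ne_zero hn ha
  have hmap := map_add_smul_eq_volume hn.norm_eq (b a) t hτ0
  -- Product integration needs s-finiteness. On the hyperplane it holds because the surface measure
  -- is an image of Lebesgue measure.
  have : SFinite ((μHE[d - 1] : Measure (Pt d)).restrict (hyperplane n (b a))) := by
    rw [restrict_hyperplane_eq_map hn.norm_eq]; infer_instance
  set ν := (μHE[d - 1] : Measure (Pt d)).restrict (hyperplane n (b a)) with hν
  have hK : MeasurableSet (simplexSet b) := (isCompact_simplexSet b).measurableSet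
  have hint : Integrable ((simplexSet b).indicator G) volume :=
    (integrable_indicator_iff hK).2 (hG.continuousOn.integrableOn_compact (isCompact_simplexSet b))
  have hint' : Integrable ((simplexSet b).indicator G)
      ((ν.prod volume).map (fun p : Pt d × ℝ => p.1 + p.2 • t)) := by
    rw [hmap]; exact hint.smul_measure ENNReal.ofReal_ne_top
  have hΦ : Measurable (fun p : Pt d × ℝ => p.1 + p.2 • t) := by fun_prop
  have h1 : ∫ x, (simplexSet b).indicator G x
      = |τ| * ∫ p : Pt d × ℝ, (simplexSet b).indicator G (p.1 + p.2 • t) ∂(ν.prod volume) := by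
    rw [← integral_map hΦ.aemeasurable hint'.aestronglyMeasurable, hmap, integral_smul_measure,
      ENNReal.toReal_ofReal (by positivity), smul_eq_mul, ← mul_assoc,
      mul_inv_cancel₀ (abs_ne_zero.2 hτ0), one_mul]
  have hprod := integral_prod (fun p : Pt d × ℝ => (simplexSet b).indicator G (p.1 + p.2 • t))
    (hint'.comp_measurable hΦ)
  rw [← integral_indicator hK, h1, hprod]
  congr 1
  have h2 : ∀ y ∈ hyperplane n (b a), ∫ s : ℝ, (simplexSet b).indicator G (y + s • t)
      = (simplexFacet b c).indicator
        (fun y => ∫ s in (0 : ℝ)..b.coord a y, G (y + s • t)) y := by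
    intro y hy
    have hyc := coord_c_eq_zero_of_mem_hyperplane hn ha hy
    by_cases hyF : y ∈ simplexFacet b c
    · rw [Set.indicator_of_mem hyF, intervalIntegral.integral_of_le (hyF.2 a),
        ← integral_Icc_eq_integral_Ioc, ← integral_indicator measurableSet_Icc]
      congr 1
      ext s
      by_cases hs : s ∈ Set.Icc 0 (b.coord a y)
      · rw [Set.indicator_of_mem hs,
          Set.indicator_of_mem ((add_smul_mem_simplexSet_iff ha hyc s).2 ⟨hyF, hs⟩)]
      · rw [Set.indicator_of_notMem hs, Set.indicator_of_notMem
          (fun h => hs ((add_smul_mem_simplexSet_iff ha hyc s).1 h).2)]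
    · rw [Set.indicator_of_notMem hyF]
      convert integral_zero ℝ ℝ with s
      exact Set.indicator_of_notMem
        (fun h => hyF ((add_smul_mem_simplexSet_iff ha hyc s).1 h).1) _
  rw [hν, setIntegral_congr_fun (isClosed_hyperplane n (b a)).measurableSet h2,
    setIntegral_indicator (isClosed_simplexFacet b c).measurableSet,
    Set.inter_eq_self_of_subset_right (simplexFacet_subset_hyperplane hn ha)]

lemma measure_simplexFacet_lt_top {c : ι} {n : Pt d} (hn : IsFacetNormal b c n) {a : ι}
    (ha : a ≠ c) : (μHE[d - 1] : Measure (Pt d)) (simplexFacet b c) < ⊤ := by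
  have h : (μHE[d - 1] : Measure (Pt d)) (simplexFacet b c)
      = ((μHE[d - 1] : Measure (Pt d)).restrict (hyperplane n (b a))) (simplexFacet b c) := by
    rw [Measure.restrict_apply (isClosed_simplexFacet b c).measurableSet,
      Set.inter_eq_self_of_subset_left (simplexFacet_subset_hyperplane hn ha)]
  rw [h, restrict_hyperplane_eq_map hn.norm_eq,
    Measure.map_apply (by fun_prop) (isClosed_simplexFacet b c).measurableSet]
  refine IsCompact.measure_lt_top ?_
  refine Topology.IsClosedEmbedding.isCompact_preimage ?_ (isCompact_simplexFacet b c)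
  exact (Homeomorph.addRight (b a)).isClosedEmbedding.comp
    (Submodule.closed_of_finiteDimensional _).isClosedEmbedding_subtypeVal

lemma interior_simplexSet : interior (simplexSet b) = {x | ∀ i, 0 < b.coord i x} := by
  rw [← convexHull_range_eq_simplexSet]
  exact b.interior_convexHull

lemma convex_simplexSet : Convex ℝ (simplexSet b) := by
  rw [← convexHull_range_eq_simplexSet]
  exact convex_convexHull ℝ _

lemma interior_simplexSet_nonempty : (interior (simplexSet b)).Nonempty := by
  rw [← convexHull_range_eq_simplexSet]
  exact interior_convexHull_nonempty_iff_affineSpan_eq_top.2 b.tot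

lemma closure_interior_simplexSet : closure (interior (simplexSet b)) = simplexSet b := by
  rw [convex_simplexSet.closure_interior_eq_closure_of_nonempty_interior
    interior_simplexSet_nonempty, (isCompact_simplexSet b).isClosed.closure_eq]

/-- A nonnegative continuous function with vanishing integral over a simplex vanishes there. -/
lemma eq_zero_of_setIntegral_simplexSet_eq_zero {G : Pt d → ℝ} (hG : Continuous G)
    (h0 : ∀ x ∈ simplexSet b, 0 ≤ G x) (h : ∫ x in simplexSet b, G x = 0) :
    ∀ x ∈ simplexSet b, G x = 0 := by
  have hK : MeasurableSet (simplexSet b) := (isCompact_simplexSet b).measurableSet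
  have h1 := (setIntegral_eq_zero_iff_of_nonneg_ae
    ((ae_restrict_iff' hK).2 (Filter.Eventually.of_forall h0))
    (hG.continuousOn.integrableOn_compact (isCompact_simplexSet b))).1 h
  -- Continuity turns almost everywhere into everywhere on the open interior, and the simplex is the
  -- closure of its interior.
  have h2 : G =ᵐ[volume.restrict (interior (simplexSet b))] 0 :=
    ae_restrict_of_ae_restrict_of_subset interior_subset h1
  have h3 := Measure.eqOn_open_of_ae_eq h2 isOpen_interior hG.continuousOn continuousOn_const
  have h4 : Set.EqOn G 0 (closure (interior (simplexSet b))) :=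
    h3.closure hG continuous_const
  rw [closure_interior_simplexSet] at h4
  exact h4

end Simplex

noncomputable section

/-! ### Polynomials on Euclidean space -/

section Polynomials

variable {d : ℕ}

lemma val_add (p q : MvPolynomial (Fin d) ℝ) (x : Pt d) : val (p + q) x = val p x + val q x :=
  map_add _ _ _

lemma val_mul (p q : MvPolynomial (Fin d) ℝ) (x : Pt d) : val (p * q) x = val p x * val q x :=
  map_mul _ _ _

lemma val_smul (c : ℝ) (p : MvPolynomial (Fin d) ℝ) (x : Pt d) : val (c • p) x = c * val p x :=
  MvPolynomial.smul_eval _ _ _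

lemma val_zero (x : Pt d) : val (0 : MvPolynomial (Fin d) ℝ) x = 0 := map_zero _

lemma val_C (c : ℝ) (x : Pt d) : val (MvPolynomial.C c) x = c := MvPolynomial.eval_C _

lemma val_X (i : Fin d) (x : Pt d) : val (MvPolynomial.X i) x = x i := MvPolynomial.eval_X _

lemma val_sum {κ : Type*} (s : Finset κ) (p : κ → MvPolynomial (Fin d) ℝ) (x : Pt d) :
    val (∑ i ∈ s, p i) x = ∑ i ∈ s, val (p i) x := map_sum _ _ _

lemma continuous_val (p : MvPolynomial (Fin d) ℝ) : Continuous (val p) :=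
  (MvPolynomial.continuous_eval p).comp (by fun_prop)

/-- The restriction of a polynomial to the line `s ↦ y + s • t`. -/
def linePoly (y t : Pt d) (p : MvPolynomial (Fin d) ℝ) : Polynomial ℝ :=
  MvPolynomial.aeval (fun i => Polynomial.C (y i) + Polynomial.C (t i) * Polynomial.X) p

lemma eval_linePoly (y t : Pt d) (p : MvPolynomial (Fin d) ℝ) (s : ℝ) :
    (linePoly y t p).eval s = val p (y + s • t) := by
  induction p using MvPolynomial.induction_on with
  | C a => simp [linePoly, val]
  | add p q hp hq =>
    rw [val_add, ← hp, ← hq, linePoly, map_add, Polynomial.eval_add]; rfl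
  | mul_X p i hp =>
    rw [val_mul, ← hp, linePoly, linePoly, map_mul, Polynomial.eval_mul, MvPolynomial.aeval_X,
      val_X, Polynomial.eval_add, Polynomial.eval_C, Polynomial.eval_C_mul, Polynomial.eval_X,
      mul_comm (t i)]
    rfl

lemma natDegree_linePoly_le (y t : Pt d) (p : MvPolynomial (Fin d) ℝ) :
    (linePoly y t p).natDegree ≤ p.totalDegree := by
  rw [linePoly, MvPolynomial.aeval_def, MvPolynomial.eval₂_eq]
  refine Polynomial.natDegree_sum_le_of_forall_le _ _ fun m hm => ?_
  refine Polynomial.natDegree_mul_le.trans ?_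
  rw [Polynomial.algebraMap_eq, Polynomial.natDegree_C, zero_add]
  refine (Polynomial.natDegree_prod_le _ _).trans (le_trans ?_ (MvPolynomial.le_totalDegree hm))
  refine Finset.sum_le_sum fun i _ => ?_
  refine Polynomial.natDegree_pow_le.trans ?_
  have : (Polynomial.C (y i) + Polynomial.C (t i) * Polynomial.X : Polynomial ℝ).natDegree ≤ 1 := by
    compute_degree
  nlinarith

/-- A polynomial that vanishes on a nonempty open set is zero. -/
lemma eq_zero_of_val_eq_zero_on_open {p : MvPolynomial (Fin d) ℝ} {U : Set (Pt d)}
    (hU : IsOpen U) (hne : U.Nonempty) (h : ∀ x ∈ U, val p x = 0) : p = 0 := by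
  obtain ⟨x₀, hx₀⟩ := hne
  refine MvPolynomial.funext fun y => ?_
  rw [map_zero]
  set y' : Pt d := WithLp.toLp 2 y
  have hcont : Continuous fun s : ℝ => x₀ + s • (y' - x₀) := by fun_prop
  have hmem : ∀ᶠ s in nhds (0 : ℝ), x₀ + s • (y' - x₀) ∈ U :=
    hcont.continuousAt.eventually_mem (hU.mem_nhds (by simpa using hx₀))
  -- Restricted to the line from `x₀` to `y'`, the polynomial vanishes for all small `s`. It then
  -- vanishes identically on that line, in particular at `s = 1`, which is the point `y'`.
  have hinf : {s : ℝ | (linePoly x₀ (y' - x₀) p).eval s = 0}.Infinite := by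
    refine infinite_of_mem_nhds (0 : ℝ) ?_
    filter_upwards [hmem] with s hs
    exact (eval_linePoly _ _ _ _).trans (h _ hs)
  have h0 := Polynomial.eq_zero_of_infinite_isRoot _ hinf
  have h1 := eval_linePoly x₀ (y' - x₀) p 1
  rw [h0, Polynomial.eval_zero, one_smul, add_sub_cancel] at h1
  exact h1.symm

/-- The derivative of polynomials in the direction `t`. -/
def dirDeriv (t : Pt d) : Derivation ℝ (MvPolynomial (Fin d) ℝ) (MvPolynomial (Fin d) ℝ) :=
  ∑ i, t i • MvPolynomial.pderiv i

lemma dirDeriv_apply (t : Pt d) (p : MvPolynomial (Fin d) ℝ) :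
    dirDeriv t p = ∑ i, t i • MvPolynomial.pderiv i p := by
  have h := map_sum Derivation.coeFnAddMonoidHom
    (fun i => t i • (MvPolynomial.pderiv i : Derivation ℝ (MvPolynomial (Fin d) ℝ) _)) Finset.univ
  have h2 := congrFun h p
  rw [Finset.sum_apply] at h2
  exact h2

lemma hasDerivAt_val (p : MvPolynomial (Fin d) ℝ) (y t : Pt d) (s : ℝ) :
    HasDerivAt (fun s : ℝ => val p (y + s • t)) (val (dirDeriv t p) (y + s • t)) s := by
  induction p using MvPolynomial.induction_on with
  | C a =>
    have h : dirDeriv t (MvPolynomial.C a) = 0 := (dirDeriv t).map_algebraMap a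
    simp only [val_C, h, val_zero]
    exact hasDerivAt_const _ _
  | add p q hp hq =>
    simp only [map_add, val_add]
    exact hp.add hq
  | mul_X p i hp =>
    have hX : dirDeriv t (MvPolynomial.X i) = MvPolynomial.C (t i) := by
      rw [dirDeriv_apply, Finset.sum_eq_single i]
      · rw [MvPolynomial.pderiv_X_self, MvPolynomial.smul_eq_C_mul, mul_one]
      · intro j _ hj
        rw [MvPolynomial.pderiv_X_of_ne hj.symm, smul_zero]
      · simp
    have h1 : HasDerivAt (fun s : ℝ => (y + s • t) i) (t i) s := by
      simpa using ((hasDerivAt_id s).mul_const (t i)).const_add (y i)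
    rw [Derivation.leibniz, hX]
    simp only [val_mul, val_X, val_add, smul_eq_mul, val_C]
    convert! hp.mul h1 using 1
    ring

lemma totalDegree_pderiv_le (i : Fin d) (p : MvPolynomial (Fin d) ℝ) :
    (MvPolynomial.pderiv i p).totalDegree ≤ p.totalDegree - 1 := by
  refine Finset.sup_le fun m hm => ?_
  rw [MvPolynomial.mem_support_iff, MvPolynomial.coeff_pderiv] at hm
  have h1 : m + Finsupp.single i 1 ∈ p.support :=
    MvPolynomial.mem_support_iff.2 (left_ne_zero_of_mul hm)
  have h2 := MvPolynomial.le_totalDegree h1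
  rw [Finsupp.sum_add_index' (fun _ => rfl) (fun _ _ _ => rfl),
    Finsupp.sum_single_index rfl] at h2
  omega

lemma totalDegree_dirDeriv_le (t : Pt d) (p : MvPolynomial (Fin d) ℝ) :
    (dirDeriv t p).totalDegree ≤ p.totalDegree - 1 := by
  rw [dirDeriv_apply]
  refine MvPolynomial.totalDegree_finsetSum_le fun i _ => ?_
  exact (MvPolynomial.totalDegree_smul_le _ _).trans (totalDegree_pderiv_le i p)

/-- The polynomial of degree at most one given by an affine function. -/
def affPoly (f : Pt d →ᵃ[ℝ] ℝ) : MvPolynomial (Fin d) ℝ :=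
  MvPolynomial.C (f 0) + ∑ i, f.linear (EuclideanSpace.single i 1) • MvPolynomial.X i

lemma val_affPoly (f : Pt d →ᵃ[ℝ] ℝ) (x : Pt d) : val (affPoly f) x = f x := by
  have hx : x = ∑ i, x i • EuclideanSpace.single i (1 : ℝ) := by
    ext j
    simp [Pi.single_apply]
  have h := congrFun f.decomp x
  rw [Pi.add_apply] at h
  rw [h, affPoly, val_add, val_C, val_sum, add_comm]
  congr 1
  conv_rhs => rw [hx, map_sum]
  refine Finset.sum_congr rfl fun i _ => ?_
  rw [val_smul, val_X, map_smul, smul_eq_mul, mul_comm]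

lemma totalDegree_affPoly_le (f : Pt d →ᵃ[ℝ] ℝ) : (affPoly f).totalDegree ≤ 1 := by
  refine (MvPolynomial.totalDegree_add _ _).trans (max_le ?_ ?_)
  · rw [MvPolynomial.totalDegree_C]; exact zero_le_one
  · refine MvPolynomial.totalDegree_finsetSum_le fun i _ => ?_
    exact (MvPolynomial.totalDegree_smul_le _ _).trans (MvPolynomial.totalDegree_X _).le

lemma eq_of_val_eq {p q : MvPolynomial (Fin d) ℝ} (h : ∀ x, val p x = val q x) : p = q :=
  MvPolynomial.funext fun y => h (WithLp.toLp 2 y)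

end Polynomials

/-! ### A one-dimensional inverse inequality -/

section Inverse

/-- Evaluation at `0` is represented, in the `L²(0,1)` inner product on polynomials of degree at
most `k`, by some polynomial `R`. Cauchy–Schwarz then bounds it with constant `‖R‖²`. -/
lemma exists_sq_eval_zero_le (k : ℕ) : ∃ C : ℝ, 0 < C ∧ ∀ Q : Polynomial ℝ, Q.natDegree ≤ k →
    Q.eval 0 ^ 2 ≤ C * ∫ s in (0 : ℝ)..1, Q.eval s ^ 2 := by
  let V := Polynomial.degreeLE ℝ (k : ℕ)
  have hfin : Module.Finite ℝ V := by
    change Module.Finite ℝ (Polynomial.degreeLE ℝ (k : ℕ))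
    rw [Polynomial.degreeLE_eq_span_X_pow]
    exact Module.Finite.span_finset ℝ _
  have hint : ∀ P : Polynomial ℝ, IntervalIntegrable (fun s => P.eval s) volume 0 1 :=
    fun P => P.continuous.intervalIntegrable _ _
  let I : Polynomial ℝ →ₗ[ℝ] ℝ :=
    { toFun := fun P => ∫ s in (0 : ℝ)..1, P.eval s
      map_add' := fun P Q => by
        simp only [Polynomial.eval_add]
        exact intervalIntegral.integral_add (hint P) (hint Q)
      map_smul' := fun c P => by
        simp only [Polynomial.eval_smul, smul_eq_mul, RingHom.id_apply]
        exact intervalIntegral.integral_const_mul _ _ }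
  let B : V →ₗ[ℝ] Module.Dual ℝ V :=
    LinearMap.mk₂ ℝ (fun P Q => I (P.1 * Q.1))
      (fun P P' Q => by simp [add_mul]) (fun c P Q => by simp)
      (fun P Q Q' => by simp [mul_add]) (fun c P Q => by simp)
  have hnonneg : ∀ P : Polynomial ℝ, 0 ≤ I (P * P) := fun P =>
    intervalIntegral.integral_nonneg zero_le_one fun s _ => by
      rw [Polynomial.eval_mul]; exact mul_self_nonneg _
  have hinj : Function.Injective B := by
    rw [injective_iff_map_eq_zero]
    intro P hP
    have h0 : I (P.1 * P.1) = 0 := congrArg (fun φ => φ P) hP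
    by_contra hne
    have hpos : 0 < I (P.1 * P.1) := by
      refine intervalIntegral.integral_pos_iff_support_of_nonneg_ae ?_ (hint _) |>.2
        ⟨zero_lt_one, ?_⟩
      · exact Filter.Eventually.of_forall fun s => by
          exact (mul_self_nonneg (P.1.eval s)).trans_eq Polynomial.eval_mul.symm
      · have hsupp : Set.Ioc (0 : ℝ) 1 \ {s | P.1.IsRoot s} ⊆
            Function.support (fun s => (P.1 * P.1).eval s) ∩ Set.Ioc 0 1 := fun s hs =>
          ⟨fun h => hs.2 (by
            simp only [Polynomial.eval_mul] at h; exact mul_self_eq_zero.1 h), hs.1⟩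
        refine lt_of_lt_of_le ?_ (measure_mono hsupp)
        rw [measure_sdiff_null
          ((Polynomial.finite_setOfPred_isRoot (fun h => hne (Subtype.ext h))).measure_zero _)]
        simp
    exact hpos.ne' h0
  have hsurj : Function.Surjective B :=
    (LinearMap.injective_iff_surjective_of_finrank_eq_finrank
      (Subspace.dual_finrank_eq (K := ℝ) (V := V)).symm).1 hinj
  obtain ⟨R, hR⟩ := hsurj ((Polynomial.leval (0 : ℝ)).comp V.subtype)
  have hRQ : ∀ Q : Polynomial ℝ, Q.natDegree ≤ k → I (R.1 * Q) = Q.eval 0 := fun Q hQ =>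
    congrArg (fun φ => φ (⟨Q, Polynomial.mem_degreeLE.2
      (Polynomial.natDegree_le_iff_degree_le.1 hQ)⟩ : V)) hR
  -- The summand `1` makes the constant positive without an argument that `R` is nonzero. The
  -- Cauchy–Schwarz step below comes from the nonnegative square of `(c + 1) Q - e R`.
  refine ⟨I (R.1 * R.1) + 1, by linarith [hnonneg R.1], fun Q hQ => ?_⟩
  have hC := hnonneg R.1
  set c := I (R.1 * R.1)
  set e := Q.eval 0
  have hsq : (∫ s in (0 : ℝ)..1, Q.eval s ^ 2) = I (Q * Q) :=
    intervalIntegral.integral_congr fun s _ => by simp [sq]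
  have h1 : 0 ≤ I (((c + 1) • Q - e • R.1) * ((c + 1) • Q - e • R.1)) := hnonneg _
  have h2 : I (((c + 1) • Q - e • R.1) * ((c + 1) • Q - e • R.1))
      = (c + 1) ^ 2 * I (Q * Q) - 2 * (c + 1) * e * I (R.1 * Q) + e ^ 2 * c := by
    have h3 : ((c + 1) • Q - e • R.1) * ((c + 1) • Q - e • R.1)
        = (c + 1) ^ 2 • (Q * Q) - (2 * (c + 1) * e) • (R.1 * Q) + e ^ 2 • (R.1 * R.1) := by
      simp only [Polynomial.smul_eq_C_mul, map_add, map_mul, map_pow]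
      simp only [map_one, map_ofNat]
      ring
    rw [h3, map_add, map_sub, map_smul, map_smul, map_smul]
    simp only [smul_eq_mul]
    rfl
  rw [h2, hRQ Q hQ] at h1
  rw [hsq]
  have h4 : 0 ≤ (c + 1) * ((c + 1) * I (Q * Q) - e ^ 2) := by nlinarith [sq_nonneg e]
  nlinarith [nonneg_of_mul_nonneg_right h4 (by linarith)]

/-- The inverse inequality on an interval of length `L`. -/
lemma exists_mul_sq_eval_zero_le (k : ℕ) : ∃ C : ℝ, 0 < C ∧ ∀ Q : Polynomial ℝ, Q.natDegree ≤ k →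
    ∀ L : ℝ, 0 ≤ L → L * Q.eval 0 ^ 2 ≤ C * ∫ s in (0 : ℝ)..L, Q.eval s ^ 2 := by
  obtain ⟨C, hC, h⟩ := exists_sq_eval_zero_le k
  refine ⟨C, hC, fun Q hQ L hL => ?_⟩
  rcases hL.eq_or_lt with rfl | hL
  · simp
  have h1 := h (Q.comp (Polynomial.C L * Polynomial.X)) (by
    refine Polynomial.natDegree_comp_le.trans ?_
    have : (Polynomial.C L * Polynomial.X : Polynomial ℝ).natDegree ≤ 1 := by compute_degree
    nlinarith)
  simp only [Polynomial.eval_comp, Polynomial.eval_mul, Polynomial.eval_C, Polynomial.eval_X,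
    mul_zero] at h1
  rw [intervalIntegral.integral_comp_mul_left (fun s => Q.eval s ^ 2) hL.ne', mul_zero, mul_one,
    smul_eq_mul] at h1
  calc L * Q.eval 0 ^ 2 ≤ L * (C * (L⁻¹ * ∫ s in (0 : ℝ)..L, Q.eval s ^ 2)) := by gcongr
    _ = C * ∫ s in (0 : ℝ)..L, Q.eval s ^ 2 := by field_simp

end Inverse

/-! ### Polynomials on a simplex -/

section SimplexPolynomials

variable {d : ℕ} {ι : Type*} [Fintype ι] {b : AffineBasis ι ℝ (Pt d)}

/-- The barycentric coordinates as polynomials. -/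
def baryPoly (b : AffineBasis ι ℝ (Pt d)) (i : ι) : MvPolynomial (Fin d) ℝ := affPoly (b.coord i)

lemma val_baryPoly (i : ι) (x : Pt d) : val (baryPoly b i) x = b.coord i x := val_affPoly _ _

lemma totalDegree_baryPoly_le (i : ι) : (baryPoly b i).totalDegree ≤ 1 := totalDegree_affPoly_le _

lemma integrableOn_of_continuousOn_of_isCompact {X : Type*} [TopologicalSpace X]
    [MeasurableSpace X] [OpensMeasurableSpace X] [T2Space X] {μ : Measure X} {s : Set X}
    (hs : IsCompact s) (hμ : μ s < ⊤) {f : X → ℝ} (hf : ContinuousOn f s) : IntegrableOn f s μ := by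
  obtain ⟨C, hC⟩ := hs.exists_bound_of_continuousOn hf
  have : IsFiniteMeasure (μ.restrict s) := ⟨by rwa [Measure.restrict_apply_univ]⟩
  exact Integrable.of_bound (hf.aestronglyMeasurable_of_isCompact hs hs.measurableSet) C
    ((ae_restrict_iff' hs.measurableSet).2 (Filter.Eventually.of_forall hC))

lemma integrableOn_simplexFacet {c a : ι} {n : Pt d} (hn : IsFacetNormal b c n) (ha : a ≠ c)
    {f : Pt d → ℝ} (hf : ContinuousOn f (simplexFacet b c)) :
    IntegrableOn f (simplexFacet b c) (μHE[d - 1] : Measure (Pt d)) :=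
  integrableOn_of_continuousOn_of_isCompact (isCompact_simplexFacet b c)
    (measure_simplexFacet_lt_top hn ha) hf

/-- The divergence theorem on a simplex in the direction of an edge. -/
lemma setIntegral_dirDeriv {c a : ι} {n : Pt d} (hn : IsFacetNormal b c n) (ha : a ≠ c)
    (g : MvPolynomial (Fin d) ℝ) :
    ∫ x in simplexSet b, val (dirDeriv (b c - b a) g) x = |inner ℝ n (b c - b a)| *
      ∫ y in simplexFacet b c, (val g (y + b.coord a y • (b c - b a)) - val g y)
        ∂(μHE[d - 1] : Measure (Pt d)) := by
  rw [setIntegral_simplexSet hn ha (continuous_val _)]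
  congr 1
  refine setIntegral_congr_fun (isClosed_simplexFacet b c).measurableSet fun y _ => ?_
  have hcont : Continuous fun s : ℝ => val (dirDeriv (b c - b a) g) (y + s • (b c - b a)) :=
    (continuous_val _).comp (by fun_prop)
  have h := intervalIntegral.integral_eq_sub_of_hasDerivAt
    (a := 0) (b := b.coord a y) (fun s _ => hasDerivAt_val g y (b c - b a) s)
    (hcont.intervalIntegrable _ _)
  simpa using h

lemma coord_add_coord_smul {c a : ι} (ha : a ≠ c) (y : Pt d) :
    b.coord a (y + b.coord a y • (b c - b a)) = 0 := by
  classical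
  rw [coord_add_smul, b.coord_apply, b.coord_apply, if_neg ha, if_pos rfl]
  ring

/-- The factor `baryPoly b a` vanishes where the segment leaves the simplex, so only the boundary
term on the facet opposite to `c` remains. -/
lemma setIntegral_dirDeriv_baryPoly_mul {c a : ι} {n : Pt d} (hn : IsFacetNormal b c n)
    (ha : a ≠ c) (s : MvPolynomial (Fin d) ℝ) :
    ∫ x in simplexSet b, val (dirDeriv (b c - b a) (baryPoly b a * s)) x
      = -(|inner ℝ n (b c - b a)| * ∫ y in simplexFacet b c, b.coord a y * val s y
        ∂(μHE[d - 1] : Measure (Pt d))) := by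
  rw [setIntegral_dirDeriv hn ha, ← mul_neg, ← integral_neg]
  congr 1
  refine integral_congr_ae (Filter.Eventually.of_forall fun y => ?_)
  simp only [val_mul, val_baryPoly, coord_add_coord_smul ha]
  ring

lemma setIntegral_dirDeriv_bubble {c a : ι} {n : Pt d} (hn : IsFacetNormal b c n)
    (ha : a ≠ c) (s : MvPolynomial (Fin d) ℝ) :
    ∫ x in simplexSet b,
      val (dirDeriv (b c - b a) (baryPoly b a * (baryPoly b c * s))) x = 0 := by
  rw [setIntegral_dirDeriv_baryPoly_mul hn ha, setIntegral_congr_fun (g := fun _ => (0 : ℝ))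
    (isClosed_simplexFacet b c).measurableSet, integral_zero, mul_zero, neg_zero]
  intro y hy
  simp only [val_mul, val_baryPoly, hy.1]
  ring

/-- The discrete trace inequality on a facet. -/
lemma trace_inequality {k : ℕ} {C : ℝ}
    (hC : ∀ Q : Polynomial ℝ, Q.natDegree ≤ k →
      ∀ L : ℝ, 0 ≤ L → L * Q.eval 0 ^ 2 ≤ C * ∫ s in (0 : ℝ)..L, Q.eval s ^ 2)
    {c : ι} {n : Pt d} (hn : IsFacetNormal b c n) {τ : ℝ}
    (hτ : ∀ a, a ≠ c → |inner ℝ n (b c - b a)| = τ) (hC0 : 0 ≤ C)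
    (hne : ∃ a, a ≠ c) {q : MvPolynomial (Fin d) ℝ} (hq : q.totalDegree ≤ k) :
    τ * ∫ y in simplexFacet b c, val q y ^ 2 ∂(μHE[d - 1] : Measure (Pt d))
      ≤ Fintype.card ι * (C * ∫ x in simplexSet b, val q x ^ 2) := by
  obtain ⟨a₀, ha₀⟩ := hne
  have hF := (isClosed_simplexFacet b c).measurableSet
  have hcq : Continuous fun x => val q x ^ 2 := (continuous_val q).pow 2
  have hint : ∀ a, IntegrableOn (fun y => b.coord a y * val q y ^ 2) (simplexFacet b c)
      (μHE[d - 1] : Measure (Pt d)) := fun a =>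
    integrableOn_simplexFacet hn ha₀ ((continuous_coord b a).mul hcq).continuousOn
  have hτ0 : 0 ≤ τ := hτ a₀ ha₀ ▸ abs_nonneg _
  -- The weight `b.coord a y` is the parameter length of the segment from `y` in the direction `b c
  -- - b a`. The weighted integrand is thus exactly the left-hand side of the inverse inequality on
  -- that segment, and Fubini reassembles the segments into the simplex. For `a = c` the weight is
  -- zero on the facet.
  have key : ∀ a, τ * ∫ y in simplexFacet b c, b.coord a y * val q y ^ 2
        ∂(μHE[d - 1] : Measure (Pt d)) ≤ C * ∫ x in simplexSet b, val q x ^ 2 := by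
    intro a
    by_cases ha : a = c
    · rw [setIntegral_congr_fun (g := fun _ => (0 : ℝ)) hF, integral_zero, mul_zero]
      · exact mul_nonneg hC0 (integral_nonneg fun x => sq_nonneg _)
      · intro y hy
        simp only [ha, hy.1, zero_mul]
    · rw [setIntegral_simplexSet hn ha hcq, hτ a ha, mul_left_comm C]
      refine mul_le_mul_of_nonneg_left ?_ hτ0
      rw [← integral_const_mul]
      have hcont : Continuous fun y : Pt d =>
          ∫ s in (0 : ℝ)..b.coord a y, val q (y + s • (b c - b a)) ^ 2 := by
        refine intervalIntegral.continuous_parametric_intervalIntegral_of_continuous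
          (f := fun (y : Pt d) (s : ℝ) => val q (y + s • (b c - b a)) ^ 2) ?_ (continuous_coord b a)
        exact hcq.comp (by fun_prop : Continuous fun p : Pt d × ℝ => p.1 + p.2 • (b c - b a))
      refine setIntegral_mono_on (hint a) ?_ hF fun y hy => ?_
      · exact integrableOn_simplexFacet hn ha (continuous_const.mul hcont).continuousOn
      · have h := hC (linePoly y (b c - b a) q) ((natDegree_linePoly_le _ _ _).trans hq) _ (hy.2 a)
        simpa only [eval_linePoly, zero_smul, add_zero] using h
  -- The weights sum to one, so adding the estimates over all vertices removes them at the price of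
  -- the factor `Fintype.card ι`.
  have hsum : ∫ y in simplexFacet b c, val q y ^ 2 ∂(μHE[d - 1] : Measure (Pt d))
      = ∑ a, ∫ y in simplexFacet b c, b.coord a y * val q y ^ 2 ∂(μHE[d - 1] : Measure (Pt d)) := by
    rw [← integral_finsetSum _ fun a _ => hint a]
    congr 1
    ext y
    rw [← Finset.sum_mul, b.sum_coord_apply_eq_one, one_mul]
  rw [hsum, Finset.mul_sum]
  refine (Finset.sum_le_sum fun a _ => key a).trans_eq ?_
  rw [Finset.sum_const, Finset.card_univ, nsmul_eq_mul]

/-- A polynomial whose square has vanishing integral over a facet vanishes there. -/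
lemma val_eq_zero_of_setIntegral_simplexFacet {c a : ι} {n : Pt d} (hn : IsFacetNormal b c n)
    (ha : a ≠ c) {r : MvPolynomial (Fin d) ℝ}
    (h : ∫ y in simplexFacet b c, val r y ^ 2 ∂(μHE[d - 1] : Measure (Pt d)) = 0) :
    ∀ y ∈ simplexFacet b c, val r y = 0 := by
  classical
  have hF := (isClosed_simplexFacet b c).measurableSet
  have hcr : Continuous fun x => val r x ^ 2 := (continuous_val r).pow 2
  -- `G` extends `r²` from the facet constantly along the edge direction. By Fubini its volume
  -- integral is a multiple of the facet integral of `r²` with weight `b.coord a ≤ 1`, hence zero,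
  -- and the vanishing criterion for the full simplex applies.
  set G : Pt d → ℝ := fun x => val r (x - b.coord c x • (b c - b a)) ^ 2 with hG
  have hGc : Continuous G := by
    have := continuous_coord b c
    exact hcr.comp (by fun_prop)
  have h1 : ∫ x in simplexSet b, G x = |inner ℝ n (b c - b a)| *
      ∫ y in simplexFacet b c, b.coord a y * val r y ^ 2 ∂(μHE[d - 1] : Measure (Pt d)) := by
    rw [setIntegral_simplexSet hn ha hGc]
    congr 1
    refine setIntegral_congr_fun hF fun y hy => ?_
    have h2 : ∀ s : ℝ, G (y + s • (b c - b a)) = val r y ^ 2 := fun s => by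
      simp only [hG]
      rw [coord_add_smul, b.coord_apply, b.coord_apply, if_pos rfl, if_neg ha.symm, hy.1]
      congr 2
      module
    simp only [h2, intervalIntegral.integral_const, sub_zero, smul_eq_mul]
  have h2 : ∫ y in simplexFacet b c, b.coord a y * val r y ^ 2 ∂(μHE[d - 1] : Measure (Pt d))
      ≤ ∫ y in simplexFacet b c, val r y ^ 2 ∂(μHE[d - 1] : Measure (Pt d)) := by
    refine setIntegral_mono_on (integrableOn_simplexFacet hn ha
      ((continuous_coord b a).mul hcr).continuousOn)
      (integrableOn_simplexFacet hn ha hcr.continuousOn) hF fun y hy => ?_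
    have h3 : b.coord a y ≤ 1 := by
      rw [← b.sum_coord_apply_eq_one y]
      exact Finset.single_le_sum (f := fun i => b.coord i y) (fun i _ => hy.2 i)
        (Finset.mem_univ a)
    nlinarith [sq_nonneg (val r y)]
  have h3 : ∫ x in simplexSet b, G x = 0 := by
    refine le_antisymm ?_ (integral_nonneg fun x => sq_nonneg _)
    rw [h1]
    exact mul_nonpos_of_nonneg_of_nonpos (abs_nonneg _) (h2.trans_eq h)
  intro y hy
  have h4 := eq_zero_of_setIntegral_simplexSet_eq_zero hGc (fun x _ => sq_nonneg _) h3 y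
    (simplexFacet_subset b c hy)
  simp only [hG, hy.1, zero_smul, sub_zero] at h4
  exact pow_eq_zero_iff two_ne_zero |>.1 h4

lemma eq_zero_of_setIntegral_simplexSet_sq {r : MvPolynomial (Fin d) ℝ}
    (h : ∫ x in simplexSet b, val r x ^ 2 = 0) : r = 0 := by
  refine eq_zero_of_val_eq_zero_on_open isOpen_interior (interior_simplexSet_nonempty (b := b))
    fun x hx => ?_
  have h1 := eq_zero_of_setIntegral_simplexSet_eq_zero ((continuous_val r).pow 2)
    (fun x _ => sq_nonneg _) h x (interior_subset hx)
  exact pow_eq_zero_iff two_ne_zero |>.1 h1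

/-! ### Rigid displacements, bubble functions and barycentric decompositions. -/

lemma val_eq_of_dirDeriv_eq_zero {p : MvPolynomial (Fin d) ℝ} {x y : Pt d}
    (h : dirDeriv (x - y) p = 0) : val p x = val p y := by
  have hd : ∀ s : ℝ, HasDerivAt (fun s : ℝ => val p (y + s • (x - y))) 0 s := fun s => by
    have := hasDerivAt_val p y (x - y) s
    rwa [h, val_zero] at this
  have h1 := is_const_of_deriv_eq_zero (fun s => (hd s).differentiableAt)
    (fun s => (hd s).deriv) 1 0
  simpa using h1

/-- A polynomial field with vanishing symmetric gradient that vanishes on a facet is zero. -/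
lemma eq_zero_of_eps_eq_zero {c : ι} {u : Fin d → MvPolynomial (Fin d) ℝ}
    (heps : ∀ i j, MvPolynomial.pderiv j (u i) + MvPolynomial.pderiv i (u j) = 0)
    (hu : ∀ a, a ≠ c → ∀ i, val (u i) (b a) = 0) : ∀ i, u i = 0 := by
  have key : ∀ x : Pt d, b.coord c x ≠ 0 → ∀ i, val (u i) x = 0 := by
    intro x hx
    set U : Pt d := WithLp.toLp 2 fun i => val (u i) x with hU
    have h1 : ∀ a, a ≠ c → inner ℝ U (x - b a) = 0 := by
      intro a ha
      set t := x - b a with ht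
      -- The derivative of `t · u` in the direction `t` is `t · ε(u) t = 0`. So `t · u` is constant
      -- on the line through `b a` and `x`, and it is zero at `b a`.
      have hg : dirDeriv t (∑ i, t i • u i) = 0 := by
        have h2 : dirDeriv t (∑ i, t i • u i)
            = ∑ i, ∑ j, (t i * t j) • MvPolynomial.pderiv j (u i) := by
          rw [map_sum]
          refine Finset.sum_congr rfl fun i _ => ?_
          rw [Derivation.map_smul, dirDeriv_apply, Finset.smul_sum]
          simp only [smul_smul]
        have h3 : dirDeriv t (∑ i, t i • u i) + dirDeriv t (∑ i, t i • u i) = 0 := by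
          have h2' : dirDeriv t (∑ i, t i • u i)
              = ∑ i, ∑ j, (t i * t j) • MvPolynomial.pderiv i (u j) := by
            rw [h2, Finset.sum_comm]
            simp only [mul_comm]
          nth_rewrite 1 [h2]
          rw [h2', ← Finset.sum_add_distrib]
          refine Finset.sum_eq_zero fun i _ => ?_
          rw [← Finset.sum_add_distrib]
          refine Finset.sum_eq_zero fun j _ => ?_
          rw [← smul_add, heps, smul_zero]
        rw [← two_smul ℝ] at h3
        exact (smul_eq_zero.1 h3).resolve_left two_ne_zero
      have h4 := val_eq_of_dirDeriv_eq_zero hg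
      rw [val_sum, val_sum] at h4
      simp only [val_smul, hu a ha, mul_zero, Finset.sum_const_zero] at h4
      rw [PiLp.inner_apply]
      simpa [hU] using h4
    have hlin : ∀ z : Pt d, inner ℝ U (x - z) = ∑ i, b.coord i z * inner ℝ U (x - b i) := by
      intro z
      have : x - z = ∑ i, b.coord i z • (x - b i) := by
        simp only [smul_sub, Finset.sum_sub_distrib, b.linear_combination_coord_eq_self,
          ← Finset.sum_smul, b.sum_coord_apply_eq_one, one_smul]
      rw [this, inner_sum]
      exact Finset.sum_congr rfl fun i _ => inner_smul_right _ _ _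
    -- An affine function of `z` that vanishes at every vertex except `c` is a multiple of
    -- coordinate `c`. Taking `z = x`, where this coordinate is nonzero, makes the multiple zero,
    -- and `z = x - U` then gives `‖U‖² = 0`.
    have hlin' : ∀ z : Pt d, inner ℝ U (x - z) = b.coord c z * inner ℝ U (x - b c) := by
      intro z
      rw [hlin z]
      refine Finset.sum_eq_single c (fun i _ hi => by rw [h1 i hi, mul_zero]) (by simp)
    have h5 : inner ℝ U (x - b c) = 0 := by
      have := hlin' x
      rw [sub_self, inner_zero_right] at this
      exact (mul_eq_zero.1 this.symm).resolve_left hx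
    have h6 : U = 0 := by
      have := hlin' (x - U)
      rw [h5, mul_zero, sub_sub_cancel] at this
      exact inner_self_eq_zero.1 this
    intro i
    have h7 := congrArg (fun v : Pt d => v i) h6
    simpa [hU] using h7
  intro i
  refine eq_zero_of_val_eq_zero_on_open isOpen_interior (interior_simplexSet_nonempty (b := b))
    fun x hx => key x ?_ i
  rw [interior_simplexSet] at hx
  exact (hx c).ne'

/-- A polynomial all of whose edge derivatives vanish is constant. -/
lemma eq_C_of_dirDeriv_eq_zero {p : MvPolynomial (Fin d) ℝ} (a : ι)
    (h : ∀ c, c ≠ a → dirDeriv (b c - b a) p = 0) : p = MvPolynomial.C (val p (b a)) := by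
  refine eq_of_val_eq fun x => ?_
  rw [val_C]
  refine val_eq_of_dirDeriv_eq_zero ?_
  have hx : x - b a = ∑ i, b.coord i x • (b i - b a) := by
    simp only [smul_sub, Finset.sum_sub_distrib, b.linear_combination_coord_eq_self,
      ← Finset.sum_smul, b.sum_coord_apply_eq_one, one_smul]
  have h1 : dirDeriv (x - b a) p = ∑ i, b.coord i x • dirDeriv (b i - b a) p := by
    simp only [dirDeriv_apply, Finset.smul_sum, smul_smul]
    rw [Finset.sum_comm]
    refine Finset.sum_congr rfl fun j _ => ?_
    rw [← Finset.sum_smul]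
    congr 1
    conv_lhs => rw [hx]
    simp
  rw [h1]
  refine Finset.sum_eq_zero fun i _ => ?_
  by_cases hi : i = a
  · rw [hi, sub_self, dirDeriv_apply]; simp
  · rw [h i hi, smul_zero]

/-- If `p` is orthogonal to the divergences of the tangential bubble fields, it is constant. -/
lemma eq_C_of_bubble {p : MvPolynomial (Fin d) ℝ} (hN : ∀ c, ∃ n, IsFacetNormal b c n) (a : ι)
    (h : ∀ c, c ≠ a → ∫ x in simplexSet b, val p x * val (dirDeriv (b c - b a)
      (baryPoly b a * (baryPoly b c * dirDeriv (b c - b a) p))) x = 0) :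
    p = MvPolynomial.C (val p (b a)) := by
  refine eq_C_of_dirDeriv_eq_zero a fun c hc => ?_
  obtain ⟨n, hn⟩ := hN c
  set D := dirDeriv (b c - b a) p with hD
  set w := baryPoly b a * (baryPoly b c * D) with hw
  have hK := isCompact_simplexSet b
  have h1 : ∫ x in simplexSet b, val (dirDeriv (b c - b a) (p * w)) x = 0 := by
    have : p * w = baryPoly b a * (baryPoly b c * (p * D)) := by rw [hw]; ring
    rw [this]
    exact setIntegral_dirDeriv_bubble hn hc.symm _
  -- By the product rule, `∫ p ∂w = 0` and `∫ ∂(p w) = 0` leave the integral of the bubble times the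
  -- squared edge derivative of `p`. The bubble is positive in the interior, so that derivative is
  -- zero.
  have h2 : ∀ x, val (dirDeriv (b c - b a) (p * w)) x
      = val p x * val (dirDeriv (b c - b a) w) x
        + b.coord a x * b.coord c x * val D x ^ 2 := fun x => by
    rw [Derivation.leibniz, val_add, smul_eq_mul, smul_eq_mul, val_mul, val_mul, ← hD, hw]
    simp only [val_mul, val_baryPoly]
    ring
  have hc2 : Continuous fun x => b.coord a x * b.coord c x * val D x ^ 2 :=
    ((continuous_coord b a).mul (continuous_coord b c)).mul ((continuous_val D).pow 2)
  simp only [h2] at h1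
  have hi1 : IntegrableOn (fun x => val p x * val (dirDeriv (b c - b a) w) x) (simplexSet b) :=
    ((continuous_val _).mul (continuous_val _)).continuousOn.integrableOn_compact hK
  rw [integral_add hi1 (hc2.continuousOn.integrableOn_compact hK), h c hc, zero_add] at h1
  have h3 := eq_zero_of_setIntegral_simplexSet_eq_zero hc2
    (fun x hx => mul_nonneg (mul_nonneg (hx a) (hx c)) (sq_nonneg _)) h1
  refine eq_zero_of_val_eq_zero_on_open isOpen_interior (interior_simplexSet_nonempty (b := b))
    fun x hx => ?_
  have h4 := h3 x (interior_subset hx)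
  rw [interior_simplexSet] at hx
  exact pow_eq_zero_iff two_ne_zero |>.1
    ((mul_eq_zero.1 h4).resolve_left (mul_pos (hx a) (hx c)).ne')

/-- Polynomials of degree at most `l + 1` are combinations of the barycentric coordinates with
coefficients of degree at most `l`. -/
lemma exists_eq_sum_baryPoly_mul (b : AffineBasis ι ℝ (Pt d)) {l : ℕ}
    {r : MvPolynomial (Fin d) ℝ} (hr : r.totalDegree ≤ l + 1) :
    ∃ s : ι → Poly d l, r = ∑ i, baryPoly b i * (s i).1 := by
  classical
  let L : (ι → Poly d l) →ₗ[ℝ] MvPolynomial (Fin d) ℝ :=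
    ∑ i, (LinearMap.mulLeft ℝ (baryPoly b i)) ∘ₗ (Submodule.subtype _) ∘ₗ LinearMap.proj i
  have hL : ∀ s, L s = ∑ i, baryPoly b i * (s i).1 := fun s => by simp [L]
  have h1 : (∑ i, baryPoly b i) = 1 := eq_of_val_eq fun x => by
    rw [val_sum]
    simp only [val_baryPoly, b.sum_coord_apply_eq_one]
    exact (map_one (MvPolynomial.eval _)).symm
  have hX : ∀ j, MvPolynomial.X j = ∑ i, baryPoly b i * MvPolynomial.C (b i j) := fun j =>
    eq_of_val_eq fun x => by
      rw [val_sum, val_X]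
      simp only [val_mul, val_baryPoly, val_C]
      conv_lhs => rw [← b.linear_combination_coord_eq_self x, WithLp.ofLp_sum, Finset.sum_apply]
      rfl
  suffices hmem : r ∈ LinearMap.range L by
    obtain ⟨s, hs⟩ := hmem
    exact ⟨s, hs ▸ hL s⟩
  rw [r.as_sum]
  refine Submodule.sum_mem _ fun m hm => ?_
  have hdeg := (MvPolynomial.le_totalDegree hm).trans hr
  -- A constant is multiplied by `1 = ∑ λ_i`. Any other monomial gives up one variable `X j = ∑ (b
  -- i)_j λ_i`, which lowers the degree of the remaining factor by one.
  by_cases hm0 : m = 0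
  · refine ⟨fun _ => ⟨MvPolynomial.C (r.coeff m), ?_⟩, ?_⟩
    · rw [MvPolynomial.mem_restrictTotalDegree, MvPolynomial.totalDegree_C]; exact Nat.zero_le _
    · rw [hL]
      simp only
      rw [← Finset.sum_mul, h1, one_mul, hm0]
      rfl
  · obtain ⟨j, hj⟩ := Finsupp.ne_iff.1 hm0
    obtain ⟨m', rfl⟩ : ∃ m', m = m' + Finsupp.single j 1 :=
      ⟨m - Finsupp.single j 1, (tsub_add_cancel_of_le (by
        rw [Finsupp.single_le_iff]; exact Nat.one_le_iff_ne_zero.2 hj)).symm⟩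
    rw [Finsupp.sum_add_index' (fun _ => rfl) (fun _ _ _ => rfl),
      Finsupp.sum_single_index rfl] at hdeg
    set c := r.coeff (m' + Finsupp.single j 1)
    refine ⟨fun i => ⟨(b i j) • MvPolynomial.monomial m' c, ?_⟩, ?_⟩
    · rw [MvPolynomial.mem_restrictTotalDegree]
      exact (MvPolynomial.totalDegree_smul_le _ _).trans
        ((MvPolynomial.totalDegree_monomial_le _ _).trans (by
          change (m'.sum fun _ e => e) ≤ l
          omega))
    · rw [hL, MvPolynomial.monomial_add_single, pow_one, hX, Finset.mul_sum]
      refine Finset.sum_congr rfl fun i _ => ?_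
      change baryPoly b i * ((b i) j • MvPolynomial.monomial m' c) = _
      rw [MvPolynomial.smul_eq_C_mul]
      ring

end SimplexPolynomials

/-! ### Geometry of the elements -/

lemma convexHull_image_eq_simplexFacet {d : ℕ} {ι : Type*} [Fintype ι]
    (b : AffineBasis ι ℝ (Pt d)) (c : ι) :
    convexHull ℝ (b '' {i | i ≠ c}) = simplexFacet b c := by
  classical
  refine Set.Subset.antisymm (convexHull_min ?_ ?_) fun x hx => ?_
  · rintro _ ⟨i, hi, rfl⟩
    refine ⟨?_, fun j => ?_⟩
    · rw [b.coord_apply, if_neg (Ne.symm hi)]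
    · rw [b.coord_apply]; split_ifs <;> norm_num
  · exact ((convex_singleton (0 : ℝ)).affine_preimage (b.coord c)).inter convex_simplexSet
  · have h1 : ∑ i ∈ Finset.univ.erase c, b.coord i x • b i = x := by
      have := b.linear_combination_coord_eq_self x
      rwa [← Finset.add_sum_erase _ _ (Finset.mem_univ c), hx.1, zero_smul, zero_add] at this
    have h2 : ∑ i ∈ Finset.univ.erase c, b.coord i x = 1 := by
      have := b.sum_coord_apply_eq_one x
      rwa [← Finset.add_sum_erase _ _ (Finset.mem_univ c), hx.1, zero_add] at this
    rw [← h1]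
    refine (convex_convexHull ℝ _).sum_mem (fun i _ => hx.2 i) h2 fun i hi => ?_
    exact subset_convexHull ℝ _ ⟨i, Finset.ne_of_mem_erase hi, rfl⟩

namespace Mesh

variable {d : ℕ} {Ω : Set (Pt d)} {T : Mesh Ω}

/-- The vertices of an element as an affine basis. -/
def Elem.basis (K : T.Elem) : AffineBasis K.1 ℝ (Pt d) where
  toFun := Subtype.val
  ind' := T.indep K.2.1
  tot' := (T.indep K.2.1).affineSpan_eq_top_iff_card_eq_finrank_add_one.2 (by
    rw [Fintype.card_coe, K.2.2, finrank_euclideanSpace_fin])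

lemma Elem.basis_apply (K : T.Elem) (i : K.1) : K.basis i = i.1 := rfl

lemma Elem.set_eq (K : T.Elem) : K.set = simplexSet K.basis := by
  rw [← convexHull_range_eq_simplexSet, Elem.set]
  congr 1
  exact Subtype.range_coe.symm

lemma Elem.card_vertices (K : T.Elem) : Fintype.card K.1 = d + 1 := by
  rw [Fintype.card_coe, K.2.2]

lemma Elem.isCompact_set (K : T.Elem) : IsCompact K.set :=
  K.set_eq ▸ isCompact_simplexSet K.basis

lemma Facet.isCompact_set (F : T.Facet) : IsCompact F.set :=
  F.1.finite_toSet.isCompact_convexHull ℝ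

instance (F : T.Facet) : CompactSpace F.set := isCompact_iff_compactSpace.1 F.isCompact_set

lemma Elem.mem_bdry {K : T.Elem} {F : T.Facet} : F ∈ K.bdry ↔ F.1 ⊆ K.1 := by
  simp [Elem.bdry]

/-- `F` is the facet of `K` opposite to the vertex `c`. -/
structure IsOpposite (K : T.Elem) (F : T.Facet) (c : K.1) : Prop where
  mem_iff : ∀ x, x ∈ F.1 ↔ x ∈ K.1 ∧ x ≠ c.1

lemma exists_isOpposite {K : T.Elem} {F : T.Facet} (h : F ∈ K.bdry) :
    ∃ c, IsOpposite K F c := by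
  classical
  have hsub := Elem.mem_bdry.1 h
  have h1 : (K.1 \ F.1).card = 1 := by
    rw [Finset.card_sdiff_of_subset hsub, K.2.2, F.2.2]; omega
  obtain ⟨c, hc⟩ := Finset.card_eq_one.1 h1
  have hcK : c ∈ K.1 ∧ c ∉ F.1 := Finset.mem_sdiff.1 (hc ▸ Finset.mem_singleton_self c)
  refine ⟨⟨c, hcK.1⟩, ⟨fun x => ⟨fun hx => ⟨hsub hx, fun h => hcK.2 (by rwa [← show x = c from h])⟩, fun hx => ?_⟩⟩⟩
  by_contra hxF
  exact hx.2 (Finset.mem_singleton.1 (hc ▸ Finset.mem_sdiff.2 ⟨hx.1, hxF⟩))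

lemma exists_facet_isOpposite (hd : 1 ≤ d) (K : T.Elem) (c : K.1) :
    ∃ F ∈ K.bdry, IsOpposite K F c := by
  classical
  have hcard : (K.1.erase c.1).card = d := by
    rw [Finset.card_erase_of_mem c.2, K.2.2, Nat.add_sub_cancel]
  have hne : (K.1.erase c.1).Nonempty := Finset.card_pos.1 (by omega)
  refine ⟨⟨K.1.erase c.1, T.down_closed K.2.1 (Finset.erase_subset _ _) hne, hcard⟩,
    Elem.mem_bdry.2 (Finset.erase_subset _ _), ⟨fun x => ?_⟩⟩
  exact Finset.mem_erase.trans and_comm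

namespace IsOpposite

variable {K : T.Elem} {F : T.Facet} {c : K.1}

lemma coe_eq (h : IsOpposite K F c) : (F.1 : Set (Pt d)) = K.basis '' {i | i ≠ c} := by
  ext x
  rw [Finset.mem_coe, h.mem_iff]
  constructor
  · rintro ⟨hx, hne⟩
    exact ⟨⟨x, hx⟩, fun h => hne (congrArg Subtype.val h), rfl⟩
  · rintro ⟨i, hi, rfl⟩
    exact ⟨i.2, fun h => hi (Subtype.ext h)⟩

lemma set_eq (h : IsOpposite K F c) : F.set = simplexFacet K.basis c := by
  rw [Facet.set, h.coe_eq, convexHull_image_eq_simplexFacet]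

lemma vectorSpan_le (h : IsOpposite K F c) :
    vectorSpan ℝ (F.1 : Set (Pt d)) ≤ LinearMap.ker (K.basis.coord c).linear := by
  classical
  rw [vectorSpan_def, Submodule.span_le]
  rintro _ ⟨x, hx, y, hy, rfl⟩
  rw [h.coe_eq] at hx hy
  obtain ⟨i, hi, rfl⟩ := hx
  obtain ⟨j, hj, rfl⟩ := hy
  change (K.basis.coord c).linear (K.basis i -ᵥ K.basis j) = 0
  rw [AffineMap.linearMap_vsub, AffineBasis.coord_apply, AffineBasis.coord_apply,
    if_neg (Ne.symm hi), if_neg (Ne.symm hj), vsub_self]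

/-- The linear part of the barycentric coordinate at `c` annihilates the direction of `F` but equals
`-1` on this edge, so the edge is not parallel to `F`. -/
lemma starProjection_ne_zero (h : IsOpposite K F c) {a : K.1} (ha : a ≠ c) :
    (vectorSpan ℝ (F.1 : Set (Pt d)))ᗮ.starProjection (K.basis a - K.basis c) ≠ 0 := by
  classical
  intro h0
  rw [Submodule.starProjection_apply_eq_zero_iff, Submodule.orthogonal_orthogonal] at h0
  have h1 : (K.basis.coord c).linear (K.basis a -ᵥ K.basis c) = 0 := h.vectorSpan_le h0
  rw [AffineMap.linearMap_vsub, AffineBasis.coord_apply, AffineBasis.coord_apply,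
    if_neg (Ne.symm ha), if_pos rfl] at h1
  norm_num at h1

/-- The barycentres of `F` and `K` differ by `(d + 1)⁻¹` times the edge from `c` to `a`, up to a
vector parallel to `F` which the projection kills. This links the normal of the mesh to the edges.
-/
lemma starProjection_centroid (h : IsOpposite K F c) (hd : 1 ≤ d) {a : K.1} (ha : a ≠ c) :
    (vectorSpan ℝ (F.1 : Set (Pt d)))ᗮ.starProjection
        (F.1.centroid ℝ id - K.1.centroid ℝ id)
      = ((d : ℝ) + 1)⁻¹ • (vectorSpan ℝ (F.1 : Set (Pt d)))ᗮ.starProjection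
        (K.basis a - K.basis c) := by
  classical
  have hd0 : (d : ℝ) ≠ 0 := by positivity
  have hcent : ∀ s : Finset (Pt d), s.Nonempty →
      s.centroid ℝ id = ((s.card : ℝ))⁻¹ • ∑ x ∈ s, x := fun s hs => by
    rw [s.centroid_eq_centerMass hs, Finset.centerMass_eq_of_sum_1 _ _
      (s.sum_centroidWeights_eq_one_of_nonempty ℝ hs), Finset.smul_sum]
    rfl
  have hK : K.1 = insert c.1 F.1 := by
    ext x
    rw [Finset.mem_insert, h.mem_iff]
    constructor
    · intro hx
      by_cases hxc : x = c.1
      · exact Or.inl hxc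
      · exact Or.inr ⟨hx, hxc⟩
    · rintro (rfl | hx)
      · exact c.2
      · exact hx.1
  have hcF : c.1 ∉ F.1 := fun hc => ((h.mem_iff _).1 hc).2 rfl
  have haF : a.1 ∈ F.1 := (h.mem_iff _).2 ⟨a.2, fun h => ha (Subtype.ext h)⟩
  have hsum : ∑ x ∈ K.1, x = c.1 + ∑ x ∈ F.1, x := 
    (Finset.sum_congr hK fun _ _ => rfl).trans (Finset.sum_insert hcF)
  have hmem : ∑ x ∈ F.1, (x - a.1) ∈ vectorSpan ℝ (F.1 : Set (Pt d)) :=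
    Submodule.sum_mem _ fun x hx => vsub_mem_vectorSpan ℝ hx haF
  have hdiff : F.1.centroid ℝ id - K.1.centroid ℝ id
      = ((d : ℝ) + 1)⁻¹ • (K.basis a - K.basis c)
        + (((d : ℝ) + 1)⁻¹ * (d : ℝ)⁻¹) • ∑ x ∈ F.1, (x - a.1) := by
    rw [hcent _ ⟨a.1, haF⟩, hcent _ ⟨a.1, a.2⟩, hsum, Finset.sum_sub_distrib, Finset.sum_const,
      F.2.2, K.2.2, Elem.basis_apply, Elem.basis_apply, ← Nat.cast_smul_eq_nsmul ℝ]
    push_cast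
    generalize ∑ x ∈ F.1, x = f
    match_scalars <;> field_simp <;> ring
  rw [hdiff, map_add, map_smul, map_smul]
  have h0 : (vectorSpan ℝ (F.1 : Set (Pt d)))ᗮ.starProjection (∑ x ∈ F.1, (x - a.1)) = 0 := by
    rw [Submodule.starProjection_apply_eq_zero_iff, Submodule.orthogonal_orthogonal]
    exact hmem
  rw [h0, smul_zero, add_zero]

lemma exists_ne (hd : 1 ≤ d) (c : K.1) : ∃ a : K.1, a ≠ c := by
  have : Nontrivial K.1 := Fintype.one_lt_card_iff_nontrivial.1 (by rw [K.card_vertices]; omega)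
  exact _root_.exists_ne c

lemma normal_eq (h : IsOpposite K F c) (hd : 1 ≤ d) {a : K.1} (ha : a ≠ c) :
    ∃ r : ℝ, 0 < r ∧ K.normal F = r • (vectorSpan ℝ (F.1 : Set (Pt d)))ᗮ.starProjection
        (K.basis a - K.basis c) ∧ ‖K.normal F‖ = 1 := by
  have hne := h.starProjection_ne_zero ha
  have hw := h.starProjection_centroid hd ha
  have hd1 : (0 : ℝ) < ((d : ℝ) + 1)⁻¹ := by positivity
  have hw0 : (vectorSpan ℝ (F.1 : Set (Pt d)))ᗮ.starProjection
        (F.1.centroid ℝ id - K.1.centroid ℝ id) ≠ 0 := by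
    rw [hw]; exact smul_ne_zero hd1.ne' hne
  refine ⟨‖(vectorSpan ℝ (F.1 : Set (Pt d)))ᗮ.starProjection
        (F.1.centroid ℝ id - K.1.centroid ℝ id)‖⁻¹ * ((d : ℝ) + 1)⁻¹,
    mul_pos (inv_pos.2 (norm_pos_iff.2 hw0)) hd1, ?_, ?_⟩
  · rw [mul_smul, ← hw]; rfl
  · exact norm_smul_inv_norm (𝕜 := ℝ) hw0

lemma isFacetNormal (h : IsOpposite K F c) (hd : 1 ≤ d) :
    IsFacetNormal K.basis c (K.normal F) := by
  obtain ⟨a, ha⟩ := exists_ne hd c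
  obtain ⟨r, -, hr, hnorm⟩ := h.normal_eq hd ha
  refine ⟨hnorm, fun i j hi hj => ?_⟩
  rw [hr, inner_smul_left]
  have h1 : K.basis i - K.basis j ∈ vectorSpan ℝ (F.1 : Set (Pt d)) := by
    rw [h.coe_eq]
    exact vsub_mem_vectorSpan ℝ ⟨i, hi, rfl⟩ ⟨j, hj, rfl⟩
  rw [Submodule.inner_left_of_mem_orthogonal h1 (Submodule.starProjection_apply_mem _ _), mul_zero]

lemma inner_normal_pos (h : IsOpposite K F c) (hd : 1 ≤ d) {a : K.1} (ha : a ≠ c) :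
    0 < inner ℝ (K.normal F) (K.basis a - K.basis c) := by
  obtain ⟨r, hr0, hr, -⟩ := h.normal_eq hd ha
  have hne := h.starProjection_ne_zero ha
  have h1 := Submodule.re_inner_starProjection_eq_normSq (𝕜 := ℝ)
    (K := (vectorSpan ℝ (F.1 : Set (Pt d)))ᗮ) (K.basis a - K.basis c)
  rw [hr, inner_smul_left]
  rw [Submodule.starProjection_apply] at hne
  exact mul_pos hr0 (lt_of_lt_of_eq
    (pow_pos (norm_pos_iff.2 fun h => hne (by rw [h]; rfl)) 2) h1.symm)

lemma inner_normal_eq (h : IsOpposite K F c) (hd : 1 ≤ d) {a a' : K.1} (ha : a ≠ c)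
    (ha' : a' ≠ c) : inner ℝ (K.normal F) (K.basis a - K.basis c)
      = inner ℝ (K.normal F) (K.basis a' - K.basis c) := by
  have h1 := (h.isFacetNormal hd).orth a a' ha ha'
  rw [← sub_eq_zero, ← inner_sub_right, sub_sub_sub_cancel_right, h1]

end IsOpposite

/-! ### Heights, diameters and shape regularity. -/

variable {d : ℕ} {Ω : Set (Pt d)} {T : Mesh Ω}

/-- The height of an element over one of its facets is at least the diameter of any ball contained
in the element. -/
lemma IsOpposite.diam_ball_le {K : T.Elem} {F : T.Facet} {c : K.1} (h : IsOpposite K F c)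
    (hd : 1 ≤ d) {x : Pt d} {ρ : ℝ} (hρ : 0 < ρ) (hball : Metric.closedBall x (ρ / 2) ⊆ K.set)
    {a : K.1} (ha : a ≠ c) : ρ ≤ inner ℝ (K.normal F) (K.basis a - K.basis c) := by
  have hn := h.isFacetNormal hd
  set n := K.normal F
  set H : ℝ := inner ℝ n (K.basis a - K.basis c) with hH
  -- The ball contains a segment of length `ρ` in the normal direction. Along it coordinate `c`
  -- changes by `ρ / H`, while it stays within `[0, 1]`.
  have hmem : ∀ s : ℝ, |s| ≤ ρ / 2 → x + s • n ∈ simplexSet K.basis := fun s hs => by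
    rw [← K.set_eq]
    refine hball ?_
    rw [Metric.mem_closedBall, dist_eq_norm, add_sub_cancel_left, norm_smul, hn.norm_eq, mul_one]
    exact hs
  have h1 := hmem (ρ / 2) (abs_of_pos (by linarith)).le
  have h2 := hmem (-(ρ / 2)) (by rw [abs_neg]; exact (abs_of_pos (by linarith)).le)
  have hcoord : ∀ y ∈ simplexSet K.basis, K.basis.coord c y ≤ 1 := fun y hy => by
    rw [← K.basis.sum_coord_apply_eq_one y]
    exact Finset.single_le_sum (f := fun i => K.basis.coord i y) (fun i _ => hy i)
      (Finset.mem_univ c)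
  have hneg : inner ℝ n (K.basis c - K.basis a) = -H := by
    rw [hH, ← inner_neg_right, neg_sub]
  have e1 := inner_normal_sub hn ha (x + (ρ / 2) • n)
  have e2 := inner_normal_sub hn ha (x + (-(ρ / 2)) • n)
  have e3 : inner ℝ n (x + (ρ / 2) • n - K.basis a) - inner ℝ n (x + (-(ρ / 2)) • n - K.basis a)
      = ρ := by
    rw [← inner_sub_right]
    have : x + (ρ / 2) • n - K.basis a - (x + (-(ρ / 2)) • n - K.basis a) = ρ • n := by module
    rw [this, inner_smul_right, real_inner_self_eq_norm_sq, hn.norm_eq]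
    ring
  rw [e1, e2, hneg] at e3
  have hH0 : 0 < H := h.inner_normal_pos hd ha
  nlinarith [hcoord _ h2, h1 c, mul_nonneg hH0.le (h1 c),
    mul_nonneg hH0.le (sub_nonneg.2 (hcoord _ h2))]

/-- The height over a facet is bounded below by the diameter and the shape regularity constant. -/
lemma ShapeRegular.h_le {γ : ℝ} (hT : T.ShapeRegular γ) (hd : 1 ≤ d) {K : T.Elem} {F : T.Facet}
    {c : K.1} (h : IsOpposite K F c) {a : K.1} (ha : a ≠ c) :
    K.h ≤ |γ| * inner ℝ (K.normal F) (K.basis a - K.basis c) := by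
  obtain ⟨x, ρ, hρ, hball, hle⟩ := hT K
  calc K.h ≤ γ * ρ := hle
    _ ≤ |γ| * ρ := by gcongr; exact le_abs_self γ
    _ ≤ _ := by gcongr; exact h.diam_ball_le hd hρ hball ha

lemma Elem.h_pos (hd : 1 ≤ d) (K : T.Elem) : 0 < K.h := by
  obtain ⟨a, ha⟩ : K.1.Nonempty := Finset.card_pos.1 (by rw [K.2.2]; omega)
  obtain ⟨c, hc⟩ := IsOpposite.exists_ne hd (⟨a, ha⟩ : K.1)
  have hsub : (K.1 : Set (Pt d)) ⊆ K.set := subset_convexHull ℝ _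
  refine lt_of_lt_of_le (dist_pos.2 fun h => hc (Subtype.ext h))
    (Metric.dist_le_diam_of_mem K.isCompact_set.isBounded (hsub c.2) (hsub ha))

lemma Elem.card_bdry_le (K : T.Elem) : K.bdry.card ≤ d + 1 := by
  classical
  have h1 : (K.bdry.map ⟨fun F : T.Facet => F.1, Subtype.val_injective⟩)
      ⊆ K.1.powersetCard d := by
    intro s hs
    obtain ⟨F, hF, rfl⟩ := Finset.mem_map.1 hs
    exact Finset.mem_powersetCard.2 ⟨Elem.mem_bdry.1 hF, F.2.2⟩
  have h2 := Finset.card_le_card h1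
  rwa [Finset.card_map, Finset.card_powersetCard, K.2.2, Nat.choose_succ_self_right] at h2

lemma Facet.exists_elem (F : T.Facet) : ∃ K : T.Elem, F ∈ K.bdry := by
  obtain ⟨t, ht, hst, hcard⟩ := T.pure F.1 F.2.1
  exact ⟨⟨t, ht, hcard⟩, Elem.mem_bdry.2 hst⟩

/-! ### Surface integrals -/

lemma Facet.integral_surf (F : T.Facet) (f : Pt d → ℝ) :
    ∫ x, f x.1 ∂F.surf = ∫ y in F.set, f y ∂(μHE[d - 1] : Measure (Pt d)) :=
  integral_subtype_comap F.isCompact_set.measurableSet f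

lemma Facet.isFiniteMeasure_surf (hd : 1 ≤ d) (F : T.Facet) : IsFiniteMeasure F.surf := by
  obtain ⟨K, hK⟩ := F.exists_elem
  obtain ⟨c, hc⟩ := exists_isOpposite hK
  obtain ⟨a, ha⟩ := IsOpposite.exists_ne hd c
  refine ⟨?_⟩
  rw [Facet.surf, comap_subtype_coe_apply F.isCompact_set.measurableSet, Set.image_univ,
    Subtype.range_coe, hc.set_eq]
  exact measure_simplexFacet_lt_top (hc.isFacetNormal hd) ha

lemma Facet.integrable_surf (hd : 1 ≤ d) (F : T.Facet) {φ : F.set → ℝ} (hφ : Continuous φ) :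
    Integrable φ F.surf := by
  have := F.isFiniteMeasure_surf hd
  obtain ⟨C, hC⟩ := isCompact_univ.exists_bound_of_continuousOn hφ.continuousOn
  exact Integrable.of_bound hφ.aestronglyMeasurable C
    (Filter.Eventually.of_forall fun x => hC x (Set.mem_univ x))

lemma Elem.integrableOn (K : T.Elem) {f : Pt d → ℝ} (hf : Continuous f) :
    IntegrableOn f K.set :=
  hf.continuousOn.integrableOn_compact K.isCompact_set

/-! ### Adjacency of elements -/

/-- At most `d` points span an affine subspace of dimension below `d`. -/
lemma addHaar_affineSpan_eq_zero (s : Finset (Pt d)) (hs : s.card ≤ d) :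
    volume (affineSpan ℝ (s : Set (Pt d)) : Set (Pt d)) = 0 := by
  refine Measure.addHaar_affineSubspace volume _ fun h => ?_
  rcases s.eq_empty_or_nonempty with rfl | hne
  · rw [Finset.coe_empty, AffineSubspace.span_empty] at h
    exact AffineSubspace.bot_ne_top ℝ _ _ h
  obtain ⟨m, hm⟩ : ∃ m, s.card = m + 1 := ⟨s.card - 1, by have := hne.card_pos; omega⟩
  have h1 := finrank_vectorSpan_image_finset_le ℝ id s hm
  rw [Finset.image_id, ← direction_affineSpan, h, AffineSubspace.direction_top, finrank_top,
    finrank_euclideanSpace_fin] at h1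
  omega

/-- A set of elements that is stable under passing to a neighbour across a common facet contains
every element as soon as it is nonempty. -/
theorem forall_elem_of_adjacent (hΩ : IsPolygonalDomain Ω) (S : T.Elem → Prop)
    (hS : ∀ K K' : T.Elem, ∀ F : T.Facet, F ∈ K.bdry → F ∈ K'.bdry → S K → S K')
    (hne : ∃ K, S K) : ∀ K, S K := by
  classical
  by_contra! hcon
  obtain ⟨K₀, hK₀⟩ := hne
  obtain ⟨K₁, hK₁⟩ := hcon
  set A : Set (Pt d) := ⋃ K : {K : T.Elem // S K}, K.1.set with hA
  set B : Set (Pt d) := ⋃ K : {K : T.Elem // ¬ S K}, K.1.set with hB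
  have hAc : IsClosed A := isClosed_iUnion_of_finite fun K => K.1.isCompact_set.isClosed
  have hBc : IsClosed B := isClosed_iUnion_of_finite fun K => K.1.isCompact_set.isClosed
  have hcover : closure Ω ⊆ A ∪ B := by
    rw [← T.space_eq]
    intro x hx
    obtain ⟨s, hs, hxs⟩ := Geometry.SimplicialComplex.mem_space_iff.1 hx
    obtain ⟨t, ht, hst, hcard⟩ := T.pure s hs
    have hxt : x ∈ Elem.set (T := T) ⟨t, ht, hcard⟩ := convexHull_mono (by exact_mod_cast hst) hxs
    by_cases h : S ⟨t, ht, hcard⟩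
    · exact Or.inl (Set.mem_iUnion.2 ⟨⟨_, h⟩, hxt⟩)
    · exact Or.inr (Set.mem_iUnion.2 ⟨⟨_, h⟩, hxt⟩)
  have hsub : ∀ K : T.Elem, K.set ⊆ closure Ω := fun K => by
    rw [← T.space_eq]; exact Geometry.SimplicialComplex.convexHull_subset_space K.2.1
  have hint : ∀ K : T.Elem, interior K.set ⊆ Ω := fun K =>
    (interior_mono (hsub K)).trans hΩ.interior_closure.subset
  have hintne : ∀ K : T.Elem, (interior K.set).Nonempty := fun K => by
    rw [K.set_eq]; exact interior_simplexSet_nonempty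
  -- `A` and `B` are closed, cover the connected set `Ω` and both meet it, so they have a common
  -- point inside `Ω`. A small ball around that point stays in `Ω`.
  obtain ⟨x₀, hx₀Ω, hx₀A, hx₀B⟩ : (Ω ∩ (A ∩ B)).Nonempty := by
    refine isPreconnected_closed_iff.1 hΩ.isConnected.isPreconnected A B hAc hBc
      (subset_closure.trans hcover) ?_ ?_
    · obtain ⟨x, hx⟩ := hintne K₀
      exact ⟨x, hint K₀ hx, Set.mem_iUnion.2 ⟨⟨K₀, hK₀⟩, interior_subset hx⟩⟩
    · obtain ⟨x, hx⟩ := hintne K₁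
      exact ⟨x, hint K₁ hx, Set.mem_iUnion.2 ⟨⟨K₁, hK₁⟩, interior_subset hx⟩⟩
  obtain ⟨r, hr, hball⟩ := Metric.isOpen_iff.1 hΩ.isOpen x₀ hx₀Ω
  -- the open pieces of the elements near `x₀`, minus finitely many null sets, are nonempty
  have hpick : ∀ K : T.Elem, x₀ ∈ K.set → ∀ N : Set (Pt d), volume N = 0 →
      ∃ x ∈ Metric.ball x₀ r, x ∈ interior K.set ∧ x ∉ N := by
    intro K hxK N hN
    have hcl : x₀ ∈ closure (interior K.set) := by
      rw [K.set_eq, closure_interior_simplexSet, ← K.set_eq]; exact hxK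
    have hopen : IsOpen (Metric.ball x₀ r ∩ interior K.set) :=
      Metric.isOpen_ball.inter isOpen_interior
    have hpos : 0 < volume (Metric.ball x₀ r ∩ interior K.set) :=
      hopen.measure_pos volume
        (mem_closure_iff.1 hcl _ Metric.isOpen_ball (Metric.mem_ball_self hr))
    by_contra! h
    exact hpos.ne' (measure_mono_null (fun x hx => h x hx.1 hx.2) hN)
  obtain ⟨⟨KA, hKA⟩, hxA⟩ := Set.mem_iUnion.1 hx₀A
  obtain ⟨⟨KB, hKB⟩, hxB⟩ := Set.mem_iUnion.1 hx₀B
  -- `L` collects the faces of codimension at least two. The point `x` avoids their affine spans,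
  -- and `y` avoids their joins with `x`, which have at most `d` spanning points and are still null
  -- sets. Hence no point of the segment from `x` to `y` lies on such a face.
  set L : Set (Finset (Pt d)) := {s | s ∈ T.faces ∧ s.card + 1 ≤ d} with hL
  have hLfin : L.Finite := T.finite_faces.subset fun s hs => hs.1
  obtain ⟨x, hxball, hxint, hxN⟩ := hpick KA hxA
    (⋃ s ∈ L, (affineSpan ℝ (s : Set (Pt d)) : Set (Pt d)))
    ((measure_biUnion_null_iff hLfin.countable).2 fun s hs =>
      addHaar_affineSpan_eq_zero s (by have := hs.2; omega))
  obtain ⟨y, hyball, hyint, hyN⟩ := hpick KB hxB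
    (⋃ s ∈ L, (affineSpan ℝ ((insert x s : Finset (Pt d)) : Set (Pt d)) : Set (Pt d)))
    ((measure_biUnion_null_iff hLfin.countable).2 fun s hs =>
      addHaar_affineSpan_eq_zero _ ((Finset.card_insert_le _ _).trans hs.2))
  have hseg : segment ℝ x y ⊆ Ω :=
    ((convex_ball x₀ r).segment_subset hxball hyball).trans hball
  obtain ⟨z, hzseg, hzA, hzB⟩ : (segment ℝ x y ∩ (A ∩ B)).Nonempty := by
    refine isPreconnected_closed_iff.1 (convex_segment x y).isPreconnected A B hAc hBc
      (hseg.trans (subset_closure.trans hcover)) ?_ ?_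
    · exact ⟨x, left_mem_segment ℝ x y, Set.mem_iUnion.2 ⟨⟨KA, hKA⟩, interior_subset hxint⟩⟩
    · exact ⟨y, right_mem_segment ℝ x y, Set.mem_iUnion.2 ⟨⟨KB, hKB⟩, interior_subset hyint⟩⟩
  obtain ⟨⟨K, hK⟩, hzK⟩ := Set.mem_iUnion.1 hzA
  obtain ⟨⟨K', hK'⟩, hzK'⟩ := Set.mem_iUnion.1 hzB
  have hz : z ∈ convexHull ℝ ((K.1 ∩ K'.1 : Finset (Pt d)) : Set (Pt d)) := by
    rw [Finset.coe_inter]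
    exact T.inter_subset_convexHull K.2.1 K'.2.1 ⟨hzK, hzK'⟩
  set s := K.1 ∩ K'.1 with hs
  have hsne : s.Nonempty := by
    rw [← Finset.coe_nonempty]; exact convexHull_nonempty_iff.1 ⟨z, hz⟩
  have hsface : s ∈ T.faces := T.down_closed K.2.1 Finset.inter_subset_left hsne
  have hscard : s.card ≤ d + 1 := (Finset.card_le_card Finset.inter_subset_left).trans K.2.2.le
  -- By conformity `z` lies in the common face `s`. With fewer than `d` vertices it contradicts the
  -- choice of `x` and `y`, with `d` vertices it is a shared facet, and with `d + 1` vertices the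
  -- two elements coincide.
  rcases Nat.lt_or_ge s.card d with hlt | hge
  · have hsL : s ∈ L := ⟨hsface, hlt⟩
    have hzs : z ∈ affineSpan ℝ (s : Set (Pt d)) := convexHull_subset_affineSpan _ hz
    rw [segment_eq_image_lineMap] at hzseg
    obtain ⟨θ, hθ, rfl⟩ := hzseg
    by_cases hθ0 : θ = 0
    · rw [hθ0, AffineMap.lineMap_apply_zero] at hzs
      exact hxN (Set.mem_biUnion hsL hzs)
    · refine hyN (Set.mem_biUnion hsL ?_)
      have hx' : x ∈ affineSpan ℝ ((insert x s : Finset (Pt d)) : Set (Pt d)) :=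
        subset_affineSpan ℝ _ (by simp)
      have hz' : AffineMap.lineMap x y θ
          ∈ affineSpan ℝ ((insert x s : Finset (Pt d)) : Set (Pt d)) :=
        affineSpan_mono ℝ (by exact_mod_cast Finset.subset_insert x s) hzs
      have hy' := AffineMap.lineMap_mem θ⁻¹ hx' hz'
      rwa [AffineMap.lineMap_lineMap_right, inv_mul_cancel₀ hθ0,
        AffineMap.lineMap_apply_one] at hy'
  · rcases hge.eq_or_lt with heq | hlt
    · exact hK' (hS K K' ⟨s, hsface, heq.symm⟩ (Elem.mem_bdry.2 Finset.inter_subset_left)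
        (Elem.mem_bdry.2 Finset.inter_subset_right) hK)
    · have h1 : s = K.1 := Finset.eq_of_subset_of_card_le Finset.inter_subset_left
        (by rw [K.2.2]; omega)
      have h2 : s = K'.1 := Finset.eq_of_subset_of_card_le Finset.inter_subset_right
        (by rw [K'.2.2]; omega)
      have h3 : K = K' := Subtype.ext (h1.symm.trans h2)
      exact hK' (h3 ▸ hK)

end Mesh

/-! ### Linear and bilinear functions -/

section Bilinear

variable {U V : Type*} [AddCommGroup U] [Module ℝ U] [AddCommGroup V] [Module ℝ V]

/-- Linearity of a real function. -/
structure IsLin (f : U → ℝ) : Prop where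
  add : ∀ u u', f (u + u') = f u + f u'
  smul : ∀ (c : ℝ) u, f (c • u) = c * f u

/-- Bilinearity of a real function of two arguments. -/
structure IsBil (f : U → V → ℝ) : Prop where
  left : ∀ v, IsLin fun u => f u v
  right : ∀ u, IsLin (f u)

namespace IsLin

lemma zero {f : U → ℝ} (hf : IsLin f) : f 0 = 0 := by
  simpa using hf.smul 0 0

lemma const_mul {f : U → ℝ} (hf : IsLin f) (r : ℝ) : IsLin fun u => r * f u :=
  ⟨fun u u' => by rw [hf.add, mul_add], fun c u => by rw [hf.smul]; ring⟩

lemma mul_const {f : U → ℝ} (hf : IsLin f) (r : ℝ) : IsLin fun u => f u * r :=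
  ⟨fun u u' => by rw [hf.add, add_mul], fun c u => by rw [hf.smul]; ring⟩

lemma add' {f g : U → ℝ} (hf : IsLin f) (hg : IsLin g) : IsLin fun u => f u + g u :=
  ⟨fun u u' => by rw [hf.add, hg.add]; ring, fun c u => by rw [hf.smul, hg.smul]; ring⟩

lemma sub {f g : U → ℝ} (hf : IsLin f) (hg : IsLin g) : IsLin fun u => f u - g u :=
  ⟨fun u u' => by rw [hf.add, hg.add]; ring, fun c u => by rw [hf.smul, hg.smul]; ring⟩

lemma sum {κ : Type*} {s : Finset κ} {f : κ → U → ℝ} (hf : ∀ i ∈ s, IsLin (f i)) :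
    IsLin fun u => ∑ i ∈ s, f i u :=
  ⟨fun u u' => by
    rw [← Finset.sum_add_distrib]; exact Finset.sum_congr rfl fun i hi => (hf i hi).add u u',
  fun c u => by
    rw [Finset.mul_sum]; exact Finset.sum_congr rfl fun i hi => (hf i hi).smul c u⟩

lemma integral {X : Type*} [MeasurableSpace X] {μ : Measure X} {f : X → U → ℝ}
    (hf : ∀ x, IsLin (f x)) (hi : ∀ u, Integrable (fun x => f x u) μ) :
    IsLin fun u => ∫ x, f x u ∂μ :=
  ⟨fun u u' => by
    rw [← integral_add (hi u) (hi u')]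
    exact integral_congr_ae (Filter.Eventually.of_forall fun x => (hf x).add u u'),
  fun c u => by
    rw [← integral_const_mul]
    exact integral_congr_ae (Filter.Eventually.of_forall fun x => (hf x).smul c u)⟩

lemma comp {f : U → ℝ} (hf : IsLin f) (φ : V →ₗ[ℝ] U) : IsLin fun v => f (φ v) :=
  ⟨fun u u' => by rw [map_add, hf.add], fun c u => by rw [map_smul, hf.smul]⟩

lemma fst {f : U → ℝ} (hf : IsLin f) : IsLin fun p : U × V => f p.1 :=
  ⟨fun _ _ => hf.add _ _, fun _ _ => hf.smul _ _⟩

lemma snd {f : V → ℝ} (hf : IsLin f) : IsLin fun p : U × V => f p.2 :=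
  ⟨fun _ _ => hf.add _ _, fun _ _ => hf.smul _ _⟩

end IsLin

namespace IsBil

lemma mul {f : U → ℝ} {g : V → ℝ} (hf : IsLin f) (hg : IsLin g) : IsBil fun u v => f u * g v :=
  ⟨fun _ => hf.mul_const _, fun _ => hg.const_mul _⟩

lemma const_mul {f : U → V → ℝ} (hf : IsBil f) (r : ℝ) : IsBil fun u v => r * f u v :=
  ⟨fun v => (hf.left v).const_mul r, fun u => (hf.right u).const_mul r⟩

lemma add {f g : U → V → ℝ} (hf : IsBil f) (hg : IsBil g) : IsBil fun u v => f u v + g u v :=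
  ⟨fun v => (hf.left v).add' (hg.left v), fun u => (hf.right u).add' (hg.right u)⟩

lemma sub {f g : U → V → ℝ} (hf : IsBil f) (hg : IsBil g) : IsBil fun u v => f u v - g u v :=
  ⟨fun v => (hf.left v).sub (hg.left v), fun u => (hf.right u).sub (hg.right u)⟩

lemma neg {f : U → V → ℝ} (hf : IsBil f) : IsBil fun u v => -f u v := by
  simpa using hf.const_mul (-1)

lemma sum {κ : Type*} {s : Finset κ} {f : κ → U → V → ℝ} (hf : ∀ i ∈ s, IsBil (f i)) :
    IsBil fun u v => ∑ i ∈ s, f i u v :=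
  ⟨fun _ => IsLin.sum fun i hi => (hf i hi).left _,
    fun _ => IsLin.sum fun i hi => (hf i hi).right _⟩

lemma integral {X : Type*} [MeasurableSpace X] {μ : Measure X} {f : X → U → V → ℝ}
    (hf : ∀ x, IsBil (f x)) (hi : ∀ u v, Integrable (fun x => f x u v) μ) :
    IsBil fun u v => ∫ x, f x u v ∂μ :=
  ⟨fun v => IsLin.integral (fun x => (hf x).left v) fun u => hi u v,
    fun u => IsLin.integral (fun x => (hf x).right u) fun v => hi u v⟩

lemma swap {f : U → V → ℝ} (hf : IsBil f) : IsBil fun v u => f u v := ⟨hf.right, hf.left⟩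

/-- A nondegenerate square linear system is uniquely solvable. -/
theorem existsUnique [FiniteDimensional ℝ U] {f : U → U → ℝ} (hf : IsBil f)
    (h0 : ∀ u, (∀ v, f u v = 0) → u = 0) {g : U → ℝ} (hg : IsLin g) :
    ∃! u, ∀ v, f u v = g v := by
  let B : U →ₗ[ℝ] Module.Dual ℝ U := LinearMap.mk₂ ℝ f
    (fun u u' v => (hf.left v).add u u') (fun c u v => (hf.left v).smul c u)
    (fun u v v' => (hf.right u).add v v') (fun c u v => (hf.right u).smul c v)
  let G : Module.Dual ℝ U :=
    { toFun := g, map_add' := hg.add, map_smul' := fun c v => hg.smul c v }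
  have hinj : Function.Injective B := by
    rw [injective_iff_map_eq_zero]
    exact fun u hu => h0 u fun v => congrArg (fun φ => φ v) hu
  have hsurj : Function.Surjective B :=
    (LinearMap.injective_iff_surjective_of_finrank_eq_finrank
      (Subspace.dual_finrank_eq (K := ℝ) (V := U)).symm).1 hinj
  obtain ⟨u, hu⟩ := hsurj G
  refine ⟨u, fun v => congrArg (fun φ => φ v) hu, fun u' hu' => hinj ?_⟩
  rw [hu]
  exact LinearMap.ext hu'

end IsBil

end Bilinear

/-! ### Discrete spaces -/

section DiscreteSpaces

variable {d : ℕ} {Ω : Set (Pt d)} {T : Mesh Ω}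

lemma exists_eq_val_of_mem_facetPoly {l : ℕ} {F : T.Facet} {φ : F.set → ℝ}
    (h : φ ∈ facetPoly l F) : ∃ p : Poly d l, ∀ x, φ x = val p.1 x.1 := h

lemma continuous_of_mem_facetPoly {l : ℕ} {F : T.Facet} {φ : F.set → ℝ}
    (h : φ ∈ facetPoly l F) : Continuous φ := by
  obtain ⟨p, hp⟩ := exists_eq_val_of_mem_facetPoly h
  rw [funext hp]
  exact (continuous_val _).comp continuous_subtype_val

lemma traceSpace_le_skelPoly (k : ℕ) (ΓD : Set (Pt d)) (m : Method) :
    traceSpace T k ΓD m ≤ skelPoly T k ΓD := by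
  cases m
  · exact le_rfl
  · exact inf_le_left

lemma toField_mem_facetPoly {k : ℕ} {ΓD : Set (Pt d)} {m : Method} (v : VbarH T k ΓD m)
    (i : Fin d) (F : T.Facet) : v.toField i F ∈ facetPoly k F :=
  (traceSpace_le_skelPoly k ΓD m (v i).2).1 F

lemma toField_eq_zero {k : ℕ} {ΓD : Set (Pt d)} {m : Method} (v : VbarH T k ΓD m)
    (i : Fin d) (F : T.Facet) (hF : F.LiesOn ΓD) : v.toField i F = 0 :=
  (traceSpace_le_skelPoly k ΓD m (v i).2).2 F hF

instance finiteDimensional_skelPoly (l : ℕ) (Γ : Set (Pt d)) :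
    FiniteDimensional ℝ (skelPoly T l Γ) := by
  let Φ : (T.Facet → Poly d l) →ₗ[ℝ] SkelFun T :=
    { toFun := fun p F x => val (p F).1 x.1
      map_add' := fun p q => by ext F x; exact val_add _ _ _
      map_smul' := fun c p => by ext F x; exact val_smul _ _ _ }
  have hle : skelPoly T l Γ ≤ LinearMap.range Φ := fun φ hφ => by
    choose p hp using fun F => exists_eq_val_of_mem_facetPoly (hφ.1 F)
    exact ⟨p, by ext F x; exact (hp F x).symm⟩
  exact Submodule.finiteDimensional_of_le hle

instance finiteDimensional_traceSpace (k : ℕ) (ΓD : Set (Pt d)) (m : Method) :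
    FiniteDimensional ℝ (traceSpace T k ΓD m) :=
  Submodule.finiteDimensional_of_le (traceSpace_le_skelPoly k ΓD m)

lemma continuous_jmp {k : ℕ} (v : Vh T k) {vbar : SkelField T}
    (hv : ∀ i F, Continuous (vbar i F)) (K : T.Elem) (F : T.Facet) (i : Fin d) :
    Continuous (jmp v vbar K F i) :=
  ((continuous_val _).comp continuous_subtype_val).sub (hv i F)

lemma continuous_epsn {k : ℕ} (v : Vh T k) (K : T.Elem) (F : T.Facet) (i : Fin d) :
    Continuous (epsn v K F i) :=
  continuous_finsetSum _ fun _ _ =>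
    ((continuous_val _).comp continuous_subtype_val).mul continuous_const

end DiscreteSpaces

/-! ### Bilinearity of the forms -/

section FormsBilinear

variable {d : ℕ} {Ω : Set (Pt d)} {T : Mesh Ω} {k l : ℕ} {ΓD Γ : Set (Pt d)} {m : Method}

lemma continuous_toField (v : VbarH T k ΓD m) (i : Fin d) (F : T.Facet) :
    Continuous (v.toField i F) := continuous_of_mem_facetPoly (toField_mem_facetPoly v i F)

lemma continuous_skel (q : skelPoly T l Γ) (F : T.Facet) : Continuous (q.1 F) :=
  continuous_of_mem_facetPoly (q.2.1 F)

lemma isLin_val (K : T.Elem) (x : Pt d) : IsLin fun p : T.Elem → Poly d l => val (p K).1 x :=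
  ⟨fun _ _ => val_add _ _ _, fun _ _ => val_smul _ _ _⟩

lemma isLin_val_comp (K : T.Elem) (i : Fin d) (x : Pt d) :
    IsLin fun v : Vh T k => val (v K i).1 x :=
  ⟨fun _ _ => val_add _ _ _, fun _ _ => val_smul _ _ _⟩

lemma isLin_pderiv (K : T.Elem) (i j : Fin d) (x : Pt d) :
    IsLin fun v : Vh T k => val (MvPolynomial.pderiv j (v K i).1) x :=
  ⟨fun u v => by
    rw [← val_add, ← map_add]; rfl,
  fun c v => by rw [← val_smul, ← Derivation.map_smul]; rfl⟩

lemma isLin_eps (K : T.Elem) (i j : Fin d) (x : Pt d) :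
    IsLin fun v : Vh T k => val (eps v K i j) x := by
  simp only [eps, val_smul, val_add]
  exact ((isLin_pderiv K i j x).add' (isLin_pderiv K j i x)).const_mul _

lemma isLin_divg (K : T.Elem) (x : Pt d) : IsLin fun v : Vh T k => val (divg v K) x := by
  simp only [divg, val_sum]
  exact IsLin.sum fun i _ => isLin_pderiv K i i x

lemma isLin_epsn (K : T.Elem) (F : T.Facet) (i : Fin d) (x : F.set) :
    IsLin fun v : Vh T k => epsn v K F i x :=
  IsLin.sum fun j _ => (isLin_eps K i j x.1).mul_const _

lemma isLin_jmp (K : T.Elem) (F : T.Facet) (i : Fin d) (x : F.set) :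
    IsLin fun v : VV T k ΓD m => jmp v.1 v.2.toField K F i x := by
  refine ((isLin_val_comp K i x.1).fst).sub ?_
  exact ⟨fun _ _ => rfl, fun _ _ => rfl⟩

lemma isLin_skel (F : T.Facet) (x : F.set) : IsLin fun q : skelPoly T l Γ => q.1 F x :=
  ⟨fun _ _ => rfl, fun _ _ => rfl⟩

lemma isBil_ipQ : IsBil fun p q : T.Elem → Poly d l => ipQ p q := by
  refine IsBil.sum fun K _ => IsBil.integral (fun x => IsBil.mul (isLin_val K x) (isLin_val K x))
    fun p q => K.integrableOn ((continuous_val _).mul (continuous_val _))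

lemma isBil_ipV : IsBil fun z w : Vh T k => ipV z w := by
  refine IsBil.sum fun K _ => IsBil.integral (fun x => IsBil.sum fun i _ =>
    IsBil.mul (isLin_val_comp K i x) (isLin_val_comp K i x)) fun p q => K.integrableOn ?_
  exact continuous_finsetSum _ fun i _ => (continuous_val _).mul (continuous_val _)

lemma isBil_bh (hd : 1 ≤ d) {l' : ℕ} :
    IsBil fun (v : VV T k ΓD m) (q : (T.Elem → Poly d l) × skelPoly T l' Γ) =>
      bh v.1 v.2.toField q.1 q.2.1 := by
  refine IsBil.add (IsBil.neg (IsBil.sum fun K _ => IsBil.integral (fun x => ?_) fun p q => ?_))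
    (IsBil.sum fun K _ => IsBil.sum fun F _ => IsBil.integral (fun x => ?_) fun p q => ?_)
  · exact (IsBil.mul ((isLin_val K x).fst)
      ((isLin_divg K x).fst)).swap
  · exact K.integrableOn ((continuous_val _).mul (continuous_val _))
  · exact (IsBil.mul ((isLin_skel F x).snd)
      (IsLin.sum fun i _ => (isLin_jmp K F i x).mul_const _)).swap
  · refine F.integrable_surf hd ((continuous_skel _ F).mul ?_)
    exact continuous_finsetSum _ fun i _ =>
      (continuous_jmp _ (continuous_toField _) K F i).mul continuous_const

lemma isBil_ah_volume (μ : ℝ) : IsBil fun u v : Vh T k => ∑ K : T.Elem, ∫ x in K.set,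
    ∑ i, ∑ j, 2 * μ * val (eps u K i j) x * val (eps v K i j) x := by
  refine IsBil.sum fun K _ => IsBil.integral (fun x => ?_) fun u v => ?_
  · exact IsBil.sum fun i _ => IsBil.sum fun j _ => IsBil.mul
      ((isLin_eps K i j x).const_mul _) (isLin_eps K i j x)
  · refine K.integrableOn ?_
    exact continuous_finsetSum _ fun i _ => continuous_finsetSum _ fun j _ =>
      (continuous_const.mul (continuous_val _)).mul (continuous_val _)

lemma isBil_ah_penalty (hd : 1 ≤ d) (r : T.Elem → ℝ) : IsBil fun u v : VV T k ΓD m =>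
    ∑ K : T.Elem, ∑ F ∈ K.bdry, ∫ x, r K *
      ∑ i, jmp u.1 u.2.toField K F i x * jmp v.1 v.2.toField K F i x ∂F.surf := by
  refine IsBil.sum fun K _ => IsBil.sum fun F _ => IsBil.integral (fun x => ?_) fun u v => ?_
  · exact (IsBil.sum fun i _ => IsBil.mul (isLin_jmp K F i x) (isLin_jmp K F i x)).const_mul _
  · exact F.integrable_surf hd (continuous_const.mul (continuous_finsetSum _ fun i _ =>
      (continuous_jmp _ (continuous_toField _) K F i).mul
        (continuous_jmp _ (continuous_toField _) K F i)))

lemma isBil_ah_consistency (hd : 1 ≤ d) (μ : ℝ) : IsBil fun u v : VV T k ΓD m =>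
    ∑ K : T.Elem, ∑ F ∈ K.bdry,
      ∫ x, ∑ i, 2 * μ * epsn u.1 K F i x * jmp v.1 v.2.toField K F i x ∂F.surf := by
  refine IsBil.sum fun K _ => IsBil.sum fun F _ => IsBil.integral (fun x => ?_) fun u v => ?_
  · exact IsBil.sum fun i _ => IsBil.mul ((isLin_epsn K F i x).const_mul _).fst
      (isLin_jmp K F i x)
  · exact F.integrable_surf hd (continuous_finsetSum _ fun i _ =>
      (continuous_const.mul (continuous_epsn _ K F i)).mul
        (continuous_jmp _ (continuous_toField _) K F i))

lemma isBil_ah (hd : 1 ≤ d) (μ β : ℝ) :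
    IsBil fun u v : VV T k ΓD m => ah μ β u.1 u.2.toField v.1 v.2.toField := by
  have h1 : IsBil fun u v : VV T k ΓD m => ∑ K : T.Elem, ∫ x in K.set,
      ∑ i, ∑ j, 2 * μ * val (eps u.1 K i j) x * val (eps v.1 K i j) x :=
    ⟨fun v => ((isBil_ah_volume μ).left v.1).fst, fun u => ((isBil_ah_volume μ).right u.1).fst⟩
  have h3 := isBil_ah_consistency (T := T) (k := k) (ΓD := ΓD) (m := m) hd μ
  exact ((h1.add (isBil_ah_penalty hd fun K => 2 * β * μ / K.h)).sub h3).sub h3.swap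

/-- Square integrable functions on the domain are integrable over the elements. -/
lemma integrableOn_elem_of_memLp (hΩ : IsPolygonalDomain Ω) {g : Pt d → ℝ}
    (hg : MemLp g 2 (volume.restrict Ω)) (K : T.Elem) : IntegrableOn g K.set := by
  have hsub : interior K.set ⊆ Ω := by
    refine (interior_mono ?_).trans hΩ.interior_closure.subset
    rw [← T.space_eq]
    exact Geometry.SimplicialComplex.convexHull_subset_space K.2.1
  have hconv : Convex ℝ K.set := convex_convexHull ℝ _
  -- Only the interior of `K` is known to lie in `Ω`, because `Ω` is the interior of its closure.
  -- The boundary of a convex set is null, so this suffices.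
  have hrestrict : volume.restrict (interior K.set) = volume.restrict K.set :=
    Measure.restrict_congr_set (interior_ae_eq_of_null_frontier (hconv.addHaar_frontier volume))
  have : IsFiniteMeasure (volume.restrict (interior K.set)) := by
    rw [hrestrict]
    exact ⟨by rw [Measure.restrict_apply_univ]; exact K.isCompact_set.measure_lt_top⟩
  rw [IntegrableOn, ← hrestrict]
  exact (hg.mono_measure (Measure.restrict_mono hsub le_rfl)).integrable one_le_two

lemma isLin_loadQ (hΩ : IsPolygonalDomain Ω) {g : Pt d → ℝ}
    (hg : MemLp g 2 (volume.restrict Ω)) : IsLin fun q : T.Elem → Poly d l => loadQ g q :=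
  IsLin.sum fun K _ => IsLin.integral (fun x => (isLin_val K x).const_mul _) fun _ =>
    (integrableOn_elem_of_memLp hΩ hg K).mul_continuousOn (continuous_val _).continuousOn
      K.isCompact_set

lemma isLin_loadV (hΩ : IsPolygonalDomain Ω) {f : Pt d → Pt d}
    (hf : MemLp f 2 (volume.restrict Ω)) : IsLin fun v : Vh T k => loadV f v := by
  have hfi : ∀ i, MemLp (fun x => f x i) 2 (volume.restrict Ω) := fun i =>
    (EuclideanSpace.proj i : Pt d →L[ℝ] ℝ).comp_memLp' hf
  exact IsLin.sum fun K _ => IsLin.integral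
    (fun x => IsLin.sum fun i _ => (isLin_val_comp K i x).const_mul _) fun _ =>
    integrable_finsetSum _ fun i _ => (integrableOn_elem_of_memLp hΩ (hfi i) K).mul_continuousOn
      (continuous_val _).continuousOn K.isCompact_set

end FormsBilinear

/-! ### Coercivity of `a_h` -/

section Coercivity

/-- The discrete trace inequality, with a constant that only depends on the dimension, the degree and
the shape regularity. -/
lemma exists_trace_constant (d : ℕ) (hd : 1 ≤ d) (k : ℕ) : ∃ C : ℝ, 0 < C ∧
    ∀ {Ω : Set (Pt d)} {T : Mesh Ω} {γ : ℝ}, T.ShapeRegular γ → ∀ (K : T.Elem), ∀ F ∈ K.bdry,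
      ∀ q : MvPolynomial (Fin d) ℝ, q.totalDegree ≤ k →
        K.h * ∫ x, val q x.1 ^ 2 ∂F.surf ≤ |γ| * C * ∫ x in K.set, val q x ^ 2 := by
  obtain ⟨C, hC0, hC⟩ := exists_mul_sq_eval_zero_le k
  -- The factor `d + 1` counts the vertices in the facet estimate. The factor `|γ|` comes from
  -- replacing the height over the facet by `h_K`.
  refine ⟨(d + 1) * C, by positivity, fun {Ω T γ} hT K F hF q hq => ?_⟩
  obtain ⟨c, hc⟩ := Mesh.exists_isOpposite hF
  obtain ⟨a, ha⟩ := Mesh.IsOpposite.exists_ne hd c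
  set H : ℝ := inner ℝ (K.normal F) (K.basis a - K.basis c) with hH
  have hH0 : 0 < H := hc.inner_normal_pos hd ha
  have hτ : ∀ a', a' ≠ c → |inner ℝ (K.normal F) (K.basis c - K.basis a')| = H := fun a' ha' => by
    rw [← neg_sub, inner_neg_right, abs_neg, hc.inner_normal_eq hd ha' ha, abs_of_pos hH0]
  have h1 := trace_inequality hC (hc.isFacetNormal hd) hτ hC0.le ⟨a, ha⟩ hq
  rw [← hc.set_eq, ← K.set_eq, ← F.integral_surf fun x => val q x ^ 2, K.card_vertices] at h1
  have h2 := hT.h_le hd hc ha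
  have h3 : 0 ≤ ∫ x, val q x.1 ^ 2 ∂F.surf := integral_nonneg fun x => sq_nonneg _
  push_cast at h1
  calc K.h * ∫ x, val q x.1 ^ 2 ∂F.surf ≤ |γ| * H * ∫ x, val q x.1 ^ 2 ∂F.surf := by gcongr
    _ = |γ| * (H * ∫ x, val q x.1 ^ 2 ∂F.surf) := by ring
    _ ≤ |γ| * ((d + 1) * (C * ∫ x in K.set, val q x ^ 2)) := by gcongr
    _ = |γ| * ((d + 1) * C) * ∫ x in K.set, val q x ^ 2 := by ring

variable {d : ℕ} {Ω : Set (Pt d)} {T : Mesh Ω} {k : ℕ}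

lemma totalDegree_le_of_poly {l : ℕ} (p : Poly d l) : p.1.totalDegree ≤ l :=
  (MvPolynomial.mem_restrictTotalDegree _ _ _).1 p.2

lemma totalDegree_eps_le (v : Vh T k) (K : T.Elem) (i j : Fin d) :
    (eps v K i j).totalDegree ≤ k := by
  have h : ∀ i j, (MvPolynomial.pderiv j (v K i).1).totalDegree ≤ k := fun i j =>
    (totalDegree_pderiv_le _ _).trans ((Nat.sub_le _ _).trans (totalDegree_le_of_poly _))
  exact (MvPolynomial.totalDegree_smul_le _ _).trans
    ((MvPolynomial.totalDegree_add _ _).trans (max_le (h i j) (h j i)))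

lemma sum_epsn_sq_le (hd : 1 ≤ d) (v : Vh T k) {K : T.Elem} {F : T.Facet} (hF : F ∈ K.bdry)
    (x : F.set) : ∑ i, epsn v K F i x ^ 2 ≤ ∑ i, ∑ j, val (eps v K i j) x.1 ^ 2 := by
  obtain ⟨c, hc⟩ := Mesh.exists_isOpposite hF
  have hn : ∑ j, K.normal F j ^ 2 = 1 := by
    rw [← EuclideanSpace.real_norm_sq_eq, (hc.isFacetNormal hd).norm_eq, one_pow]
  refine Finset.sum_le_sum fun i _ => ?_
  have h := Finset.sum_mul_sq_le_sq_mul_sq Finset.univ (fun j => val (eps v K i j) x.1)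
    (fun j => K.normal F j)
  rwa [hn, mul_one] at h

/-- The elementwise energy `‖ε(v)‖²_K`. -/
def energy (v : Vh T k) (K : T.Elem) : ℝ := ∫ x in K.set, ∑ i, ∑ j, val (eps v K i j) x ^ 2

/-- The squared norm of the jump `v - v̄` on a facet of an element. -/
def jumpSq (v : Vh T k) (vbar : SkelField T) (K : T.Elem) (F : T.Facet) : ℝ :=
  ∫ x, ∑ i, jmp v vbar K F i x ^ 2 ∂F.surf

lemma energy_nonneg (v : Vh T k) (K : T.Elem) : 0 ≤ energy v K :=
  integral_nonneg fun _ => Finset.sum_nonneg fun _ _ => Finset.sum_nonneg fun _ _ => sq_nonneg _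

lemma jumpSq_nonneg (v : Vh T k) (vbar : SkelField T) (K : T.Elem) (F : T.Facet) :
    0 ≤ jumpSq v vbar K F :=
  integral_nonneg fun _ => Finset.sum_nonneg fun _ _ => sq_nonneg _

lemma energy_eq_sum (v : Vh T k) (K : T.Elem) :
    energy v K = ∑ i, ∑ j, ∫ x in K.set, val (eps v K i j) x ^ 2 := by
  have hc : ∀ i j, Continuous fun x => val (eps v K i j) x ^ 2 := fun i j =>
    (continuous_val _).pow 2
  rw [energy, integral_finsetSum _ fun i _ =>
    K.integrableOn (continuous_finsetSum _ fun j _ => hc i j)]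
  exact Finset.sum_congr rfl fun i _ => integral_finsetSum _ fun j _ => K.integrableOn (hc i j)

/-- Young's inequality with weight `θ h_K`, followed by the trace inequality for each entry of
`ε(v)`. The weight cancels the factor `h_K` of the trace inequality and puts `h_K⁻¹` on the jump,
which is the scaling of the penalty. -/
lemma two_mul_integral_epsn_jmp_le (hd : 1 ≤ d) {C γ : ℝ}
    (hC : ∀ (K : T.Elem), ∀ F ∈ K.bdry,
      ∀ q : MvPolynomial (Fin d) ℝ, q.totalDegree ≤ k →
        K.h * ∫ x, val q x.1 ^ 2 ∂F.surf ≤ |γ| * C * ∫ x in K.set, val q x ^ 2)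
    (v : Vh T k) {vbar : SkelField T} (hv : ∀ i F, Continuous (vbar i F)) {K : T.Elem}
    {F : T.Facet} (hF : F ∈ K.bdry) {θ : ℝ} (hθ : 0 < θ) :
    2 * ∫ x, ∑ i, epsn v K F i x * jmp v vbar K F i x ∂F.surf
      ≤ θ * (|γ| * C) * energy v K + (θ * K.h)⁻¹ * jumpSq v vbar K F := by
  have hh := K.h_pos hd
  have hθh : 0 < θ * K.h := mul_pos hθ hh
  have hce : ∀ i j, Continuous fun x : F.set => val (eps v K i j) x.1 ^ 2 := fun i j =>
    ((continuous_val _).comp continuous_subtype_val).pow 2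
  have hi1 : Integrable (fun x : F.set => ∑ i, ∑ j, val (eps v K i j) x.1 ^ 2) F.surf :=
    F.integrable_surf hd (continuous_finsetSum _ fun i _ => continuous_finsetSum _ fun j _ => hce i j)
  have hi2 : Integrable (fun x => ∑ i, jmp v vbar K F i x ^ 2) F.surf :=
    F.integrable_surf hd (continuous_finsetSum _ fun i _ => (continuous_jmp v hv K F i).pow 2)
  have hi3 : Integrable (fun x => ∑ i, epsn v K F i x * jmp v vbar K F i x) F.surf :=
    F.integrable_surf hd (continuous_finsetSum _ fun i _ =>
      (continuous_epsn v K F i).mul (continuous_jmp v hv K F i))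
  have h1 : 2 * ∫ x, ∑ i, epsn v K F i x * jmp v vbar K F i x ∂F.surf
      ≤ θ * K.h * (∫ x : F.set, ∑ i, ∑ j, val (eps v K i j) x.1 ^ 2 ∂F.surf)
        + (θ * K.h)⁻¹ * jumpSq v vbar K F := by
    rw [jumpSq, ← integral_const_mul, ← integral_const_mul, ← integral_const_mul,
      ← integral_add (hi1.const_mul _) (hi2.const_mul _)]
    refine integral_mono (hi3.const_mul _) ((hi1.const_mul _).add (hi2.const_mul _)) fun x => ?_
    have hle := mul_le_mul_of_nonneg_left (sum_epsn_sq_le hd v hF x) hθh.le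
    refine le_trans ?_ (add_le_add_left hle _)
    simp only [Finset.mul_sum]
    rw [← Finset.sum_add_distrib]
    refine Finset.sum_le_sum fun i _ => ?_
    have h2 := sq_nonneg (θ * K.h * epsn v K F i x - jmp v vbar K F i x)
    have h3 : θ * K.h * epsn v K F i x ^ 2 + (θ * K.h)⁻¹ * jmp v vbar K F i x ^ 2
        - 2 * (epsn v K F i x * jmp v vbar K F i x)
        = (θ * K.h)⁻¹ * (θ * K.h * epsn v K F i x - jmp v vbar K F i x) ^ 2 := by
      field_simp
      ring
    have h4 := mul_nonneg (inv_nonneg.2 hθh.le) h2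
    linarith
  have h2 : K.h * (∫ x : F.set, ∑ i, ∑ j, val (eps v K i j) x.1 ^ 2 ∂F.surf)
      ≤ |γ| * C * energy v K := by
    have hs : (∫ x : F.set, ∑ i, ∑ j, val (eps v K i j) x.1 ^ 2 ∂F.surf)
        = ∑ i, ∑ j, ∫ x : F.set, val (eps v K i j) x.1 ^ 2 ∂F.surf := by
      rw [integral_finsetSum _ fun i _ =>
        F.integrable_surf hd (continuous_finsetSum _ fun j _ => hce i j)]
      exact Finset.sum_congr rfl fun i _ =>
        integral_finsetSum _ fun j _ => F.integrable_surf hd (hce i j)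
    rw [hs, energy_eq_sum, Finset.mul_sum, Finset.mul_sum]
    refine Finset.sum_le_sum fun i _ => ?_
    rw [Finset.mul_sum, Finset.mul_sum]
    exact Finset.sum_le_sum fun j _ => hC K F hF _ (totalDegree_eps_le v K i j)
  calc _ ≤ _ := h1
    _ = θ * (K.h * (∫ x : F.set, ∑ i, ∑ j, val (eps v K i j) x.1 ^ 2 ∂F.surf))
        + (θ * K.h)⁻¹ * jumpSq v vbar K F := by ring
    _ ≤ θ * (|γ| * C * energy v K) + (θ * K.h)⁻¹ * jumpSq v vbar K F := by gcongr
    _ = _ := by ring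

lemma ah_self_eq (μ β : ℝ) (v : Vh T k) (vbar : SkelField T) :
    ah μ β v vbar v vbar = ∑ K : T.Elem, (2 * μ * energy v K
      + ∑ F ∈ K.bdry, (2 * β * μ / K.h * jumpSq v vbar K F
        - 2 * μ * (2 * ∫ x, ∑ i, epsn v K F i x * jmp v vbar K F i x ∂F.surf))) := by
  have h1 : ∀ K : T.Elem, ∫ x in K.set,
      ∑ i, ∑ j, 2 * μ * val (eps v K i j) x * val (eps v K i j) x = 2 * μ * energy v K := by
    intro K
    rw [energy, ← integral_const_mul]
    refine integral_congr_ae (Filter.Eventually.of_forall fun x => ?_)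
    simp only [Finset.mul_sum, sq, mul_assoc]
  have h2 : ∀ (K : T.Elem) (F : T.Facet), ∫ x, 2 * β * μ / K.h *
      ∑ i, jmp v vbar K F i x * jmp v vbar K F i x ∂F.surf
      = 2 * β * μ / K.h * jumpSq v vbar K F := by
    intro K F
    rw [jumpSq, ← integral_const_mul]
    refine integral_congr_ae (Filter.Eventually.of_forall fun x => ?_)
    simp only [sq]
  have h3 : ∀ (K : T.Elem) (F : T.Facet),
      ∫ x, ∑ i, 2 * μ * epsn v K F i x * jmp v vbar K F i x ∂F.surf
      = 2 * μ * ∫ x, ∑ i, epsn v K F i x * jmp v vbar K F i x ∂F.surf := by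
    intro K F
    rw [← integral_const_mul]
    refine integral_congr_ae (Filter.Eventually.of_forall fun x => ?_)
    simp only [Finset.mul_sum, mul_assoc]
  rw [ah]
  simp only [h1, h2, h3]
  rw [← Finset.sum_add_distrib, ← Finset.sum_sub_distrib, ← Finset.sum_sub_distrib]
  refine Finset.sum_congr rfl fun K _ => ?_
  rw [Finset.sum_sub_distrib, add_sub_assoc, add_sub_assoc, sub_sub, ← Finset.sum_add_distrib]
  congr 2
  exact Finset.sum_congr rfl fun F _ => by ring

/-- Coercivity of `a_h` for a sufficiently large penalty parameter. -/
theorem exists_coercive (d : ℕ) (hd : 1 ≤ d) (k : ℕ) (γ : ℝ) : ∃ β₀ : ℝ, 0 < β₀ ∧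
    ∀ {Ω : Set (Pt d)} {T : Mesh Ω}, T.ShapeRegular γ → ∀ {μ β : ℝ}, 0 < μ → β₀ < β →
      ∀ (v : Vh T k) (vbar : SkelField T), (∀ i F, Continuous (vbar i F)) →
      ∑ K : T.Elem, (μ * energy v K
        + ∑ F ∈ K.bdry, 2 * μ / K.h * (β - β₀) * jumpSq v vbar K F) ≤ ah μ β v vbar v vbar := by
  obtain ⟨C, hC0, hC⟩ := exists_trace_constant d hd k
  -- Adding `1` keeps `M` positive for every `γ`.
  set M : ℝ := |γ| * C + 1 with hM
  have hM0 : 0 < M := by positivity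
  refine ⟨2 * (d + 1) * M, by positivity, fun {Ω T} hT {μ β} hμ hβ v vbar hv => ?_⟩
  rw [ah_self_eq]
  refine Finset.sum_le_sum fun K _ => ?_
  have hh := K.h_pos hd
  have hE := energy_nonneg v K
  -- With `θ = β₀⁻¹` each facet consumes at most `μ / (d + 1)` of the energy coefficient. The at
  -- most `d + 1` facets together leave `μ` out of `2 μ`, and the penalty retains `β - β₀`.
  set θ : ℝ := (2 * (d + 1) * M)⁻¹ with hθ
  have hθ0 : 0 < θ := by positivity
  have hF : ∀ F ∈ K.bdry, 2 * μ / K.h * (β - 2 * (d + 1) * M) * jumpSq v vbar K F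
      - μ / (d + 1) * energy v K ≤ 2 * β * μ / K.h * jumpSq v vbar K F
        - 2 * μ * (2 * ∫ x, ∑ i, epsn v K F i x * jmp v vbar K F i x ∂F.surf) := by
    intro F hF
    have h1 := two_mul_integral_epsn_jmp_le hd (hC hT) v hv hF hθ0
    have h2 : θ * (|γ| * C) * energy v K ≤ θ * M * energy v K := by
      gcongr
      linarith
    have h3 : θ * M = (2 * ((d : ℝ) + 1))⁻¹ := by rw [hθ]; field_simp
    have h4 : (θ * K.h)⁻¹ = 2 * (d + 1) * M / K.h := by rw [hθ]; field_simp
    rw [h3] at h2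
    rw [h4] at h1
    have h5 := mul_le_mul_of_nonneg_left (h1.trans (add_le_add_left h2 _))
      (by positivity : 0 ≤ 2 * μ)
    have h6 : 2 * μ * ((2 * ((d : ℝ) + 1))⁻¹ * energy v K
        + 2 * (d + 1) * M / K.h * jumpSq v vbar K F)
        = μ / (d + 1) * energy v K + 2 * μ / K.h * (2 * (d + 1) * M) * jumpSq v vbar K F := by
      field_simp
    have h7 : 2 * β * μ / K.h * jumpSq v vbar K F = 2 * μ / K.h * β * jumpSq v vbar K F := by ring
    rw [h6] at h5
    rw [h7]
    linarith
  have hsum := Finset.sum_le_sum hF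
  rw [Finset.sum_sub_distrib, Finset.sum_const, nsmul_eq_mul] at hsum
  have hcard : (K.bdry.card : ℝ) * (μ / (d + 1) * energy v K) ≤ μ * energy v K := by
    have h1 : (K.bdry.card : ℝ) ≤ d + 1 := by exact_mod_cast K.card_bdry_le
    calc (K.bdry.card : ℝ) * (μ / (d + 1) * energy v K)
        ≤ (d + 1) * (μ / (d + 1) * energy v K) := by gcongr
      _ = μ * energy v K := by field_simp
  linarith

lemma eps_eq_zero_of_energy (v : Vh T k) (K : T.Elem) (h : energy v K = 0) (i j : Fin d) :
    MvPolynomial.pderiv j (v K i).1 + MvPolynomial.pderiv i (v K j).1 = 0 := by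
  rw [energy_eq_sum, Finset.sum_eq_zero_iff_of_nonneg fun i _ => Finset.sum_nonneg fun j _ =>
    integral_nonneg fun x => sq_nonneg _] at h
  have h1 := h i (Finset.mem_univ i)
  rw [Finset.sum_eq_zero_iff_of_nonneg fun j _ => integral_nonneg fun x => sq_nonneg _] at h1
  have h2 := h1 j (Finset.mem_univ j)
  rw [K.set_eq] at h2
  exact (smul_eq_zero.1 (eq_zero_of_setIntegral_simplexSet_sq h2)).resolve_left (by norm_num)

/-- A function on a facet that is a polynomial and whose square has vanishing integral is zero. -/
lemma val_eq_zero_of_integral_surf (hd : 1 ≤ d) {F : T.Facet} {r : MvPolynomial (Fin d) ℝ}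
    (h : ∫ x, val r x.1 ^ 2 ∂F.surf = 0) (x : F.set) : val r x.1 = 0 := by
  obtain ⟨K, hK⟩ := F.exists_elem
  obtain ⟨c, hc⟩ := Mesh.exists_isOpposite hK
  obtain ⟨a, ha⟩ := Mesh.IsOpposite.exists_ne hd c
  rw [F.integral_surf fun x => val r x ^ 2, hc.set_eq] at h
  exact val_eq_zero_of_setIntegral_simplexFacet (hc.isFacetNormal hd) ha h x.1 (hc.set_eq ▸ x.2)

/-- On a facet the jump is itself the restriction of a polynomial, so vanishing in `L²` means
vanishing pointwise. -/
lemma jmp_eq_zero_of_jumpSq (hd : 1 ≤ d) (v : Vh T k) {vbar : SkelField T}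
    (hv : ∀ i F, vbar i F ∈ facetPoly k F) {K : T.Elem} {F : T.Facet}
    (h : jumpSq v vbar K F = 0) (i : Fin d) (x : F.set) : vbar i F x = val (v K i).1 x.1 := by
  have hc : ∀ i, Continuous fun x => jmp v vbar K F i x ^ 2 := fun i =>
    (continuous_jmp v (fun i F => continuous_of_mem_facetPoly (hv i F)) K F i).pow 2
  rw [jumpSq, integral_finsetSum _ fun i _ => F.integrable_surf hd (hc i),
    Finset.sum_eq_zero_iff_of_nonneg fun i _ => integral_nonneg fun x => sq_nonneg _] at h
  obtain ⟨p, hp⟩ := exists_eq_val_of_mem_facetPoly (hv i F)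
  have hj : ∀ x, jmp v vbar K F i x = val ((v K i).1 - p.1) x.1 := fun x => by
    rw [jmp, hp]; exact (map_sub (MvPolynomial.eval _) _ _).symm
  have h1 := h i (Finset.mem_univ i)
  simp only [hj] at h1
  have h2 := val_eq_zero_of_integral_surf hd h1 x
  rw [← hj, jmp, sub_eq_zero] at h2
  exact h2.symm

end Coercivity

/-! ### Kernels of the discrete operators -/

section Kernels

variable {d : ℕ} {Ω : Set (Pt d)} {T : Mesh Ω} {k : ℕ} {ΓD : Set (Pt d)} {m : Method}

/-- Positive measure makes `Γ` nonempty, so the union of facets that exhausts its closure cannot be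
empty. -/
lemma Mesh.Resolves.exists_liesOn {Γ Γ' : Set (Pt d)} (h : T.Resolves Γ)
    (hΓ : IsBoundaryPartition Ω Γ Γ') : ∃ F : T.Facet, F.LiesOn Γ := by
  have hne : (closure Γ).Nonempty := (nonempty_of_measure_ne_zero hΓ.pos.ne').closure
  rw [h] at hne
  obtain ⟨x, hx⟩ := hne
  obtain ⟨F, -⟩ := Set.mem_iUnion.1 hx
  exact ⟨F.1, F.2⟩

lemma Mesh.IsOpposite.basis_mem {K : T.Elem} {F : T.Facet} {c : K.1} (h : Mesh.IsOpposite K F c)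
    {a : K.1} (ha : a ≠ c) : K.basis a ∈ F.set :=
  subset_convexHull ℝ _ ((h.mem_iff _).2 ⟨a.2, fun h => ha (Subtype.ext h)⟩)

lemma Mesh.Facet.nonempty_set (hd : 1 ≤ d) (F : T.Facet) : F.set.Nonempty :=
  convexHull_nonempty_iff.2 (Finset.coe_nonempty.2 (Finset.card_pos.1 (by rw [F.2.2]; omega)))

/-- A displacement with vanishing strains and jumps that is clamped on a facet is zero. -/
lemma eq_zero_of_energy_of_jumpSq (hd : 1 ≤ d) (hΩ : IsPolygonalDomain Ω) (v : VV T k ΓD m)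
    (hE : ∀ K, energy v.1 K = 0) (hJ : ∀ K, ∀ F ∈ K.bdry, jumpSq v.1 v.2.toField K F = 0)
    (hD : ∃ F : T.Facet, F.LiesOn ΓD) : v = 0 := by
  have hjump : ∀ K, ∀ F ∈ K.bdry, ∀ i (x : F.set), v.2.toField i F x = val (v.1 K i).1 x.1 :=
    fun K F hF i x => jmp_eq_zero_of_jumpSq hd v.1 (toField_mem_facetPoly v.2) (hJ K F hF) i x
  have hfacet : ∀ K, ∀ F ∈ K.bdry, (∀ i, v.2.toField i F = 0) → v.1 K = 0 := by
    intro K F hF h0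
    obtain ⟨c, hc⟩ := Mesh.exists_isOpposite hF
    have h1 := eq_zero_of_eps_eq_zero (b := K.basis) (c := c) (u := fun i => (v.1 K i).1)
      (fun i j => eps_eq_zero_of_energy v.1 K (hE K) i j) fun a ha i => by
        have h2 := hjump K F hF i ⟨_, hc.basis_mem ha⟩
        rw [h0 i] at h2
        exact h2.symm
    exact funext fun i => Subtype.ext (h1 i)
  have hall : ∀ K, v.1 K = 0 := by
    -- The trace `v̄` is single-valued on a facet. A zero displacement on one side makes it zero
    -- there, which clamps the neighbour.
    refine Mesh.forall_elem_of_adjacent hΩ (fun K => v.1 K = 0) (fun K K' F hF hF' hK => ?_) ?_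
    · refine hfacet K' F hF' fun i => funext fun x => ?_
      rw [hjump K F hF, hK]
      exact val_zero _
    · obtain ⟨F, hF⟩ := hD
      obtain ⟨K, hK⟩ := F.exists_elem
      exact ⟨K, hfacet K F hK fun i => toField_eq_zero v.2 i F hF⟩
  refine Prod.ext (funext hall) (funext fun i => Subtype.ext (funext fun F => funext fun x => ?_))
  obtain ⟨K, hK⟩ := F.exists_elem
  refine (hjump K F hK i x).trans ?_
  rw [hall K]
  exact val_zero _

/-- The form `b_h` tested with a field that is supported on one element and has a fixed direction. -/
lemma bh_single [DecidableEq T.Elem] {l : ℕ} (p : T.Elem → Poly d l) (pbar : SkelFun T)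
    (K : T.Elem) (q : Poly d k) (t : Pt d) :
    bh (Pi.single K fun i => t i • q) 0 p pbar
      = -(∫ x in K.set, val (p K).1 x * val (dirDeriv t q.1) x)
        + ∑ F ∈ K.bdry, inner ℝ (K.normal F) t * ∫ x, pbar F x * val q.1 x.1 ∂F.surf := by
  set w : Vh T k := Pi.single K fun i => t i • q with hw
  have hwK : w K = fun i => t i • q := Pi.single_eq_same _ _
  have hw0 : ∀ K', K' ≠ K → w K' = 0 := fun K' h => Pi.single_eq_of_ne h _
  have hin : ∀ n : Pt d, inner ℝ n t = ∑ i, t i * n i := fun n => by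
    rw [PiLp.inner_apply]
    exact Finset.sum_congr rfl fun i _ => by simp
  rw [bh]
  congr 1
  · rw [neg_inj, Finset.sum_eq_single K]
    · have h1 : divg w K = dirDeriv t q.1 := by
        rw [divg, hwK, dirDeriv_apply]
        exact Finset.sum_congr rfl fun i _ => Derivation.map_smul _ _ _
      rw [h1]
    · intro K' _ hK'
      have h1 : divg w K' = 0 := by
        rw [divg, hw0 K' hK']
        exact Finset.sum_eq_zero fun i _ => map_zero _
      simp only [h1, val_zero, mul_zero, integral_zero]
    · simp
  · rw [Finset.sum_eq_single K]
    · refine Finset.sum_congr rfl fun F _ => ?_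
      rw [← integral_const_mul]
      refine integral_congr_ae (Filter.Eventually.of_forall fun x => ?_)
      have h1 : ∀ i, jmp w 0 K F i x = t i * val q.1 x.1 := fun i => by
        rw [jmp, hwK]
        exact (sub_zero _).trans (val_smul _ _ _)
      simp only [h1]
      rw [hin, Finset.mul_sum, Finset.sum_mul]
      exact Finset.sum_congr rfl fun i _ => by ring
    · intro K' _ hK'
      have h1 : ∀ F i x, jmp w 0 K' F i x = 0 := fun F i x => by
        rw [jmp, hw0 K' hK']
        exact (sub_zero _).trans (val_zero _)
      simp only [h1, zero_mul, Finset.sum_const_zero, mul_zero, integral_zero]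
    · simp

/-- If `b_h((w, 0), (p, p̄))` vanishes for all `w`, then on every element `p` is constant and `p̄`
takes the same constant value on the boundary of the element. -/
theorem exists_eq_C_of_bh_eq_zero (hd : 1 ≤ d) (hk : 1 ≤ k) {p : T.Elem → Poly d (k - 1)}
    {pbar : SkelFun T} (hpbar : ∀ F, pbar F ∈ facetPoly k F)
    (h : ∀ w : Vh T k, bh w 0 p pbar = 0) (K : T.Elem) :
    ∃ κ : ℝ, (p K).1 = MvPolynomial.C κ ∧ ∀ F ∈ K.bdry, ∀ x, pbar F x = κ := by
  classical
  have htest : ∀ (q : Poly d k) (t : Pt d), ∫ x in K.set, val (p K).1 x * val (dirDeriv t q.1) x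
      = ∑ F ∈ K.bdry, inner ℝ (K.normal F) t * ∫ x, pbar F x * val q.1 x.1 ∂F.surf := by
    intro q t
    have h1 := h (Pi.single K fun i => t i • q)
    rw [bh_single] at h1
    linarith
  -- facets on which the test field has no normal component do not contribute
  have hfacet : ∀ (q : Poly d k) {F : T.Facet} {c : K.1}, Mesh.IsOpposite K F c → ∀ a c' : K.1,
      (a = c ∨ c' = c → ∀ x ∈ simplexFacet K.basis c, val q.1 x = 0) →
      inner ℝ (K.normal F) (K.basis c' - K.basis a) * ∫ x, pbar F x * val q.1 x.1 ∂F.surf = 0 := by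
    intro q F c hc a c' hq
    by_cases hac : a = c ∨ c' = c
    · have h1 : ∀ x : F.set, pbar F x * val q.1 x.1 = 0 := fun x => by
        rw [hq hac x.1 (hc.set_eq ▸ x.2), mul_zero]
      simp only [h1, integral_zero, mul_zero]
    · push Not at hac
      rw [(hc.isFacetNormal hd).orth c' a hac.2 hac.1, zero_mul]
  have hN : ∀ c : K.1, ∃ n, IsFacetNormal K.basis c n := fun c => by
    obtain ⟨F, -, hF⟩ := Mesh.exists_facet_isOpposite hd K c
    exact ⟨_, hF.isFacetNormal hd⟩
  obtain ⟨a₀, ha₀⟩ : K.1.Nonempty := Finset.card_pos.1 (by rw [K.2.2]; omega)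
  obtain ⟨κ, hκ⟩ : ∃ κ, (p K).1 = MvPolynomial.C κ := by
    have hpdeg := totalDegree_le_of_poly (p K)
    -- For `k = 1` the polynomial already has degree zero. Otherwise two barycentric factors and one
    -- derivative of a polynomial of degree at most `k - 1` give an admissible test field of degree
    -- at most `k`.
    by_cases hk1 : k = 1
    · exact ⟨_, MvPolynomial.totalDegree_eq_zero_iff_eq_C.1 (by omega)⟩
    refine ⟨_, eq_C_of_bubble (b := K.basis) hN ⟨a₀, ha₀⟩ fun c hc => ?_⟩
    set a : K.1 := ⟨a₀, ha₀⟩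
    set t := K.basis c - K.basis a with ht
    have hq : (baryPoly K.basis a * (baryPoly K.basis c * dirDeriv t (p K).1)).totalDegree ≤ k := by
      refine (MvPolynomial.totalDegree_mul _ _).trans ?_
      have h1 := MvPolynomial.totalDegree_mul (baryPoly K.basis c) (dirDeriv t (p K).1)
      have h2 := totalDegree_baryPoly_le (b := K.basis) a
      have h3 := totalDegree_baryPoly_le (b := K.basis) c
      have h4 := totalDegree_dirDeriv_le t (p K).1
      omega
    have h1 := htest ⟨_, (MvPolynomial.mem_restrictTotalDegree _ _ _).2 hq⟩ t
    rw [← K.set_eq, h1]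
    refine Finset.sum_eq_zero fun F hF => ?_
    obtain ⟨c', hc'⟩ := Mesh.exists_isOpposite hF
    refine hfacet _ hc' a c fun hac x hx => ?_
    rw [val_mul, val_mul, val_baryPoly, val_baryPoly]
    rcases hac with rfl | rfl
    · rw [hx.1, zero_mul]
    · rw [hx.1, zero_mul, mul_zero]
  refine ⟨κ, hκ, fun F hF => ?_⟩
  obtain ⟨c, hc⟩ := Mesh.exists_isOpposite hF
  have hn := hc.isFacetNormal hd
  obtain ⟨r', hr'⟩ := exists_eq_val_of_mem_facetPoly (hpbar F)
  set r := r'.1 - MvPolynomial.C κ with hr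
  have hval : ∀ x, val r x = val r'.1 x - κ := fun x => by
    rw [hr]; exact (map_sub (MvPolynomial.eval _) _ _).trans (by rw [MvPolynomial.eval_C]; rfl)
  have hint : ∀ q q' : MvPolynomial (Fin d) ℝ,
      Integrable (fun x : F.set => val q x.1 * val q' x.1) F.surf := fun q q' =>
    F.integrable_surf hd (((continuous_val q).mul (continuous_val q')).comp continuous_subtype_val)
  -- Test with `λ_a s` in the direction `b c - b a`. It vanishes on the facet opposite to `a` and
  -- has no normal component on the others except `F`. The divergence formula turns the volume term
  -- into `κ` times the same integral over `F`, so `p̄ - κ` is orthogonal to `λ_a s`.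
  have key : ∀ (a : K.1) (s : Poly d (k - 1)),
      ∫ x, val r x.1 * val (baryPoly K.basis a * s.1) x.1 ∂F.surf = 0 := by
    intro a s
    by_cases ha : a = c
    · have h1 : ∀ x : F.set, val r x.1 * val (baryPoly K.basis a * s.1) x.1 = 0 := fun x => by
        have hx : x.1 ∈ simplexFacet K.basis c := hc.set_eq ▸ x.2
        rw [val_mul, val_baryPoly, ha, hx.1, zero_mul, mul_zero]
      simp only [h1, integral_zero]
    have hq : (baryPoly K.basis a * s.1).totalDegree ≤ k := by
      refine (MvPolynomial.totalDegree_mul _ _).trans ?_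
      have h2 := totalDegree_baryPoly_le (b := K.basis) a
      have h3 := totalDegree_le_of_poly s
      omega
    set q : Poly d k := ⟨_, (MvPolynomial.mem_restrictTotalDegree _ _ _).2 hq⟩ with hqdef
    have h1 := htest q (K.basis c - K.basis a)
    rw [Finset.sum_eq_single F] at h1
    · have hpos := hc.inner_normal_pos hd ha
      have hneg : inner ℝ (K.normal F) (K.basis c - K.basis a)
          = -inner ℝ (K.normal F) (K.basis a - K.basis c) := by
        rw [← inner_neg_right, neg_sub]
      have h2 := setIntegral_dirDeriv_baryPoly_mul hn ha s.1
      rw [hneg, abs_neg, abs_of_pos hpos, ← hc.set_eq, ← K.set_eq,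
        ← F.integral_surf fun y => K.basis.coord a y * val s.1 y] at h2
      simp only [hκ, val_C, integral_const_mul, hqdef] at h1
      rw [hneg, h2] at h1
      simp only [hr'] at h1
      have h3 : ∫ x : F.set, K.basis.coord a x.1 * val s.1 x.1 ∂F.surf
          = ∫ x : F.set, val (baryPoly K.basis a * s.1) x.1 ∂F.surf := by
        simp only [val_mul, val_baryPoly]
      have h4 : ∫ x : F.set, val r x.1 * val (baryPoly K.basis a * s.1) x.1 ∂F.surf
          = (∫ x : F.set, val r'.1 x.1 * val (baryPoly K.basis a * s.1) x.1 ∂F.surf)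
            - κ * ∫ x : F.set, val (baryPoly K.basis a * s.1) x.1 ∂F.surf := by
        have hi : Integrable (fun x : F.set => κ * val (baryPoly K.basis a * s.1) x.1) F.surf :=
          (F.integrable_surf hd ((continuous_val _).comp continuous_subtype_val)).const_mul _
        rw [← integral_const_mul, ← integral_sub (hint _ _) hi]
        simp only [hval, sub_mul]
      rw [h3] at h1
      rw [h4]
      have h5 : inner ℝ (K.normal F) (K.basis a - K.basis c) *
          ((∫ x : F.set, val r'.1 x.1 * val (baryPoly K.basis a * s.1) x.1 ∂F.surf)
            - κ * ∫ x : F.set, val (baryPoly K.basis a * s.1) x.1 ∂F.surf) = 0 := by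
        linarith
      exact (mul_eq_zero.1 h5).resolve_left hpos.ne'
    · intro F' hF' hne
      obtain ⟨c', hc'⟩ := Mesh.exists_isOpposite hF'
      refine hfacet q hc' a c fun hac x hx => ?_
      rcases hac with rfl | rfl
      · change val (baryPoly K.basis a * s.1) x = 0
        rw [val_mul, val_baryPoly, hx.1, zero_mul]
      · refine absurd (Subtype.ext (Finset.ext fun x => ?_)) hne
        rw [hc'.mem_iff, hc.mem_iff]
    · exact fun hnot => absurd hF hnot
  have hrdeg : r.totalDegree ≤ k - 1 + 1 := by
    refine (MvPolynomial.totalDegree_sub _ _).trans (max_le ?_ ?_)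
    · exact (totalDegree_le_of_poly r').trans (by omega)
    · rw [MvPolynomial.totalDegree_C]; exact Nat.zero_le _
  -- Since `r` has degree at most `k`, it is a sum of products `λ_i s_i`. It is therefore orthogonal
  -- to itself on `F`.
  obtain ⟨s, hs⟩ := exists_eq_sum_baryPoly_mul K.basis hrdeg
  have hzero : ∫ x : F.set, val r x.1 ^ 2 ∂F.surf = 0 := by
    have h1 : ∀ x, val r x ^ 2 = ∑ i, val r x * val (baryPoly K.basis i * (s i).1) x := fun x => by
      rw [← Finset.mul_sum, ← val_sum, ← hs, sq]
    simp only [h1]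
    rw [integral_finsetSum _ fun i _ => hint _ _]
    exact Finset.sum_eq_zero fun i _ => key i (s i)
  intro x
  have h1 := val_eq_zero_of_integral_surf hd hzero x
  rw [hval, ← hr'] at h1
  linarith

/-- The kernel of the transpose of `b_h((·, 0), ·)` is trivial on pressures that vanish on a
facet. -/
lemma eq_zero_of_bh_eq_zero (hd : 1 ≤ d) (hk : 1 ≤ k) (hΩ : IsPolygonalDomain Ω)
    {Γ : Set (Pt d)} (q : QQ0 T k Γ) (hΓ : ∃ F : T.Facet, F.LiesOn Γ)
    (h : ∀ w : Vh T k, bh w 0 q.1 q.2.1 = 0) : q = 0 := by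
  choose κ hκ hκ' using exists_eq_C_of_bh_eq_zero hd hk q.2.2.1 h
  have hall : ∀ K, κ K = 0 := by
    refine Mesh.forall_elem_of_adjacent hΩ (fun K => κ K = 0) (fun K K' F hF hF' hK => ?_) ?_
    · obtain ⟨x, hx⟩ := F.nonempty_set hd
      rw [← hκ' K' F hF' ⟨x, hx⟩, hκ' K F hF ⟨x, hx⟩, hK]
    · obtain ⟨F, hF⟩ := hΓ
      obtain ⟨K, hK⟩ := F.exists_elem
      obtain ⟨x, hx⟩ := F.nonempty_set hd
      exact ⟨K, by rw [← hκ' K F hK ⟨x, hx⟩, q.2.2.2 F hF]; rfl⟩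
  refine Prod.ext (funext fun K => Subtype.ext ?_)
    (Subtype.ext (funext fun F => funext fun x => ?_))
  · rw [hκ, hall, MvPolynomial.C_0]; rfl
  · obtain ⟨K, hK⟩ := F.exists_elem
    rw [hκ' K F hK, hall]; rfl

/-! ### Definiteness of the inner products on the discrete spaces. -/

lemma eq_zero_of_ipQ_self {l : ℕ} {p : T.Elem → Poly d l} (h : ipQ p p = 0) : p = 0 := by
  rw [ipQ, Finset.sum_eq_zero_iff_of_nonneg fun K _ =>
    integral_nonneg fun x => mul_self_nonneg _] at h
  refine funext fun K => Subtype.ext (eq_zero_of_setIntegral_simplexSet_sq (b := K.basis) ?_)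
  rw [← K.set_eq]
  simpa only [sq] using h K (Finset.mem_univ K)

lemma ipQ_self_nonneg {l : ℕ} (p : T.Elem → Poly d l) : 0 ≤ ipQ p p :=
  Finset.sum_nonneg fun _ _ => integral_nonneg fun _ => mul_self_nonneg _

lemma ipV_self_nonneg (z : Vh T k) : 0 ≤ ipV z z :=
  Finset.sum_nonneg fun _ _ => integral_nonneg fun _ =>
    Finset.sum_nonneg fun _ _ => mul_self_nonneg _

lemma eq_zero_of_ipV_self {z : Vh T k} (h : ipV z z = 0) : z = 0 := by
  rw [ipV, Finset.sum_eq_zero_iff_of_nonneg fun K _ =>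
    integral_nonneg fun x => Finset.sum_nonneg fun _ _ => mul_self_nonneg _] at h
  refine funext fun K => funext fun i => Subtype.ext
    (eq_zero_of_setIntegral_simplexSet_sq (b := K.basis) ?_)
  have h1 := h K (Finset.mem_univ K)
  have hi : ∀ i, IntegrableOn (fun x => val (z K i).1 x * val (z K i).1 x) K.set := fun i =>
    K.integrableOn ((continuous_val _).mul (continuous_val _))
  rw [integral_finsetSum _ fun i _ => hi i, Finset.sum_eq_zero_iff_of_nonneg fun i _ => integral_nonneg fun x => mul_self_nonneg _] at h1
  rw [← K.set_eq]
  simpa only [sq] using h1 i (Finset.mem_univ i)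

end Kernels

/-! ### The discrete problem -/

section DiscreteProblem

lemma isLin_zero {X : Type*} [AddCommGroup X] [Module ℝ X] : IsLin fun _ : X => (0 : ℝ) :=
  ⟨fun _ _ => (add_zero 0).symm, fun r _ => (mul_zero r).symm⟩

/-- Unique solvability of a nondegenerate square system of four coupled variational equations. -/
lemma IsBil.existsUnique_four {X A B C D : Type*} [AddCommGroup X] [Module ℝ X]
    [AddCommGroup A] [Module ℝ A] [AddCommGroup B] [Module ℝ B] [AddCommGroup C] [Module ℝ C]
    [AddCommGroup D] [Module ℝ D] (φ : X ≃ₗ[ℝ] A × B × C × D) [FiniteDimensional ℝ X]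
    {e₁ : X → A → ℝ} {e₂ : X → B → ℝ} {e₃ : X → C → ℝ} {e₄ : X → D → ℝ}
    (h₁ : IsBil e₁) (h₂ : IsBil e₂) (h₃ : IsBil e₃) (h₄ : IsBil e₄)
    {g₁ : A → ℝ} {g₂ : B → ℝ} {g₃ : C → ℝ} {g₄ : D → ℝ}
    (hg₁ : IsLin g₁) (hg₂ : IsLin g₂) (hg₃ : IsLin g₃) (hg₄ : IsLin g₄)
    (h0 : ∀ x, (∀ a, e₁ x a = 0) → (∀ b, e₂ x b = 0) → (∀ c, e₃ x c = 0) → (∀ d, e₄ x d = 0) →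
      x = 0) :
    ∃! x, (∀ a, e₁ x a = g₁ a) ∧ (∀ b, e₂ x b = g₂ b) ∧ (∀ c, e₃ x c = g₃ c) ∧
      ∀ d, e₄ x d = g₄ d := by
  set f : X → X → ℝ := fun x y =>
    e₁ x (φ y).1 + (e₂ x (φ y).2.1 + (e₃ x (φ y).2.2.1 + e₄ x (φ y).2.2.2)) with hf
  -- Adding the four equations loses nothing: setting all test components but one to zero recovers
  -- each of them.
  have hsplit : ∀ {k₁ : A → ℝ} {k₂ : B → ℝ} {k₃ : C → ℝ} {k₄ : D → ℝ}, IsLin k₁ → IsLin k₂ →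
      IsLin k₃ → IsLin k₄ → ∀ x,
      (∀ y, f x y = k₁ (φ y).1 + (k₂ (φ y).2.1 + (k₃ (φ y).2.2.1 + k₄ (φ y).2.2.2))) ↔
      (∀ a, e₁ x a = k₁ a) ∧ (∀ b, e₂ x b = k₂ b) ∧ (∀ c, e₃ x c = k₃ c) ∧
        ∀ d, e₄ x d = k₄ d := by
    intro k₁ k₂ k₃ k₄ hk₁ hk₂ hk₃ hk₄ x
    refine ⟨fun h => ⟨fun a => ?_, fun b => ?_, fun c => ?_, fun d => ?_⟩,
      fun ⟨i₁, i₂, i₃, i₄⟩ y => by simp only [hf, i₁, i₂, i₃, i₄]⟩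
    · simpa [hf, (h₂.right x).zero, (h₃.right x).zero, (h₄.right x).zero, hk₂.zero, hk₃.zero,
        hk₄.zero] using h (φ.symm (a, 0, 0, 0))
    · simpa [hf, (h₁.right x).zero, (h₃.right x).zero, (h₄.right x).zero, hk₁.zero, hk₃.zero,
        hk₄.zero] using h (φ.symm (0, b, 0, 0))
    · simpa [hf, (h₁.right x).zero, (h₂.right x).zero, (h₄.right x).zero, hk₁.zero, hk₂.zero,
        hk₄.zero] using h (φ.symm (0, 0, c, 0))
    · simpa [hf, (h₁.right x).zero, (h₂.right x).zero, (h₃.right x).zero, hk₁.zero, hk₂.zero,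
        hk₃.zero] using h (φ.symm (0, 0, 0, d))
  have hbil : IsBil f := by
    have hφ : ∀ {k : A × B × C × D → ℝ}, IsLin k → IsLin fun y => k (φ y) := fun hk =>
      hk.comp φ.toLinearMap
    refine ⟨fun y => ?_, fun x => ?_⟩
    · exact (h₁.left _).add' ((h₂.left _).add' ((h₃.left _).add' (h₄.left _)))
    · exact hφ ((h₁.right x).fst.add' (((h₂.right x).fst.add'
        ((h₃.right x).fst.add' (h₄.right x).snd).snd).snd))
  have hglin : IsLin fun y => g₁ (φ y).1 + (g₂ (φ y).2.1 + (g₃ (φ y).2.2.1 + g₄ (φ y).2.2.2)) :=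
    (hg₁.fst.add' ((hg₂.fst.add' (hg₃.fst.add' hg₄.snd).snd).snd)).comp φ.toLinearMap
  have key := hbil.existsUnique (fun x hx => by
    have h := (hsplit isLin_zero isLin_zero isLin_zero isLin_zero x).1
      (fun y => by rw [hx y]; simp)
    exact h0 x h.1 h.2.1 h.2.2.1 h.2.2.2) hglin
  simpa only [hsplit hg₁ hg₂ hg₃ hg₄] using key

/-- A relation that is a function in each of `N` steps has exactly one orbit of length `N` from every
starting point. -/
lemma existsUnique_orbit {X : Type*} {N : ℕ} {R : ℕ → X → X → Prop}
    (h : ∀ n < N, ∀ a, ∃! b, R n a b) (x₀ : X) :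
    ∃! x : Fin (N + 1) → X, x 0 = x₀ ∧ ∀ n : Fin N, R n (x n.castSucc) (x n.succ) := by
  choose! F hF huniq using h
  let s : ℕ → X := fun n => Nat.rec x₀ (fun n a => F n a) n
  refine ⟨fun i => s i, ⟨rfl, fun n => hF n n.2 (s n)⟩, fun y hy => funext fun i => ?_⟩
  induction i using Fin.induction with
  | zero => exact hy.1
  | succ n ih =>
    rw [huniq n n.2 _ _ (hy.2 n), ih]
    rfl

variable {d : ℕ} {Ω : Set (Pt d)} {T : Mesh Ω} {k : ℕ} {ΓD ΓP : Set (Pt d)} {m : Method}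

/-- The pairs `(w, 0)` form a linear subspace of the pair space for any boundary part and either
method, so the choice `∅` and `.hdg` is harmless. -/
lemma isBil_bh_zero (hd : 1 ≤ d) {l l' : ℕ} {Γ : Set (Pt d)} :
    IsBil fun (w : Vh T k) (q : (T.Elem → Poly d l) × skelPoly T l' Γ) => bh w 0 q.1 q.2.1 := by
  have h := isBil_bh (T := T) (k := k) (l := l) (l' := l') (Γ := Γ) (ΓD := ∅) (m := .hdg) hd
  refine ⟨fun q => ⟨fun w w' => ?_, fun c w => ?_⟩, fun w => h.right (w, 0)⟩
  · have h1 := (h.left q).add (w, 0) (w', 0)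
    rw [Prod.mk_add_mk, add_zero] at h1
    exact h1
  · have h1 := (h.left q).smul c (w, 0)
    rw [Prod.smul_mk, smul_zero] at h1
    exact h1

/-- The homogeneous discrete problem only has the trivial solution. -/
lemma eq_zero_of_homogeneous (hd : 1 ≤ d) (hk : 1 ≤ k) (hΩ : IsPolygonalDomain Ω)
    (hD : ∃ F : T.Facet, F.LiesOn ΓD) (hP : ∃ F : T.Facet, F.LiesOn ΓP) (c : Coeffs)
    {β₀ β dt : ℝ} (hβ : β₀ < β) (hdt : 0 < dt)
    (hcoer : ∀ (v : Vh T k) (vbar : SkelField T), (∀ i F, Continuous (vbar i F)) →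
      ∑ K : T.Elem, (c.mu * energy v K
        + ∑ F ∈ K.bdry, 2 * c.mu / K.h * (β - β₀) * jumpSq v vbar K F)
        ≤ ah c.mu β v vbar v vbar)
    {u : VV T k ΓD m} {pT : QQ T k} {z : Vh T k} {p : QQ0 T k ΓP}
    (h1 : ∀ v : VV T k ΓD m, ah c.mu β u.1 u.2.toField v.1 v.2.toField
      + bh v.1 v.2.toField pT.1 pT.2.1 = 0)
    (h2 : ∀ qT : QQ T k, bh u.1 u.2.toField qT.1 qT.2.1
      + c.lam⁻¹ * ipQ (c.alpha • p.1 - pT.1) qT.1 = 0)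
    (h3 : ∀ w : Vh T k, c.kappa⁻¹ * ipV z w + bh w 0 p.1 p.2.1 = 0)
    (h4 : ∀ q : QQ0 T k ΓP, 1 / dt * (c.c0 * ipQ p.1 q.1
      + c.lam⁻¹ * ipQ (c.alpha • p.1 - pT.1) (c.alpha • q.1)) - bh z 0 q.1 q.2.1 = 0) :
    u = 0 ∧ pT = 0 ∧ z = 0 ∧ p = 0 := by
  have hmu := c.mu_pos
  have hlam := inv_pos.2 c.lam_pos
  have hkap := inv_pos.2 c.kappa_pos
  set e := c.alpha • p.1 - pT.1 with he
  -- Writing `α p = e + p_T` exposes the square of `e`. The remaining term `(e, p_T)` cancels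
  -- against the total pressure equation.
  have hαp : ipQ e (c.alpha • p.1) = ipQ e e + ipQ e pT.1 := by
    rw [← (isBil_ipQ.right e).add, he, sub_add_cancel]
  have hterm : ∀ K : T.Elem, 0 ≤ c.mu * energy u.1 K
      + ∑ F ∈ K.bdry, 2 * c.mu / K.h * (β - β₀) * jumpSq u.1 u.2.toField K F := fun K => by
    have hh := K.h_pos hd
    have hβ' := sub_pos.2 hβ
    exact add_nonneg (mul_nonneg hmu.le (energy_nonneg _ _))
      (Finset.sum_nonneg fun F _ => mul_nonneg (by positivity) (jumpSq_nonneg _ _ _ _))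
  have hco := hcoer u.1 u.2.toField (continuous_toField u.2)
  have ha : 0 ≤ ah c.mu β u.1 u.2.toField u.1 u.2.toField :=
    (Finset.sum_nonneg fun K _ => hterm K).trans hco
  have hee := ipQ_self_nonneg e
  have hpp := ipQ_self_nonneg p.1
  have hzz := ipV_self_nonneg z
  have i1 := h1 u
  have i2 := h2 pT
  have i3 := h3 z
  have i4 := h4 p
  have hbal : ah c.mu β u.1 u.2.toField u.1 u.2.toField + c.lam⁻¹ * ipQ e e
      + c.c0 * ipQ p.1 p.1 + dt * (c.kappa⁻¹ * ipV z z) = 0 := by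
    have j4 : c.c0 * ipQ p.1 p.1 + c.lam⁻¹ * (ipQ e e + ipQ e pT.1)
        = dt * bh z 0 p.1 p.2.1 := by
      rw [← sub_eq_zero.1 i4, ← mul_assoc, mul_one_div_cancel hdt.ne', one_mul, hαp]
    have j3 : bh z 0 p.1 p.2.1 = -(c.kappa⁻¹ * ipV z z) := by linarith
    rw [j3] at j4
    linarith
  have t1 := mul_nonneg hlam.le hee
  have t2 := mul_nonneg c.c0_nonneg hpp
  have t3 := mul_nonneg hkap.le hzz
  have t4 := mul_nonneg hdt.le t3
  have ha0 : ah c.mu β u.1 u.2.toField u.1 u.2.toField = 0 := by linarith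
  have he0 : e = 0 := eq_zero_of_ipQ_self
    ((mul_eq_zero.1 (by linarith : c.lam⁻¹ * ipQ e e = 0)).resolve_left hlam.ne')
  have hz0 : z = 0 := by
    have h5 : dt * (c.kappa⁻¹ * ipV z z) = 0 := by linarith
    exact eq_zero_of_ipV_self
      ((mul_eq_zero.1 ((mul_eq_zero.1 h5).resolve_left hdt.ne')).resolve_left hkap.ne')
  have hu0 : u = 0 := by
    rw [ha0] at hco
    have hsum := le_antisymm hco (Finset.sum_nonneg fun K _ => hterm K)
    rw [Finset.sum_eq_zero_iff_of_nonneg fun K _ => hterm K] at hsum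
    have hF : ∀ K, ∀ F ∈ K.bdry,
        0 ≤ 2 * c.mu / K.h * (β - β₀) * jumpSq u.1 u.2.toField K F := fun K F _ => by
      have hh := K.h_pos hd
      have hβ' := sub_pos.2 hβ
      exact mul_nonneg (by positivity) (jumpSq_nonneg _ _ _ _)
    have hboth := fun K => (add_eq_zero_iff_of_nonneg (mul_nonneg hmu.le (energy_nonneg u.1 K))
      (Finset.sum_nonneg (hF K))).1 (hsum K (Finset.mem_univ K))
    refine eq_zero_of_energy_of_jumpSq hd hΩ u
      (fun K => (mul_eq_zero.1 (hboth K).1).resolve_left hmu.ne') (fun K F hKF => ?_) hD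
    have h5 := (Finset.sum_eq_zero_iff_of_nonneg (hF K)).1 (hboth K).2 F hKF
    refine (mul_eq_zero.1 h5).resolve_left ?_
    have hh := K.h_pos hd
    have hβ' := sub_pos.2 hβ
    positivity
  -- For `c₀ = 0` the energy balance gives no bound on `p`, so the information comes from Darcy's
  -- law with `z = 0`.
  have hp0 : p = 0 := eq_zero_of_bh_eq_zero hd hk hΩ p hP fun w => by
    have h5 := h3 w
    rwa [hz0, (isBil_ipV.left w).zero, mul_zero, zero_add] at h5
  have hpT1 : pT.1 = 0 := by
    rw [he, hp0, sub_eq_zero] at he0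
    rw [← he0]
    exact smul_zero _
  have hpT0 : pT = 0 := by
    -- No boundary condition is imposed on `p̄_T`. None is needed, because the element part `p_T` is
    -- already zero and fixes the constant on every facet.
    have hker : ∀ w : Vh T k, bh w 0 pT.1 pT.2.1 = 0 := fun w => by
      have h5 := h1 (w, 0)
      rw [hu0] at h5
      have h6 : ah c.mu β (0 : VV T k ΓD m).1 (0 : VV T k ΓD m).2.toField w
          (0 : VbarH T k ΓD m).toField = 0 := ((isBil_ah hd c.mu β).left (w, 0)).zero
      rw [h6, zero_add] at h5
      exact h5
    refine Prod.ext hpT1 (Subtype.ext (funext fun F => funext fun x => ?_))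
    obtain ⟨K, hK⟩ := F.exists_elem
    obtain ⟨κ, hκ, hκ'⟩ := exists_eq_C_of_bh_eq_zero hd hk pT.2.2.1 hker K
    rw [hκ' F hK x]
    rw [hpT1] at hκ
    exact (MvPolynomial.C_eq_zero.1 hκ.symm)
  exact ⟨hu0, hpT0, hz0, hp0⟩

/-! ### The four equations as bilinear forms in the state and the test function. -/

/-- The quantity `α p - p_T` of a state. -/
def excess (a : ℝ) : Xh T k ΓD ΓP m →ₗ[ℝ] (T.Elem → Poly d (k - 1)) where
  toFun x := a • x.2.2.2.1 - x.2.1.1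
  map_add' x y := by
    rw [Prod.snd_add, Prod.snd_add, Prod.snd_add, Prod.fst_add, Prod.fst_add, Prod.fst_add,
      smul_add]
    abel
  map_smul' r x := by
    rw [Prod.smul_snd, Prod.smul_snd, Prod.smul_snd, Prod.smul_fst, Prod.smul_fst, Prod.smul_fst,
      RingHom.id_apply, smul_sub, smul_comm r a]

lemma isBil_momentum (hd : 1 ≤ d) (c : Coeffs) (β : ℝ) :
    IsBil fun (x : Xh T k ΓD ΓP m) (v : VV T k ΓD m) =>
      ah c.mu β x.1.1 x.1.2.toField v.1 v.2.toField + bh v.1 v.2.toField x.2.1.1 x.2.1.2.1 :=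
  ⟨fun v => ((isBil_ah hd c.mu β).left v).fst.add' ((isBil_bh hd).right v).fst.snd,
    fun x => ((isBil_ah hd c.mu β).right x.1).add' ((isBil_bh hd).left x.2.1)⟩

lemma isBil_totalPressure (hd : 1 ≤ d) (c : Coeffs) :
    IsBil fun (x : Xh T k ΓD ΓP m) (q : QQ T k) =>
      bh x.1.1 x.1.2.toField q.1 q.2.1 + c.lam⁻¹ * ipQ (excess c.alpha x) q.1 :=
  ⟨fun q => ((isBil_bh hd).left q).fst.add'
      (((isBil_ipQ.left q.1).comp (excess c.alpha)).const_mul _),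
    fun x => ((isBil_bh hd).right x.1).add'
      ((isBil_ipQ.right (excess c.alpha x)).fst.const_mul _)⟩

lemma isBil_darcy (hd : 1 ≤ d) (c : Coeffs) :
    IsBil fun (x : Xh T k ΓD ΓP m) (w : Vh T k) =>
      c.kappa⁻¹ * ipV x.2.2.1 w + bh w 0 x.2.2.2.1 x.2.2.2.2.1 :=
  ⟨fun w => ((isBil_ipV.left w).fst.snd.snd.const_mul _).add'
      ((isBil_bh_zero hd).right w).snd.snd.snd,
    fun x => ((isBil_ipV.right x.2.2.1).const_mul _).add' ((isBil_bh_zero hd).left x.2.2.2)⟩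

lemma isLin_ipQ_smul {l : ℕ} (a : ℝ) (e : T.Elem → Poly d l) :
    IsLin fun q : T.Elem → Poly d l => ipQ e (a • q) := by
  refine ⟨fun q q' => ?_, fun r q => ?_⟩
  · rw [smul_add, (isBil_ipQ.right e).add]
  · rw [smul_comm, (isBil_ipQ.right e).smul]

/-- The part of the mass balance that stems from the accumulated fluid content. -/
lemma isLin_content (c : Coeffs) (dt : ℝ) (p e : T.Elem → Poly d (k - 1)) :
    IsLin fun q : QQ0 T k ΓP =>
      1 / dt * (c.c0 * ipQ p q.1 + c.lam⁻¹ * ipQ e (c.alpha • q.1)) :=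
  (((isBil_ipQ.right p).fst.const_mul _).add'
    ((isLin_ipQ_smul c.alpha e).fst.const_mul _)).const_mul _

lemma isBil_mass (hd : 1 ≤ d) (c : Coeffs) (dt : ℝ) :
    IsBil fun (x : Xh T k ΓD ΓP m) (q : QQ0 T k ΓP) =>
      1 / dt * (c.c0 * ipQ x.2.2.2.1 q.1 + c.lam⁻¹ * ipQ (excess c.alpha x) (c.alpha • q.1))
        - bh x.2.2.1 0 q.1 q.2.1 :=
  ⟨fun q => ((((isBil_ipQ.left q.1).fst.snd.snd.snd.const_mul _).add'
      (((isBil_ipQ.left (c.alpha • q.1)).comp (excess c.alpha)).const_mul _)).const_mul _).sub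
      ((isBil_bh_zero hd).left q).fst.snd.snd,
    fun x => (isLin_content c dt _ _).sub ((isBil_bh_zero hd).right x.2.2.1)⟩

/-- Unique solvability of one time step. -/
theorem existsUnique_isStep (hd : 1 ≤ d) (hk : 1 ≤ k) (hΩ : IsPolygonalDomain Ω)
    (hD : ∃ F : T.Facet, F.LiesOn ΓD) (hP : ∃ F : T.Facet, F.LiesOn ΓP) (c : Coeffs)
    {β₀ β dt : ℝ} (hβ : β₀ < β) (hdt : 0 < dt)
    (hcoer : ∀ (v : Vh T k) (vbar : SkelField T), (∀ i F, Continuous (vbar i F)) →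
      ∑ K : T.Elem, (c.mu * energy v K
        + ∑ F ∈ K.bdry, 2 * c.mu / K.h * (β - β₀) * jumpSq v vbar K F)
        ≤ ah c.mu β v vbar v vbar)
    {f : Pt d → Pt d} (hf : MemLp f 2 (volume.restrict Ω))
    {g : Pt d → ℝ} (hg : MemLp g 2 (volume.restrict Ω)) (old : Xh T k ΓD ΓP m) :
    ∃! new : Xh T k ΓD ΓP m, IsStep c β dt f g old new := by
  have key := IsBil.existsUnique_four (LinearEquiv.refl ℝ (Xh T k ΓD ΓP m))
    (isBil_momentum hd c β) (isBil_totalPressure hd c) (isBil_darcy hd c) (isBil_mass hd c dt)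
    (isLin_loadV hΩ hf).fst isLin_zero isLin_zero
    ((isLin_content c dt old.2.2.2.1 (excess c.alpha old)).add' (isLin_loadQ hΩ hg).fst)
    fun x h1 h2 h3 h4 => by
      obtain ⟨i1, i2, i3, i4⟩ :=
        eq_zero_of_homogeneous hd hk hΩ hD hP c hβ hdt hcoer h1 h2 h3 h4
      exact Prod.ext i1 (Prod.ext i2 (Prod.ext i3 i4))
  -- After matching on the pairs, `IsStep` unfolds to these four families of equations, with the
  -- contribution of the old state on the right-hand side.
  exact key

end DiscreteProblem

end

end BiotHDG

theorem mainTheorem3 (d : ℕ) (hd : d = 2 ∨ d = 3) (k : ℕ) (hk : 1 ≤ k) (γ : ℝ) :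
    ∃ β₀ : ℝ, 0 < β₀ ∧
      ∀ (Ω ΓD ΓT ΓP ΓF : Set (BiotHDG.Pt d)) (hΩ : BiotHDG.IsPolygonalDomain Ω)
        (hDT : BiotHDG.IsBoundaryPartition Ω ΓD ΓT) (hPF : BiotHDG.IsBoundaryPartition Ω ΓP ΓF)
        (T : BiotHDG.Mesh Ω) (hT : T.ShapeRegular γ)
        (hΓD : T.Resolves ΓD) (hΓT : T.Resolves ΓT) (hΓP : T.Resolves ΓP) (hΓF : T.Resolves ΓF)
        (m : BiotHDG.Method) (c : BiotHDG.Coeffs) (β : ℝ) (hβ : β₀ < β)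
        (Tend : ℝ) (hTend : 0 < Tend) (N : ℕ) (hN : 1 ≤ N)
        (f : ℝ → BiotHDG.Pt d → BiotHDG.Pt d) (g : ℝ → BiotHDG.Pt d → ℝ)
        (hf : ∀ n < N, MemLp (f (BiotHDG.timeLevel Tend N (n + 1))) 2 (volume.restrict Ω))
        (hg : ∀ n < N, MemLp (g (BiotHDG.timeLevel Tend N (n + 1))) 2 (volume.restrict Ω)),
        (∀ n < N, ∀ old : BiotHDG.Xh T k ΓD ΓP m, ∃! new : BiotHDG.Xh T k ΓD ΓP m,
          BiotHDG.IsStep c β (Tend / N) (f (BiotHDG.timeLevel Tend N (n + 1)))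
            (g (BiotHDG.timeLevel Tend N (n + 1))) old new) ∧
        (∀ x₀ : BiotHDG.Xh T k ΓD ΓP m, ∃! x : Fin (N + 1) → BiotHDG.Xh T k ΓD ΓP m,
          x 0 = x₀ ∧ ∀ n : Fin N,
            BiotHDG.IsStep c β (Tend / N) (f (BiotHDG.timeLevel Tend N (n + 1)))
              (g (BiotHDG.timeLevel Tend N (n + 1))) (x n.castSucc) (x n.succ)) := by
  have hd1 : 1 ≤ d := by omega
  -- The threshold is fixed from `d`, `k` and `γ` before any domain, mesh or coefficient is
  -- introduced.
  obtain ⟨β₀, hβ₀, hcoer⟩ := BiotHDG.exists_coercive d hd1 k γ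
  refine ⟨β₀, hβ₀, ?_⟩
  intro Ω ΓD ΓT ΓP ΓF hΩ hDT hPF T hT hΓD hΓT hΓP hΓF m c β hβ Tend hTend N hN f g hf hg
  have hdt : 0 < Tend / N := div_pos hTend (by exact_mod_cast hN)
  have hstep := fun n (hn : n < N) => BiotHDG.existsUnique_isStep (m := m) hd1 hk hΩ
    (hΓD.exists_liesOn hDT) (hΓP.exists_liesOn hPF) c hβ hdt (hcoer hT c.mu_pos hβ) (hf n hn)
    (hg n hn)
  exact ⟨hstep, BiotHDG.existsUnique_orbit hstep⟩
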